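/- **Setting.** Two particles $k\in\{1,2\}$ have masses $m_k>0$ and charges $e_k\neq 0$; the speed of light is $1$. Put $\mathbf v_k(\mathbf p)=\mathbf p/\sqrt{m_k^2+\|\mathbf p\|^2}$ and $\mathbf F(\mathbf x)=\mathbf x/\|\mathbf x\|^3$ for $\mathbf x\in\mathbb R^3\setminus\{0\}$. For a trajectory $t\mapsto\mathbf q_{l,t}$ on a time interval, the advanced and retarded times $t_l^{\pm}(t,\mathbf x)$ of a space-time point $(t,\mathbf x)$ are the solutions, in that interval, of $t_l^\pm=t\pm\|\mathbf x-\mathbf q_{l,t_l^\pm}\|$. The delay system is, for $k\ne l$, $$\dot{\mathbf q}_{k,t}=\mathbf v_k(\mathbf p_{k,t}),\qquad \dot{\mathbf p}_{k,t}=e_ke_l\Big[\mathbf F\big(\mathbf q_{k,t}-\mathbf q_{l,t_l^+(t,\mathbf q_{k,t})}\big)+\mathbf F\big(\mathbf q_{k,t}-\mathbf q_{l,t_l^-(t,\mathbf q_{k,t})}\big)\Big].\tag{1}$$ Derivatives at end points of intervals are one-sided. **Initial data.** Fix $(i,j)=(1,2)$ or $(2,1)$. Initial data are smooth maps $\mathbf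 q^{(0)}_k,\mathbf p_k^{(0)}:[t_k^{(0)},t_k^{(1)}]\to\mathbb R^3$, $t_k^{(0)}<t_k^{(1)}$, $k=1,2$ (the strips), such that: $\mathbf q^{(0)}_{1,t}\ne\mathbf q^{(0)}_{2,t}$ at common times; $\dot{\mathbf q}^{(0)}_{k,t}=\mathbf v_k(\mathbf p^{(0)}_{k,t})$ on $[t_k^{(0)},t_k^{(1)}]$; $t_i^{(0)}$ is the advanced time of $(t_j^{(0)},\mathbf q^{(0)}_{j,t_j^{(0)}})$, $t_j^{(1)}$ that of $(t_i^{(0)},\mathbf q^{(0)}_{i,t_i^{(0)}})$, and $t_i^{(1)}$ that of $(t_j^{(1)},\mathbf q^{(0)}_{j,t_j^{(1)}})$; and the equations (1) for particle $i$ at $t=t_i^{(0)}$, and for particle $j$ at $t=t_j^{(1)}$, hold together with all their $t$-derivatives (computed from the one-sided derivatives of the strips, equivalently by means of smooth extensions of the strips). **Solutions.** Let $J_k\supseteq[t_k^{(0)},t_k^{(1)}]$, $k=1,2$, be intervals. A solution on $(J_1,J_2)$ is a pair of smooth maps $t\mapsto(\mathbf q_{k,t},\mathbf p_{k,t})$ on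 $J_k$ such that (a) $\dot{\mathbf q}_{k,t}=\mathbf v_k(\mathbf p_{k,t})$ on $J_k$; (b) the momentum equation in (1) holds, with non-zero arguments of $\mathbf F$, at all $t\in J_k$ for which both delayed times exist in $J_l$, $l\neq k$; (c) for each $t\in J_k$ with $t>t_k^{(1)}$ the retarded time $t_l^-(t,\mathbf q_{k,t})$ exists in $J_l$, and for each $t\in J_k$ with $t<t_k^{(0)}$ the advanced time $t_l^+(t,\mathbf q_{k,t})$ exists in $J_l$. (In particular, all smooth maps on $J_1,J_2$ that satisfy (1) at all times of these intervals, both delayed times always existing, are solutions.) For $0\le v<1$ and $d>0$, say that trajectories on $(J_1,J_2)$ obey the bounds $(v,d)$ if $$\|\dot{\mathbf q}_{k,t}\|\le v\quad\text{and}\quad \|\mathbf q_{k,t}-\mathbf q_{l,t_l^\pm(t,\mathbf q_{k,t})}\|\ge d\qquad\text{for all } t\in J_k,\ k\neq l,\tag{2}$$ the second condition being imposed for those delayed times that exist in $J_l$. **Theorem.** Let initial data be given. There are $0\le v<1$ and $d>0$ such that the strips obey the bounds $(v,d)$; and for all such $v,d$ there exist times $-\infty\le T_k^{\min}\le t_k^{(0)}<t_k^{(1)}\le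 T_k^{\max}\le\infty$ and a solution $t\mapsto(\mathbf q_{k,t},\mathbf p_{k,t})$ on the intervals $J_k=[T_k^{\min},T_k^{\max}]\cap\mathbb R$, $k=1,2$, that obeys the bounds $(v,d)$, with the following properties. 1. $(\mathbf q_{k,t},\mathbf p_{k,t})=(\mathbf q^{(0)}_{k,t},\mathbf p^{(0)}_{k,t})$ for all $t\in[t_k^{(0)},t_k^{(1)}]$, $k=1,2$. 2. For $k\ne l$ and all $t\in D_k:=\big(t_k^+(T_l^{\min},\mathbf q_{l,T_l^{\min}}),\,t_k^-(T_l^{\max},\mathbf q_{l,T_l^{\max}})\big)$ both delayed times $t_l^\pm(t,\mathbf q_{k,t})$ exist in $J_l$ and (1) holds (an infinite $T_l^{\min}$ or $T_l^{\max}$ means no restriction on that side). 3. Let $(\widetilde{\mathbf q}_k,\widetilde{\mathbf p}_k)_{k=1,2}$ be any solution, on any intervals $\widetilde D_k\supseteq[t_k^{(0)},t_k^{(1)}]$. Then $(\widetilde{\mathbf q}_{k,t},\widetilde{\mathbf p}_{k,t})=(\mathbf q_{k,t},\mathbf p_{k,t})$ for all $t\in J_k\cap\widetilde D_k$, $k=1,2$,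 if and only if this holds for all $t\in[t_k^{(0)},t_k^{(1)}]$, $k=1,2$. 4. The intervals are the largest ones on which the bounds hold: if a solution on $(J_1',J_2')$ agrees with the initial data on the strips and obeys the bounds $(v,d)$, then $J_k'\subseteq J_k$ for $k=1,2$. Moreover only the bounds limit the intervals: if $T_1^{\max}$ or $T_2^{\max}$ is finite, then $(\mathbf q_k,\mathbf p_k)_{k=1,2}$ can be extended to a solution (no longer obeying the bounds) on intervals $J_k'\supseteq J_k$, where for at least one $k$ the interval $J'_k$ contains a time later than all times of $J_k$; similarly into the past if $T_1^{\min}$ or $T_2^{\min}$ is finite. -/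

import Mathlib

open Set Filter Topology
open scoped ContDiff

noncomputable section

namespace TwoBodyDelay

/-- Euclidean three-space. -/
abbrev Space : Type := EuclideanSpace ℝ (Fin 3)

/-- The velocity `v(p) = p / √(m² + ‖p‖²)` of a particle of mass `m` and momentum `p`
(units in which the speed of light is one). -/
def velocity (m : ℝ) (p : Space) : Space := (Real.sqrt (m ^ 2 + ‖p‖ ^ 2))⁻¹ • p

/-- The Coulomb force field `F(x) = x / ‖x‖³`; only its values at `x ≠ 0` are meaningful. -/
def coulomb (x : Space) : Space := (‖x‖ ^ 3)⁻¹ • x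

/-- `s` is the advanced time `t⁺(t, x)` of the space-time point `(t, x)` with respect to the
trajectory `q`, defined on the time set `J`. -/
def IsAdvancedTime (q : ℝ → Space) (J : Set ℝ) (t : ℝ) (x : Space) (s : ℝ) : Prop :=
  s ∈ J ∧ s = t + ‖x - q s‖

/-- `s` is the retarded time `t⁻(t, x)` of the space-time point `(t, x)` with respect to the
trajectory `q`, defined on the time set `J`. -/
def IsRetardedTime (q : ℝ → Space) (J : Set ℝ) (t : ℝ) (x : Space) (s : ℝ) : Prop :=
  s ∈ J ∧ s = t - ‖x - q s‖

/-- The right-hand side of the momentum equation of a particle at `x`, when the other particle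
is at `yAdv` at the advanced time and at `yRet` at the retarded time; `c` is the product of the
two charges. -/
def force (c : ℝ) (x yAdv yRet : Space) : Space :=
  c • (coulomb (x - yAdv) + coulomb (x - yRet))

/-- The strips satisfy the equation of motion of particle `k` to all orders at time `t`, where
`sRet` and `sAdv` are the retarded and advanced times of `(t, q k t)` on the strip of particle
`l`. At such a junction the strips determine one-sided derivatives of all orders only (for the
trajectories at `t`, `sRet` and `sAdv`, from different sides), and the derivatives of both sides
of the equation at `t` are the expressions in these one-sided derivatives given by the chain
rule. They are computed by means of smooth functions that extend the strips, together with
the delay functions near `t`; the result does not depend on the extension. -/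
def SolvesToAllOrdersAt (m e : Fin 2 → ℝ) (t0 t1 : Fin 2 → ℝ) (q p : Fin 2 → ℝ → Space)
    (k l : Fin 2) (t sRet sAdv : ℝ) : Prop :=
  ∃ (Q P Q' : ℝ → Space) (τAdv τRet : ℝ → ℝ),
    ContDiff ℝ ∞ Q ∧ ContDiff ℝ ∞ P ∧ ContDiff ℝ ∞ Q' ∧
    EqOn Q (q k) (Icc (t0 k) (t1 k)) ∧ EqOn P (p k) (Icc (t0 k) (t1 k)) ∧
    EqOn Q' (q l) (Icc (t0 l) (t1 l)) ∧
    ContDiffAt ℝ ∞ τAdv t ∧ ContDiffAt ℝ ∞ τRet t ∧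
    τAdv t = sAdv ∧ τRet t = sRet ∧
    (∀ᶠ s in 𝓝 t, τAdv s = s + ‖Q s - Q' (τAdv s)‖) ∧
    (∀ᶠ s in 𝓝 t, τRet s = s - ‖Q s - Q' (τRet s)‖) ∧
    ∀ n : ℕ,
      iteratedDeriv n (deriv Q) t = iteratedDeriv n (fun s => velocity (m k) (P s)) t ∧
      iteratedDeriv n (deriv P) t =
        iteratedDeriv n (fun s => force (e k * e l) (Q s) (Q' (τAdv s)) (Q' (τRet s))) t

/-- Initial data: smooth position and momentum strips `q k`, `p k` on `[t0 k, t1 k]`, `k = 0, 1`,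
where the strip of particle `j` starts first. Only the restrictions of `q k` and `p k` to
`[t0 k, t1 k]` matter. -/
structure IsInitialData (m e : Fin 2 → ℝ) (i j : Fin 2) (t0 t1 : Fin 2 → ℝ)
    (q p : Fin 2 → ℝ → Space) : Prop where
  lt : ∀ k, t0 k < t1 k
  smooth_q : ∀ k, ContDiffOn ℝ ∞ (q k) (Icc (t0 k) (t1 k))
  smooth_p : ∀ k, ContDiffOn ℝ ∞ (p k) (Icc (t0 k) (t1 k))
  ne : ∀ t ∈ Icc (t0 i) (t1 i) ∩ Icc (t0 j) (t1 j), q i t ≠ q j t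
  velocity_eq : ∀ k, ∀ t ∈ Icc (t0 k) (t1 k),
    HasDerivWithinAt (q k) (velocity (m k) (p k t)) (Icc (t0 k) (t1 k)) t
  start_i : IsAdvancedTime (q i) (Icc (t0 i) (t1 i)) (t0 j) (q j (t0 j)) (t0 i)
  end_j : IsAdvancedTime (q j) (Icc (t0 j) (t1 j)) (t0 i) (q i (t0 i)) (t1 j)
  end_i : IsAdvancedTime (q i) (Icc (t0 i) (t1 i)) (t1 j) (q j (t1 j)) (t1 i)
  junction_i : SolvesToAllOrdersAt m e t0 t1 q p i j (t0 i) (t0 j) (t1 j)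
  junction_j : SolvesToAllOrdersAt m e t0 t1 q p j i (t1 j) (t0 i) (t1 i)

/-- At time `t` the trajectories `q k`, `p k` on the time sets `J k` satisfy the equation of
motion of particle `k`: both delayed times on the trajectory of the other particle `l` exist,
the forces are not singular, and the differential equation holds. -/
def SolvesAt (m e : Fin 2 → ℝ) (J : Fin 2 → Set ℝ) (q p : Fin 2 → ℝ → Space)
    (k l : Fin 2) (t : ℝ) : Prop :=
  HasDerivWithinAt (q k) (velocity (m k) (p k t)) (J k) t ∧
  ∃ sAdv sRet : ℝ,
    IsAdvancedTime (q l) (J l) t (q k t) sAdv ∧ IsRetardedTime (q l) (J l) t (q k t) sRet ∧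
    q k t ≠ q l sAdv ∧ q k t ≠ q l sRet ∧
    HasDerivWithinAt (p k) (force (e k * e l) (q k t) (q l sAdv) (q l sRet)) (J k) t

/-- `q k`, `p k` are a smooth solution of the two-body delay system on the time intervals
`J k ⊇ [t0 k, t1 k]`. As the intervals may be bounded, the momentum equation is required
at exactly those times at which both delayed times lie within the intervals. Points outside the
strips must be reached by the dynamics: a point later than the strip is the advanced point of
some point of the other trajectory, and a point earlier than the strip is the retarded point
of some point of the other trajectory (otherwise no equation would refer to it).
A smooth pair of trajectories on intervals such that `SolvesAt` holds for both particles at all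
times of their intervals is a special case. -/
structure IsSolution (m e : Fin 2 → ℝ) (t0 t1 : Fin 2 → ℝ) (J : Fin 2 → Set ℝ)
    (q p : Fin 2 → ℝ → Space) : Prop where
  ordConnected : ∀ k, (J k).OrdConnected
  strip_subset : ∀ k, Icc (t0 k) (t1 k) ⊆ J k
  smooth_q : ∀ k, ContDiffOn ℝ ∞ (q k) (J k)
  smooth_p : ∀ k, ContDiffOn ℝ ∞ (p k) (J k)
  velocity_eq : ∀ k, ∀ t ∈ J k, HasDerivWithinAt (q k) (velocity (m k) (p k t)) (J k) t
  momentum_eq : ∀ k l, k ≠ l → ∀ t ∈ J k, ∀ sAdv sRet : ℝ,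
    IsAdvancedTime (q l) (J l) t (q k t) sAdv → IsRetardedTime (q l) (J l) t (q k t) sRet →
    q k t ≠ q l sAdv ∧ q k t ≠ q l sRet ∧
    HasDerivWithinAt (p k) (force (e k * e l) (q k t) (q l sAdv) (q l sRet)) (J k) t
  reached_future : ∀ k l, k ≠ l → ∀ t ∈ J k, t1 k < t →
    ∃ s, IsRetardedTime (q l) (J l) t (q k t) s
  reached_past : ∀ k l, k ≠ l → ∀ t ∈ J k, t < t0 k →
    ∃ s, IsAdvancedTime (q l) (J l) t (q k t) s

/-- On the intervals `J k` speeds are at most `v`, and the distance between a particle and the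
other one at a delayed time (if that time lies within the interval of the other particle) is at
least `d`. -/
def ObeysBounds (v d : ℝ) (J : Fin 2 → Set ℝ) (q : Fin 2 → ℝ → Space) : Prop :=
  (∀ k, ∀ t ∈ J k, ‖derivWithin (q k) (J k) t‖ ≤ v) ∧
  ∀ k l, k ≠ l → ∀ t ∈ J k, ∀ s,
    (IsAdvancedTime (q l) (J l) t (q k t) s ∨ IsRetardedTime (q l) (J l) t (q k t) s) →
    d ≤ ‖q k t - q l s‖

/-- `(v, d)` are admissible constants for the initial strips. -/
def AdmissibleConstants (t0 t1 : Fin 2 → ℝ) (q : Fin 2 → ℝ → Space) (v d : ℝ) : Prop :=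
  0 ≤ v ∧ v < 1 ∧ 0 < d ∧ ObeysBounds v d (fun k => Icc (t0 k) (t1 k)) q

/-- With `J l = [Tmin, Tmax]`, the open interval of times of particle `k` from the advanced time
of `(Tmin, q l Tmin)` to the retarded time of `(Tmax, q l Tmax)`; an infinite `Tmin` or `Tmax`
imposes no condition. -/
def equationDomain (J : Fin 2 → Set ℝ) (q : Fin 2 → ℝ → Space) (k l : Fin 2) : Set ℝ :=
  {t | t ∈ J k ∧
    (∀ a, IsLeast (J l) a → ∀ s, IsAdvancedTime (q k) (J k) a (q l a) s → s < t) ∧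
    (∀ b, IsGreatest (J l) b → ∀ s, IsRetardedTime (q k) (J k) b (q l b) s → t < s)}

/-- The trajectories `(q, p)` and `(q', p')` agree at all times of `I k`, for both particles. -/
def AgreeOn (I : Fin 2 → Set ℝ) (q p q' p' : Fin 2 → ℝ → Space) : Prop :=
  ∀ k, ∀ t ∈ I k, q k t = q' k t ∧ p k t = p' k t

end TwoBodyDelay

end

namespace TwoBodyDelay

/-! ### Momentum, velocity and the Coulomb field -/

/-! The advanced term, which seems to make the system ill-posed, turns it into an explicit
propagation rule. At a time `u` the equation of one particle involves its own momentum derivative,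
the field of the other particle at the retarded time, and that field at the advanced time. The first
two belong to the known history, so the equation yields the advanced field. The Coulomb field is
injective away from zero, hence the equation determines the displacement `W` to the advanced point,
and the length of `W` is the delay. The history of one particle up to `u` and of the other up to its
retarded time thus fix the position of the other at time `u + ‖W‖`. Time reversal exchanges advanced
and retarded times, so each statement about the future also gives one about the past.

Uniqueness (`unique_step_aux`, `unique_future`) applies the rule step by step; on compact histories
the delays have a positive lower bound, so finitely many steps suffice. By uniqueness all solutions
with the given strips are compatible, and their union is a maximal solution on `M`
(`exists_maximal`).

Existence beyond an end point (`exists_smooth_continuation`, `exists_extension`) uses the rule as a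
definition: the new piece is obtained by inverting a smooth field `G`. A speed bound below one makes
the advanced time have positive derivative and keeps the continuation timelike. In the interior, `G`
is read off from the smooth trajectory of the other particle. At the end of a strip, `G` is glued
from two formulas, and the junction conditions say exactly that their derivatives of all orders
agree. If both trajectories end, a positive lower bound on the delays shows that one of the two can
still be extended (`not_isLUB_of_bounds`). Hence a maximal solution cannot end where bounds hold up
to the end, and it has no last or first time.

For given `(v, d)`, the required intervals are the union of all parts of `M` that obey the bounds.
The union is again such a part, and so is its closure, because limit points cannot leave `M` while
the bounds hold. Therefore the intervals are closed, they are the largest ones, and `M` itself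
continues past their finite end points. -/

lemma velocity_sqrt_pos {m : ℝ} (hm : 0 < m) (p : Space) : 0 < Real.sqrt (m ^ 2 + ‖p‖ ^ 2) :=
  Real.sqrt_pos.2 (by positivity)

lemma norm_velocity {m : ℝ} (p : Space) :
    ‖velocity m p‖ = (Real.sqrt (m ^ 2 + ‖p‖ ^ 2))⁻¹ * ‖p‖ := by
  rw [velocity, norm_smul, Real.norm_of_nonneg (by positivity)]

lemma norm_velocity_lt_one {m : ℝ} (hm : 0 < m) (p : Space) : ‖velocity m p‖ < 1 := by
  rw [norm_velocity, inv_mul_lt_iff₀ (velocity_sqrt_pos hm p), mul_one]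
  exact Real.lt_sqrt_of_sq_lt (by nlinarith)

lemma velocity_neg (m : ℝ) (p : Space) : velocity m (-p) = -velocity m p := by
  simp [velocity]

lemma contDiff_velocity {m : ℝ} (hm : 0 < m) : ContDiff ℝ ∞ (velocity m) := by
  unfold velocity
  refine ContDiff.smul (ContDiff.inv (ContDiff.sqrt ?_ ?_) ?_) contDiff_id
  · exact contDiff_const.add (contDiff_norm_sq ℝ)
  · intro p; positivity
  · intro p; exact (velocity_sqrt_pos hm p).ne'

/-- The momentum of a particle of mass `m` and velocity `w`, `‖w‖ < 1`. -/
noncomputable def momentum (m : ℝ) (w : Space) : Space := (m * (Real.sqrt (1 - ‖w‖ ^ 2))⁻¹) • w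

lemma one_sub_norm_sq_pos {w : Space} (hw : ‖w‖ < 1) : 0 < 1 - ‖w‖ ^ 2 := by
  nlinarith [norm_nonneg w]

lemma contDiffAt_momentum {m : ℝ} {w : Space} (hw : ‖w‖ < 1) :
    ContDiffAt ℝ ∞ (momentum m) w := by
  unfold momentum
  have h := one_sub_norm_sq_pos hw
  have h1 : ContDiffAt ℝ ∞ (fun w : Space => 1 - ‖w‖ ^ 2) w :=
    (contDiff_const.sub (contDiff_norm_sq ℝ)).contDiffAt
  exact ContDiffAt.smul (contDiffAt_const.mul ((h1.sqrt h.ne').inv (Real.sqrt_pos.2 h).ne'))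
    contDiffAt_id

lemma momentum_velocity {m : ℝ} (hm : 0 < m) (p : Space) : momentum m (velocity m p) = p := by
  have hs := velocity_sqrt_pos hm p
  set r := Real.sqrt (m ^ 2 + ‖p‖ ^ 2) with hr
  have hr2 : r ^ 2 = m ^ 2 + ‖p‖ ^ 2 := Real.sq_sqrt (by positivity)
  have h1 : 1 - ‖velocity m p‖ ^ 2 = (m / r) ^ 2 := by
    rw [norm_velocity, ← hr]; field_simp; linarith
  have h2 : Real.sqrt (1 - ‖velocity m p‖ ^ 2) = m / r := by
    rw [h1, Real.sqrt_sq (by positivity)]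
  rw [momentum, h2, velocity, ← hr, smul_smul]
  have : m * (m / r)⁻¹ * r⁻¹ = 1 := by field_simp
  rw [this, one_smul]

lemma velocity_momentum {m : ℝ} (hm : 0 < m) {w : Space} (hw : ‖w‖ < 1) :
    velocity m (momentum m w) = w := by
  have h := one_sub_norm_sq_pos hw
  set r := Real.sqrt (1 - ‖w‖ ^ 2) with hr
  have hr0 : 0 < r := Real.sqrt_pos.2 h
  have hr2 : r ^ 2 = 1 - ‖w‖ ^ 2 := Real.sq_sqrt h.le
  have h1 : m ^ 2 + ‖momentum m w‖ ^ 2 = (m / r) ^ 2 := by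
    rw [momentum, norm_smul, Real.norm_of_nonneg (by positivity), ← hr]
    field_simp; linarith
  have h2 : Real.sqrt (m ^ 2 + ‖momentum m w‖ ^ 2) = m / r := by
    rw [h1, Real.sqrt_sq (by positivity)]
  rw [velocity, h2, momentum, ← hr, smul_smul]
  have : (m / r)⁻¹ * (m * r⁻¹) = 1 := by field_simp
  rw [this, one_smul]

/-- The inverse of the Coulomb field on nonzero vectors. -/
noncomputable def coulombInv (g : Space) : Space := (‖g‖ * Real.sqrt ‖g‖)⁻¹ • g

lemma norm_coulomb (x : Space) : ‖coulomb x‖ = (‖x‖ ^ 2)⁻¹ := by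
  rw [coulomb, norm_smul, Real.norm_of_nonneg (by positivity)]
  by_cases h : ‖x‖ = 0
  · simp [h]
  · field_simp

lemma coulomb_ne_zero {x : Space} (hx : x ≠ 0) : coulomb x ≠ 0 := by
  rw [← norm_ne_zero_iff, norm_coulomb]
  have := norm_ne_zero_iff.2 hx
  positivity

lemma coulomb_zero : coulomb 0 = 0 := by simp [coulomb]

/-- The field has norm `‖x‖⁻²`, so the distance is recovered as the inverse square root of the field
strength. This injectivity is what lets the equation of motion be solved for the advanced position.
-/
lemma coulombInv_coulomb {x : Space} (hx : x ≠ 0) : coulombInv (coulomb x) = x := by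
  have h0 : 0 < ‖x‖ := norm_pos_iff.2 hx
  have h1 : Real.sqrt ‖coulomb x‖ = ‖x‖⁻¹ := by
    rw [norm_coulomb, ← inv_pow, Real.sqrt_sq (by positivity)]
  rw [coulombInv, h1, norm_coulomb, coulomb, smul_smul]
  have : ((‖x‖ ^ 2)⁻¹ * ‖x‖⁻¹)⁻¹ * (‖x‖ ^ 3)⁻¹ = 1 := by field_simp
  rw [this, one_smul]

lemma coulombInv_ne_zero {g : Space} (hg : g ≠ 0) : coulombInv g ≠ 0 := by
  have h0 : 0 < ‖g‖ := norm_pos_iff.2 hg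
  refine smul_ne_zero ?_ hg
  have := Real.sqrt_pos.2 h0
  positivity

lemma coulomb_coulombInv {g : Space} (hg : g ≠ 0) : coulomb (coulombInv g) = g := by
  have h0 : 0 < ‖g‖ := norm_pos_iff.2 hg
  have hs := Real.sqrt_pos.2 h0
  set r := Real.sqrt ‖g‖ with hr
  have hr2 : ‖g‖ = r ^ 2 := (Real.sq_sqrt h0.le).symm
  rw [coulomb, coulombInv, norm_smul, Real.norm_of_nonneg (by positivity), ← hr, smul_smul, hr2]
  have : (((r ^ 2 * r)⁻¹ * r ^ 2) ^ 3)⁻¹ * (r ^ 2 * r)⁻¹ = 1 := by field_simp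
  rw [this, one_smul]

lemma coulomb_injOn {x y : Space} (hx : x ≠ 0) (hy : y ≠ 0) (h : coulomb x = coulomb y) :
    x = y := by
  rw [← coulombInv_coulomb hx, h, coulombInv_coulomb hy]

lemma contDiffAt_coulomb {x : Space} (hx : x ≠ 0) : ContDiffAt ℝ ∞ coulomb x := by
  unfold coulomb
  refine ContDiffAt.smul (ContDiffAt.inv ((contDiffAt_norm ℝ hx).pow 3) ?_) contDiffAt_id
  have := norm_ne_zero_iff.2 hx
  positivity

lemma contDiffAt_coulombInv {g : Space} (hg : g ≠ 0) : ContDiffAt ℝ ∞ coulombInv g := by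
  unfold coulombInv
  have h0 : 0 < ‖g‖ := norm_pos_iff.2 hg
  have hs := Real.sqrt_pos.2 h0
  refine ContDiffAt.smul (ContDiffAt.inv ((contDiffAt_norm ℝ hg).mul
    ((contDiffAt_norm ℝ hg).sqrt h0.ne')) ?_) contDiffAt_id
  positivity

/-! ### Timelike curves -/

/-- `f` is timelike on `I`: it moves at less than the speed of light. -/
def Timelike (f : ℝ → Space) (I : Set ℝ) : Prop :=
  ∀ x ∈ I, ∀ y ∈ I, x < y → ‖f y - f x‖ < y - x

/-- The excess of the elapsed time over the distance between `(a, f a)` and `(b, g b)`. It vanishes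
if and only if `b` is the advanced time of `(a, f a)` on `g`, equivalently `a` is the
retarded time of `(b, g b)` on `f`. -/
noncomputable def gap (f g : ℝ → Space) (a b : ℝ) : ℝ := b - a - ‖g b - f a‖

lemma isAdvancedTime_iff {f g : ℝ → Space} {J : Set ℝ} {a b : ℝ} :
    IsAdvancedTime g J a (f a) b ↔ b ∈ J ∧ gap f g a b = 0 := by
  unfold IsAdvancedTime gap
  rw [norm_sub_rev]
  constructor <;> rintro ⟨h, h'⟩ <;> exact ⟨h, by linarith⟩

lemma isRetardedTime_iff {f g : ℝ → Space} {J : Set ℝ} {a b : ℝ} :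
    IsRetardedTime f J b (g b) a ↔ a ∈ J ∧ gap f g a b = 0 := by
  unfold IsRetardedTime gap
  constructor <;> rintro ⟨h, h'⟩ <;> exact ⟨h, by linarith⟩

/-- By the triangle inequality, a timelike curve changes its distance from a point by less than the
elapsed time. The resulting strict monotonicity of `gap` in each argument gives uniqueness and
ordering of all delayed times. -/
lemma Timelike.gap_lt_right {f g : ℝ → Space} {I : Set ℝ} (h : Timelike g I) {a b b' : ℝ}
    (hb : b ∈ I) (hb' : b' ∈ I) (hlt : b < b') : gap f g a b < gap f g a b' := by
  have := h b hb b' hb' hlt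
  have h2 : ‖g b' - f a‖ ≤ ‖g b' - g b‖ + ‖g b - f a‖ := norm_sub_le_norm_sub_add_norm_sub ..
  unfold gap; linarith

lemma Timelike.gap_lt_left {f g : ℝ → Space} {I : Set ℝ} (h : Timelike f I) {a a' b : ℝ}
    (ha : a ∈ I) (ha' : a' ∈ I) (hlt : a < a') : gap f g a' b < gap f g a b := by
  have := h a ha a' ha' hlt
  have h2 : ‖g b - f a‖ ≤ ‖g b - f a'‖ + ‖f a' - f a‖ := norm_sub_le_norm_sub_add_norm_sub ..
  unfold gap; linarith

lemma Timelike.gap_le_right {f g : ℝ → Space} {I : Set ℝ} (h : Timelike g I) {a b b' : ℝ}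
    (hb : b ∈ I) (hb' : b' ∈ I) (hle : b ≤ b') : gap f g a b ≤ gap f g a b' := by
  rcases hle.eq_or_lt with rfl | hlt
  · rfl
  · exact (h.gap_lt_right hb hb' hlt).le

lemma Timelike.gap_le_left {f g : ℝ → Space} {I : Set ℝ} (h : Timelike f I) {a a' b : ℝ}
    (ha : a ∈ I) (ha' : a' ∈ I) (hle : a ≤ a') : gap f g a' b ≤ gap f g a b := by
  rcases hle.eq_or_lt with rfl | hlt
  · rfl
  · exact (h.gap_lt_left ha ha' hlt).le

lemma Timelike.lt_right_of_gap_lt {f g : ℝ → Space} {I : Set ℝ} (h : Timelike g I) {a b b' : ℝ}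
    (hb : b ∈ I) (hb' : b' ∈ I) (hlt : gap f g a b < gap f g a b') : b < b' :=
  lt_of_not_ge fun hle => absurd (h.gap_le_right hb' hb hle) (not_le.2 hlt)

lemma Timelike.lt_left_of_gap_lt {f g : ℝ → Space} {I : Set ℝ} (h : Timelike f I) {a a' b : ℝ}
    (ha : a ∈ I) (ha' : a' ∈ I) (hlt : gap f g a' b < gap f g a b) : a < a' :=
  lt_of_not_ge fun hle => absurd (h.gap_le_left ha' ha hle) (not_le.2 hlt)

lemma Timelike.le_right_of_gap_le {f g : ℝ → Space} {I : Set ℝ} (h : Timelike g I) {a b b' : ℝ}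
    (hb : b ∈ I) (hb' : b' ∈ I) (hle : gap f g a b ≤ gap f g a b') : b ≤ b' :=
  le_of_not_gt fun hlt => absurd (h.gap_lt_right hb' hb hlt) (not_lt.2 hle)

lemma Timelike.le_left_of_gap_le {f g : ℝ → Space} {I : Set ℝ} (h : Timelike f I) {a a' b : ℝ}
    (ha : a ∈ I) (ha' : a' ∈ I) (hle : gap f g a' b ≤ gap f g a b) : a ≤ a' :=
  le_of_not_gt fun hlt => absurd (h.gap_lt_left ha' ha hlt) (not_lt.2 hle)

lemma Timelike.eq_right {f g : ℝ → Space} {I : Set ℝ} (h : Timelike g I) {a b b' : ℝ}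
    (hb : b ∈ I) (hb' : b' ∈ I) (heq : gap f g a b = gap f g a b') : b = b' :=
  le_antisymm (h.le_right_of_gap_le hb hb' heq.le) (h.le_right_of_gap_le hb' hb heq.ge)

lemma Timelike.eq_left {f g : ℝ → Space} {I : Set ℝ} (h : Timelike f I) {a a' b : ℝ}
    (ha : a ∈ I) (ha' : a' ∈ I) (heq : gap f g a b = gap f g a' b) : a = a' :=
  le_antisymm (h.le_left_of_gap_le ha ha' heq.ge) (h.le_left_of_gap_le ha' ha heq.le)

lemma le_of_gap_eq_zero {f g : ℝ → Space} {a b : ℝ} (h : gap f g a b = 0) : a ≤ b := by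
  unfold gap at h; linarith [norm_nonneg (g b - f a)]

lemma norm_of_gap_eq_zero {f g : ℝ → Space} {a b : ℝ} (h : gap f g a b = 0) :
    ‖g b - f a‖ = b - a := by
  unfold gap at h; linarith

lemma gap_nonpos_of_le {f g : ℝ → Space} {a b : ℝ} (h : b ≤ a) : gap f g a b ≤ 0 := by
  unfold gap; linarith [norm_nonneg (g b - f a)]

lemma continuousOn_gap_right {f g : ℝ → Space} {I : Set ℝ} (h : ContinuousOn g I) (a : ℝ) :
    ContinuousOn (fun b => gap f g a b) I := by
  unfold gap; fun_prop

lemma continuousOn_gap_left {f g : ℝ → Space} {I : Set ℝ} (h : ContinuousOn f I) (b : ℝ) :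
    ContinuousOn (fun a => gap f g a b) I := by
  unfold gap; fun_prop

lemma exists_gap_right {f g : ℝ → Space} {a x y : ℝ} (hxy : x ≤ y)
    (hg : ContinuousOn g (Icc x y)) (hx : gap f g a x ≤ 0) (hy : 0 ≤ gap f g a y) :
    ∃ b ∈ Icc x y, gap f g a b = 0 := by
  obtain ⟨b, hb, h⟩ := intermediate_value_Icc hxy (continuousOn_gap_right hg a) ⟨hx, hy⟩
  exact ⟨b, hb, h⟩

lemma exists_gap_left {f g : ℝ → Space} {b x y : ℝ} (hxy : x ≤ y)
    (hf : ContinuousOn f (Icc x y)) (hx : 0 ≤ gap f g x b) (hy : gap f g y b ≤ 0) :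
    ∃ a ∈ Icc x y, gap f g a b = 0 := by
  obtain ⟨a, ha, h⟩ := intermediate_value_Icc' hxy (continuousOn_gap_left hf b) ⟨hy, hx⟩
  exact ⟨a, ha, h⟩

/-- The light-like pairs form a compact set, on which the delay is continuous; it is positive
because a zero delay would be a meeting at a common time. -/
lemma exists_delay_lower_bound {f g : ℝ → Space} {a b c d : ℝ}
    (hf : ContinuousOn f (Icc a b)) (hg : ContinuousOn g (Icc c d))
    (hne : ∀ x ∈ Icc a b, x ∈ Icc c d → f x ≠ g x) :
    ∃ δ > 0, ∀ x ∈ Icc a b, ∀ y ∈ Icc c d, gap f g x y = 0 → δ ≤ y - x := by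
  let φ : ℝ × ℝ → ℝ := fun z => gap f g z.1 z.2
  have hφ : ContinuousOn φ (Icc a b ×ˢ Icc c d) := by
    have h1 : ContinuousOn (fun z : ℝ × ℝ => f z.1) (Icc a b ×ˢ Icc c d) :=
      hf.comp continuousOn_fst fun z hz => hz.1
    have h2 : ContinuousOn (fun z : ℝ × ℝ => g z.2) (Icc a b ×ˢ Icc c d) :=
      hg.comp continuousOn_snd fun z hz => hz.2
    exact (continuousOn_snd.sub continuousOn_fst).sub (h2.sub h1).norm
  have hK : IsCompact ((Icc a b ×ˢ Icc c d) ∩ φ ⁻¹' {0}) := by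
    refine (isCompact_Icc.prod isCompact_Icc).of_isClosed_subset ?_ inter_subset_left
    exact hφ.preimage_isClosed_of_isClosed (isClosed_Icc.prod isClosed_Icc) isClosed_singleton
  obtain ⟨δ, hδ, h⟩ := hK.exists_forall_le' (f := fun z : ℝ × ℝ => z.2 - z.1) (a := 0)
    (by fun_prop) (by
      rintro ⟨x, y⟩ ⟨⟨hx, hy⟩, h0⟩
      have h0 : gap f g x y = 0 := h0
      have hle := le_of_gap_eq_zero h0
      rcases hle.eq_or_lt with h | h
      · have h : x = y := h
        subst h
        have := norm_of_gap_eq_zero h0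
        rw [sub_self, norm_eq_zero, sub_eq_zero] at this
        exact absurd this.symm (hne x hx hy)
      · exact sub_pos.2 h)
  exact ⟨δ, hδ, fun x hx y hy h0 => h (x, y) ⟨⟨hx, hy⟩, h0⟩⟩

/-- Every speed is below one, and on a compact interval continuity of the momentum turns this into a
uniform bound, to which the mean value inequality applies. -/
lemma timelike_of_velocity {m : ℝ} (hm : 0 < m) {q p : ℝ → Space} {J : Set ℝ}
    (hJ : J.OrdConnected) (hp : ContinuousOn p J)
    (hq : ∀ t ∈ J, HasDerivWithinAt q (velocity m (p t)) J t) : Timelike q J := by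
  intro x hx y hy hxy
  have hsub : Icc x y ⊆ J := hJ.out hx hy
  have hc : ContinuousOn (fun t => 1 - ‖velocity m (p t)‖) (Icc x y) :=
    continuousOn_const.sub
      ((contDiff_velocity hm).continuous.comp_continuousOn (hp.mono hsub)).norm
  obtain ⟨δ, hδ, h⟩ := isCompact_Icc.exists_forall_le' hc (a := 0)
    (fun t _ => sub_pos.2 (norm_velocity_lt_one hm _))
  have := (convex_Icc x y).norm_image_sub_le_of_norm_hasDerivWithin_le (C := 1 - δ)
    (fun t ht => (hq t (hsub ht)).mono hsub) (fun t ht => by linarith [h t ht])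
    (left_mem_Icc.2 hxy.le) (right_mem_Icc.2 hxy.le)
  rw [Real.norm_of_nonneg (by linarith : (0:ℝ) ≤ y - x)] at this
  nlinarith

/-! ### Continuations of initial data -/

/-- A solution whose strips are admissible initial data. The conditions on the strips are
symmetric in the two particles: each strip has a junction time `c k` whose delayed times are the
end points of the strip of the other particle. -/
structure IsContinuation (m e t0 t1 c : Fin 2 → ℝ) (J : Fin 2 → Set ℝ)
    (q p : Fin 2 → ℝ → Space) : Prop extends IsSolution m e t0 t1 J q p where
  mass_pos : ∀ k, 0 < m k
  charge_ne : ∀ k, e k ≠ 0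
  lt : ∀ k, t0 k < t1 k
  mem : ∀ k, c k ∈ Icc (t0 k) (t1 k)
  gap_left : ∀ k l, k ≠ l → gap (q l) (q k) (t0 l) (c k) = 0
  gap_right : ∀ k l, k ≠ l → gap (q k) (q l) (c k) (t1 l) = 0
  junction : ∀ k l, k ≠ l → SolvesToAllOrdersAt m e t0 t1 q p k l (c k) (t0 l) (t1 l)

lemma exists_other (k : Fin 2) : ∃ l, k ≠ l := by decide +revert

lemma eq_or_eq_of_ne {k l : Fin 2} (h : k ≠ l) (n : Fin 2) : n = k ∨ n = l := by
  decide +revert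

namespace IsContinuation

variable {m e t0 t1 c : Fin 2 → ℝ} {J J' : Fin 2 → Set ℝ} {q p q' p' : Fin 2 → ℝ → Space}
  {k l : Fin 2}

lemma timelike (S : IsContinuation m e t0 t1 c J q p) (k : Fin 2) : Timelike (q k) (J k) :=
  timelike_of_velocity (S.mass_pos k) (S.ordConnected k) (S.smooth_p k).continuousOn
    (S.velocity_eq k)

lemma continuousOn (S : IsContinuation m e t0 t1 c J q p) (k : Fin 2) : ContinuousOn (q k) (J k) :=
  (S.smooth_q k).continuousOn

lemma Icc_subset (S : IsContinuation m e t0 t1 c J q p) {x y : ℝ} (hx : x ∈ J k) (hy : y ∈ J k) :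
    Icc x y ⊆ J k := (S.ordConnected k).out hx hy

lemma c_mem (S : IsContinuation m e t0 t1 c J q p) (k : Fin 2) : c k ∈ J k :=
  S.strip_subset k (S.mem k)

lemma t0_mem (S : IsContinuation m e t0 t1 c J q p) (k : Fin 2) : t0 k ∈ J k :=
  S.strip_subset k (left_mem_Icc.2 (S.lt k).le)

lemma t1_mem (S : IsContinuation m e t0 t1 c J q p) (k : Fin 2) : t1 k ∈ J k :=
  S.strip_subset k (right_mem_Icc.2 (S.lt k).le)

lemma uniqueDiffOn (S : IsContinuation m e t0 t1 c J q p) (k : Fin 2) :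
    UniqueDiffOn ℝ (J k) := by
  refine uniqueDiffOn_convex (S.ordConnected k).convex ?_
  refine Nonempty.mono (interior_mono (S.strip_subset k)) ?_
  rw [interior_Icc]
  exact nonempty_Ioo.2 (S.lt k)

/-- At a meeting the common time would be its own advanced and retarded time, and the momentum
equation at such a time includes the nonvanishing of the arguments of the field. -/
lemma ne (S : IsContinuation m e t0 t1 c J q p) (hkl : k ≠ l) {t : ℝ} (hk : t ∈ J k)
    (hl : t ∈ J l) : q k t ≠ q l t := by
  intro h
  have h0 : IsAdvancedTime (q l) (J l) t (q k t) t := ⟨hl, by simp [h]⟩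
  have h1 : IsRetardedTime (q l) (J l) t (q k t) t := ⟨hl, by simp [h]⟩
  exact (S.momentum_eq k l hkl t hk t t h0 h1).1 h

lemma ne_of_gap (S : IsContinuation m e t0 t1 c J q p) (hkl : k ≠ l) {a b : ℝ} (hk : a ∈ J k)
    (hl : b ∈ J l) (h : gap (q k) (q l) a b = 0) : q k a ≠ q l b := by
  intro hab
  have := norm_of_gap_eq_zero h
  rw [hab, sub_self, norm_zero] at this
  obtain rfl : a = b := by linarith
  exact S.ne hkl hk hl hab

lemma lt_of_gap (S : IsContinuation m e t0 t1 c J q p) (hkl : k ≠ l) {a b : ℝ} (hk : a ∈ J k)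
    (hl : b ∈ J l) (h : gap (q k) (q l) a b = 0) : a < b := by
  refine (le_of_gap_eq_zero h).lt_of_ne ?_
  rintro rfl
  refine S.ne_of_gap hkl hk hl h ?_
  have := norm_of_gap_eq_zero h
  rw [sub_self, norm_eq_zero, sub_eq_zero] at this
  exact this.symm

lemma hasDerivWithinAt_p (S : IsContinuation m e t0 t1 c J q p) (hkl : k ≠ l) {t a b : ℝ}
    (ht : t ∈ J k) (ha : a ∈ J l) (hb : b ∈ J l) (hat : gap (q l) (q k) a t = 0)
    (htb : gap (q k) (q l) t b = 0) :
    HasDerivWithinAt (p k) (force (e k * e l) (q k t) (q l b) (q l a)) (J k) t :=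
  (S.momentum_eq k l hkl t ht b a (isAdvancedTime_iff.2 ⟨hb, htb⟩)
    (isRetardedTime_iff.2 ⟨ha, hat⟩)).2.2

lemma c_lt_of_gap (S : IsContinuation m e t0 t1 c J q p) (hkl : k ≠ l) {s t : ℝ} (hs : s ∈ J l)
    (ht : t ∈ J k) (h : gap (q l) (q k) s t = 0) (h1 : t1 k < t) : c l < s := by
  refine (S.timelike l).lt_left_of_gap_lt (S.c_mem l) hs (g := q k) (b := t) ?_
  rw [h, ← S.gap_right l k hkl.symm]
  exact (S.timelike k).gap_lt_right (S.t1_mem k) ht h1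

lemma t0_le_of_gap (S : IsContinuation m e t0 t1 c J q p) (hkl : k ≠ l) {s t : ℝ} (hs : s ∈ J l)
    (ht : t ∈ J k) (h : gap (q l) (q k) s t = 0) (h1 : c k ≤ t) : t0 l ≤ s := by
  refine (S.timelike l).le_left_of_gap_le (S.t0_mem l) hs (g := q k) (b := t) ?_
  rw [h, ← S.gap_left k l hkl]
  exact (S.timelike k).gap_le_right (S.c_mem k) ht h1

lemma t0_lt_of_gap (S : IsContinuation m e t0 t1 c J q p) (hkl : k ≠ l) {s t : ℝ} (hs : s ∈ J l)
    (ht : t ∈ J k) (h : gap (q l) (q k) s t = 0) (h1 : c k < t) : t0 l < s := by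
  refine (S.timelike l).lt_left_of_gap_lt (S.t0_mem l) hs (g := q k) (b := t) ?_
  rw [h, ← S.gap_left k l hkl]
  exact (S.timelike k).gap_lt_right (S.c_mem k) ht h1

/-- Beyond the strip this is part of being a solution. Between the junction and the end of the
strip, the intermediate value theorem applies on `[t0 l, c l]`, since these are the retarded times
of `c k` and `t1 k`. -/
lemma exists_retarded (S : IsContinuation m e t0 t1 c J q p) (hkl : k ≠ l) {t : ℝ} (ht : t ∈ J k)
    (h : c k ≤ t) : ∃ s ∈ J l, gap (q l) (q k) s t = 0 ∧ t0 l ≤ s := by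
  suffices ∃ s ∈ J l, gap (q l) (q k) s t = 0 by
    obtain ⟨s, hs, h0⟩ := this
    exact ⟨s, hs, h0, S.t0_le_of_gap hkl hs ht h0 h⟩
  rcases lt_or_ge (t1 k) t with h1 | h1
  · obtain ⟨s, hs⟩ := S.reached_future k l hkl t ht h1
    obtain ⟨hs, h0⟩ := isRetardedTime_iff.1 hs
    exact ⟨s, hs, h0⟩
  · obtain ⟨s, hs, h0⟩ := exists_gap_left (f := q l) (g := q k) (b := t) (S.mem l).1
      ((S.continuousOn l).mono (S.Icc_subset (S.t0_mem l) (S.c_mem l)))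
      (by rw [← S.gap_left k l hkl]; exact (S.timelike k).gap_le_right (S.c_mem k) ht h)
      (by rw [← S.gap_right l k hkl.symm]; exact (S.timelike k).gap_le_right ht (S.t1_mem k) h1)
    exact ⟨s, S.Icc_subset (S.t0_mem l) (S.c_mem l) hs, h0⟩

/-! ### Change of solution and time reversal -/

lemma _root_.TwoBodyDelay.SolvesToAllOrdersAt.congr {t sRet sAdv : ℝ}
    (h : SolvesToAllOrdersAt m e t0 t1 q p k l t sRet sAdv)
    (hqp : AgreeOn (fun k => Icc (t0 k) (t1 k)) q' p' q p) :
    SolvesToAllOrdersAt m e t0 t1 q' p' k l t sRet sAdv := by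
  obtain ⟨Q, P, Q', τA, τR, h1, h2, h3, h4, h5, h6, h7⟩ := h
  exact ⟨Q, P, Q', τA, τR, h1, h2, h3, fun t ht => (h4 ht).trans (hqp k t ht).1.symm,
    fun t ht => (h5 ht).trans (hqp k t ht).2.symm,
    fun t ht => (h6 ht).trans (hqp l t ht).1.symm, h7⟩

lemma congr (S : IsContinuation m e t0 t1 c J q p) (S' : IsSolution m e t0 t1 J' q' p')
    (h : AgreeOn (fun k => Icc (t0 k) (t1 k)) q' p' q p) :
    IsContinuation m e t0 t1 c J' q' p' where
  toIsSolution := S'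
  mass_pos := S.mass_pos
  charge_ne := S.charge_ne
  lt := S.lt
  mem := S.mem
  gap_left k l hkl := by
    rw [← S.gap_left k l hkl, gap, gap, (h k _ (S.mem k)).1,
      (h l _ (left_mem_Icc.2 (S.lt l).le)).1]
  gap_right k l hkl := by
    rw [← S.gap_right k l hkl, gap, gap, (h k _ (S.mem k)).1,
      (h l _ (right_mem_Icc.2 (S.lt l).le)).1]
  junction k l hkl := (S.junction k l hkl).congr h

end IsContinuation

/-- The time reversal of positions. -/
def revPos (q : Fin 2 → ℝ → Space) : Fin 2 → ℝ → Space := fun k t => q k (-t)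

/-- The time reversal of momenta. -/
noncomputable def revMom (p : Fin 2 → ℝ → Space) : Fin 2 → ℝ → Space := fun k t => -p k (-t)

/-- The time reversal of time sets. -/
def revSet (J : Fin 2 → Set ℝ) : Fin 2 → Set ℝ := fun k => {t | -t ∈ J k}

@[simp] lemma revPos_revPos (q : Fin 2 → ℝ → Space) : revPos (revPos q) = q := by
  funext k t; simp [revPos]

@[simp] lemma revMom_revMom (p : Fin 2 → ℝ → Space) : revMom (revMom p) = p := by
  funext k t; simp [revMom]

lemma mem_revSet {J : Fin 2 → Set ℝ} {k : Fin 2} {t : ℝ} : t ∈ revSet J k ↔ -t ∈ J k := Iff.rfl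

lemma gap_revPos (q : Fin 2 → ℝ → Space) (k l : Fin 2) (a b : ℝ) :
    gap (revPos q k) (revPos q l) a b = gap (q l) (q k) (-b) (-a) := by
  simp only [gap, revPos]
  rw [norm_sub_rev]; ring

lemma revSet_Icc (t0 t1 : Fin 2 → ℝ) :
    revSet (fun k => Icc (t0 k) (t1 k)) = fun k => Icc ((-t1) k) ((-t0) k) := by
  funext k; ext t; simp only [mem_revSet, mem_Icc, Pi.neg_apply]
  constructor <;> rintro ⟨h, h'⟩ <;> constructor <;> linarith

lemma HasDerivWithinAt.comp_neg_set {f : ℝ → Space} {f' : Space} {I : Set ℝ} {t : ℝ}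
    (h : HasDerivWithinAt f f' I (-t)) :
    HasDerivWithinAt (fun x => f (-x)) (-f') {x | -x ∈ I} t := by
  have := HasDerivWithinAt.scomp (h := fun x : ℝ => -x) (h' := -1) t h
    (hasDerivAt_neg t).hasDerivWithinAt (s := {x | -x ∈ I}) (fun x hx => hx)
  rw [neg_one_smul] at this
  exact this

lemma contDiffOn_comp_neg_set {f : ℝ → Space} {I : Set ℝ} (h : ContDiffOn ℝ ∞ f I) :
    ContDiffOn ℝ ∞ (fun x => f (-x)) {x | -x ∈ I} :=
  h.comp contDiff_neg.contDiffOn fun _ hx => hx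

/-- Reversal exchanges advanced and retarded times, and the force is symmetric in the two; momenta
change sign, so their time derivatives do not. All results about the past are obtained from the
future through this. -/
lemma IsSolution.rev {m e t0 t1 : Fin 2 → ℝ} {J : Fin 2 → Set ℝ} {q p : Fin 2 → ℝ → Space}
    (S : IsSolution m e t0 t1 J q p) :
    IsSolution m e (-t1) (-t0) (revSet J) (revPos q) (revMom p) where
  ordConnected k := ⟨fun x hx y hy z hz =>
    (S.ordConnected k).out hy hx ⟨neg_le_neg hz.2, neg_le_neg hz.1⟩⟩
  strip_subset k t ht := S.strip_subset k ⟨le_neg.1 ht.2, neg_le.1 ht.1⟩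
  smooth_q k := contDiffOn_comp_neg_set (S.smooth_q k)
  smooth_p k := (contDiffOn_comp_neg_set (S.smooth_p k)).neg
  velocity_eq k t ht := by
    rw [revMom, velocity_neg]
    exact HasDerivWithinAt.comp_neg_set (S.velocity_eq k (-t) ht)
  momentum_eq k l hkl t ht a b ha hb := by
    obtain ⟨ha, ha0⟩ := isAdvancedTime_iff.1 ha
    obtain ⟨hb, hb0⟩ := isRetardedTime_iff.1 hb
    rw [gap_revPos] at ha0 hb0
    obtain ⟨h1, h2, h3⟩ := S.momentum_eq k l hkl (-t) ht (-b) (-a)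
      (isAdvancedTime_iff.2 ⟨hb, hb0⟩) (isRetardedTime_iff.2 ⟨ha, ha0⟩)
    refine ⟨h2, h1, ?_⟩
    have := (HasDerivWithinAt.comp_neg_set h3).neg
    rw [neg_neg, force, add_comm] at this
    exact this
  reached_future k l hkl t ht h := by
    obtain ⟨s, hs⟩ := S.reached_past k l hkl (-t) ht (neg_lt.1 h)
    obtain ⟨hs, h0⟩ := isAdvancedTime_iff.1 hs
    refine ⟨-s, isRetardedTime_iff.2 ⟨by simpa [mem_revSet] using hs, ?_⟩⟩
    rw [gap_revPos, neg_neg, h0]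
  reached_past k l hkl t ht h := by
    obtain ⟨s, hs⟩ := S.reached_future k l hkl (-t) ht (lt_neg.1 h)
    obtain ⟨hs, h0⟩ := isRetardedTime_iff.1 hs
    refine ⟨-s, isAdvancedTime_iff.2 ⟨by simpa [mem_revSet] using hs, ?_⟩⟩
    rw [gap_revPos, neg_neg, h0]

lemma SolvesToAllOrdersAt.rev {m e t0 t1 : Fin 2 → ℝ} {q p : Fin 2 → ℝ → Space} {k l : Fin 2}
    {t a b : ℝ} (h : SolvesToAllOrdersAt m e t0 t1 q p k l t a b) :
    SolvesToAllOrdersAt m e (-t1) (-t0) (revPos q) (revMom p) k l (-t) (-b) (-a) := by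
  obtain ⟨Q, P, Q', τA, τR, hQ, hP, hQ', eQ, eP, eQ', hA, hR, hAt, hRt, hAe, hRe, hn⟩ := h
  have tn : Tendsto (fun x : ℝ => -x) (𝓝 (-t)) (𝓝 t) := by
    simpa using (continuous_neg.tendsto (-t) : Tendsto (fun x : ℝ => -x) _ _)
  have dP : deriv (fun s => -P (-s)) = fun s => deriv P (-s) := by
    funext s
    rw [deriv.fun_neg, deriv_comp_neg, neg_neg]
  have dQ : deriv (fun s => Q (-s)) = fun s => -deriv Q (-s) := by
    funext s; rw [deriv_comp_neg]
  have hmem : ∀ k s, s ∈ Icc ((-t1) k) ((-t0) k) → -s ∈ Icc (t0 k) (t1 k) := fun k s hs =>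
    ⟨le_neg.1 hs.2, neg_le.1 hs.1⟩
  refine ⟨fun s => Q (-s), fun s => -P (-s), fun s => Q' (-s), fun s => -τR (-s),
    fun s => -τA (-s), hQ.comp contDiff_neg, (hP.comp contDiff_neg).neg, hQ'.comp contDiff_neg,
    fun s hs => eQ (hmem k s hs), fun s hs => congrArg Neg.neg (eP (hmem k s hs)),
    fun s hs => eQ' (hmem l s hs), ?_, ?_, by simp [hRt], by simp [hAt], ?_, ?_, ?_⟩
  · refine (ContDiffAt.comp (-t) (g := τR) (f := fun s : ℝ => -s) ?_
      contDiff_neg.contDiffAt).neg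
    simpa using hR
  · refine (ContDiffAt.comp (-t) (g := τA) (f := fun s : ℝ => -s) ?_
      contDiff_neg.contDiffAt).neg
    simpa using hA
  · filter_upwards [tn.eventually hRe] with s hs
    rw [neg_neg]; linarith
  · filter_upwards [tn.eventually hAe] with s hs
    rw [neg_neg]; linarith
  · intro n
    obtain ⟨h1, h2⟩ := hn n
    constructor
    · have : (fun s => velocity (m k) (-P (-s))) = fun s => -velocity (m k) (P (-s)) := by
        funext s; rw [velocity_neg]
      rw [dQ, this, iteratedDeriv_fun_neg, iteratedDeriv_fun_neg,
        iteratedDeriv_comp_neg n (deriv Q), iteratedDeriv_comp_neg n (fun s => velocity (m k) (P s)),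
        neg_neg, h1]
    · have : (fun s => force (e k * e l) (Q (-s)) (Q' (- -τR (-s))) (Q' (- -τA (-s)))) =
          fun s => (fun s => force (e k * e l) (Q s) (Q' (τA s)) (Q' (τR s))) (-s) := by
        funext s; simp only [neg_neg, force]; rw [add_comm]
      rw [dP, this, iteratedDeriv_comp_neg n (deriv P),
        iteratedDeriv_comp_neg n (fun s => force (e k * e l) (Q s) (Q' (τA s)) (Q' (τR s))),
        neg_neg, h2]

lemma AgreeOn.rev {I : Fin 2 → Set ℝ} {q p q' p' : Fin 2 → ℝ → Space}
    (h : AgreeOn I q' p' q p) :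
    AgreeOn (revSet I) (revPos q') (revMom p') (revPos q) (revMom p) := fun k _ ht =>
  ⟨(h k _ ht).1, congrArg Neg.neg (h k _ ht).2⟩

namespace IsContinuation

variable {m e t0 t1 c : Fin 2 → ℝ} {J J' : Fin 2 → Set ℝ} {q p q' p' : Fin 2 → ℝ → Space}
  {k l : Fin 2}

lemma rev (S : IsContinuation m e t0 t1 c J q p) :
    IsContinuation m e (-t1) (-t0) (-c) (revSet J) (revPos q) (revMom p) where
  toIsSolution := S.toIsSolution.rev
  mass_pos := S.mass_pos
  charge_ne := S.charge_ne
  lt k := neg_lt_neg (S.lt k)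
  mem k := ⟨neg_le_neg (S.mem k).2, neg_le_neg (S.mem k).1⟩
  gap_left k l hkl := by
    rw [gap_revPos]; simpa using S.gap_right k l hkl
  gap_right k l hkl := by
    rw [gap_revPos]; simpa using S.gap_left k l hkl
  junction k l hkl := (S.junction k l hkl).rev

/-! ### Uniqueness -/

lemma p_eq_momentum (S : IsContinuation m e t0 t1 c J q p) {I : Set ℝ} {t : ℝ}
    (hI : I ⊆ J k) (ht : t ∈ J k) (hu : UniqueDiffWithinAt ℝ I t) :
    p k t = momentum (m k) (derivWithin (q k) I t) := by
  rw [((S.velocity_eq k t ht).mono hI).derivWithin hu, momentum_velocity (S.mass_pos k)]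

lemma uniqueDiffWithinAt_right {a t : ℝ} (h : a < t) : UniqueDiffWithinAt ℝ (Icc a t) t :=
  uniqueDiffOn_Icc h t (right_mem_Icc.2 h.le)

/-- The momentum is a function of the one-sided derivative of the position, so only positions have
to be compared beyond the strips. -/
lemma p_eq_of_q_eq (S : IsContinuation m e t0 t1 c J q p) (S' : IsContinuation m e t0 t1 c J' q' p')
    {t : ℝ} (ht : t ∈ J k) (ht' : t ∈ J' k) (h0 : t0 k < t)
    (h : ∀ x ∈ Icc (t0 k) t, q k x = q' k x) : p k t = p' k t := by
  rw [S.p_eq_momentum (S.Icc_subset (S.t0_mem k) ht) ht (uniqueDiffWithinAt_right h0),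
    S'.p_eq_momentum (S'.Icc_subset (S'.t0_mem k) ht') ht' (uniqueDiffWithinAt_right h0),
    derivWithin_congr h (h t (right_mem_Icc.2 h0.le))]

/-- Up to the earlier retarded time `s`, both solutions share the trajectory of `l`, hence also its
momentum derivative and the retarded field acting on it at `s`. So the advanced fields at `s`
coincide, and injectivity of the Coulomb field gives the same point of particle `k`; equal distances
from `q l s` give the same time. The assumption `s ≤ s'` ensures that the second trajectory of `k`
has an advanced time of `s` not later than `t`. -/
lemma unique_step_aux (S : IsContinuation m e t0 t1 c J q p)
    (S' : IsContinuation m e t0 t1 c J' q' p') (hkl : k ≠ l) {t s s' : ℝ}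
    (ht : t ∈ J k) (ht' : t ∈ J' k) (h1 : t1 k < t)
    (hs : s ∈ J l) (hs' : s' ∈ J' l) (hst : gap (q l) (q k) s t = 0)
    (hst' : gap (q' l) (q' k) s' t = 0) (hss : s ≤ s')
    (hl : ∀ x ∈ Icc (t0 l) s, q l x = q' l x ∧ p l x = p' l x)
    (hk : ∀ x ∈ Icc (t0 k) s, x ≤ t → q k x = q' k x) : q k t = q' k t := by
  have hcs := S.c_lt_of_gap hkl hs ht hst h1
  have h0s : t0 l < s := (S.mem l).1.trans_lt hcs
  have hsJ' : s ∈ J' l := S'.Icc_subset (S'.t0_mem l) hs' ⟨h0s.le, hss⟩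
  have hs_lt := S.lt_of_gap hkl.symm hs ht hst
  obtain ⟨r, hr, hrs, h0r⟩ := S.exists_retarded hkl.symm hs hcs.le
  have hr_lt := S.lt_of_gap hkl hr hs hrs
  have hrJ' : r ∈ J' k := S'.Icc_subset (S'.t0_mem k) ht' ⟨h0r, (hr_lt.trans hs_lt).le⟩
  have eqr : q k r = q' k r := hk r ⟨h0r, hr_lt.le⟩ (hr_lt.trans hs_lt).le
  have eqs := hl s ⟨h0s.le, le_rfl⟩
  have hrs' : gap (q' k) (q' l) r s = 0 := by rw [← hrs, gap, gap, eqr, eqs.1]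
  obtain ⟨u, hu, hsu⟩ := exists_gap_right (f := q' l) (g := q' k) (a := s)
    (hr_lt.trans hs_lt).le ((S'.continuousOn k).mono (S'.Icc_subset hrJ' ht'))
    (gap_nonpos_of_le hr_lt.le) (by
      rw [← hst']; exact (S'.timelike l).gap_le_left hsJ' hs' hss)
  have huJ := S'.Icc_subset hrJ' ht' hu
  have d := (S.hasDerivWithinAt_p hkl.symm hs hr ht hrs hst).mono (S.Icc_subset (S.t0_mem l) hs)
  have d' := (S'.hasDerivWithinAt_p hkl.symm hsJ' hrJ' huJ hrs' hsu).mono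
    (S'.Icc_subset (S'.t0_mem l) hsJ')
  have d'' : HasDerivWithinAt (p l) _ (Icc (t0 l) s) s :=
    d'.congr (fun x hx => (hl x hx).2) eqs.2
  have hF := (uniqueDiffWithinAt_right h0s).eq_deriv _ d d''
  rw [force, force, ← eqs.1, ← eqr] at hF
  have hF := add_right_cancel
    (smul_right_injective _ (mul_ne_zero (S.charge_ne l) (S.charge_ne k)) hF)
  have heq := coulomb_injOn (sub_ne_zero.2 (S.ne_of_gap hkl.symm hs ht hst))
    (sub_ne_zero.2 (eqs.1 ▸ S'.ne_of_gap hkl.symm hsJ' huJ hsu)) hF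
  have heq : q k t = q' k u := sub_right_injective heq
  have e1 := norm_of_gap_eq_zero hst
  have e2 := norm_of_gap_eq_zero hsu
  rw [← heq, ← eqs.1, e1] at e2
  obtain rfl : t = u := by linarith
  exact heq

lemma unique_step (S : IsContinuation m e t0 t1 c J q p)
    (S' : IsContinuation m e t0 t1 c J' q' p') (hkl : k ≠ l) {t τ : ℝ}
    (ht : t ∈ J k) (ht' : t ∈ J' k) (h1 : t1 k < t)
    (hτ : ∀ s ∈ J l, gap (q l) (q k) s t = 0 → s ≤ τ)
    (hag : ∀ k, ∀ x ∈ J k ∩ J' k, t0 k ≤ x → x ≤ τ → q k x = q' k x ∧ p k x = p' k x) :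
    q k t = q' k t := by
  obtain ⟨s, hs, hst, h0s⟩ := S.exists_retarded hkl ht ((S.mem k).2.trans h1.le)
  obtain ⟨s', hs', hst', h0s'⟩ := S'.exists_retarded hkl ht' ((S.mem k).2.trans h1.le)
  have hsτ := hτ s hs hst
  rcases le_total s s' with h | h
  · refine S.unique_step_aux S' hkl ht ht' h1 hs hs' hst hst' h (fun x hx => ?_) fun x hx hxt => ?_
    · exact hag l x ⟨S.Icc_subset (S.t0_mem l) hs hx,
        S'.Icc_subset (S'.t0_mem l) hs' ⟨hx.1, hx.2.trans h⟩⟩ hx.1 (hx.2.trans hsτ)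
    · exact (hag k x ⟨S.Icc_subset (S.t0_mem k) ht ⟨hx.1, hxt⟩,
        S'.Icc_subset (S'.t0_mem k) ht' ⟨hx.1, hxt⟩⟩ hx.1 (hx.2.trans hsτ)).1
  · refine (S'.unique_step_aux S hkl ht' ht h1 hs' hs hst' hst h (fun x hx => ?_)
      fun x hx hxt => ?_).symm
    · have := hag l x ⟨S.Icc_subset (S.t0_mem l) hs ⟨hx.1, hx.2.trans h⟩,
        S'.Icc_subset (S'.t0_mem l) hs' hx⟩ hx.1 (hx.2.trans (h.trans hsτ))
      exact ⟨this.1.symm, this.2.symm⟩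
    · exact (hag k x ⟨S.Icc_subset (S.t0_mem k) ht ⟨hx.1, hxt⟩,
        S'.Icc_subset (S'.t0_mem k) ht' ⟨hx.1, hxt⟩⟩ hx.1 (hx.2.trans (h.trans hsτ))).1.symm

lemma exists_delay (S : IsContinuation m e t0 t1 c J q p) (hkl : k ≠ l) {a b c' d : ℝ}
    (hk : Icc a b ⊆ J k) (hl : Icc c' d ⊆ J l) :
    ∃ δ > 0, ∀ x ∈ Icc a b, ∀ y ∈ Icc c' d, gap (q k) (q l) x y = 0 → δ ≤ y - x :=
  exists_delay_lower_bound ((S.continuousOn k).mono hk) ((S.continuousOn l).mono hl)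
    fun _ hx hy => S.ne hkl (hk hx) (hl hy)

lemma unique_future (S : IsContinuation m e t0 t1 c J q p)
    (S' : IsContinuation m e t0 t1 c J' q' p')
    (h : AgreeOn (fun k => Icc (t0 k) (t1 k)) q' p' q p) {t : ℝ} (ht : t ∈ J k) (ht' : t ∈ J' k)
    (h0 : t0 k ≤ t) : q k t = q' k t ∧ p k t = p' k t := by
  rcases le_or_gt t (t1 k) with h1 | h1
  · have := h k t ⟨h0, h1⟩
    exact ⟨this.1.symm, this.2.symm⟩
  obtain ⟨l, hkl⟩ := exists_other k
  have hcase := eq_or_eq_of_ne hkl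
  obtain ⟨s, hs, hst, h0s⟩ := S.exists_retarded hkl ht ((S.mem k).2.trans h1.le)
  have hst_lt := S.lt_of_gap hkl.symm hs ht hst
  -- The history is cut at `t` and at its retarded time `s`. No retarded time leads out of the
  -- compact intervals `[t0 n, E n]`, so the delays in them have a common lower bound `δ`.
  let E : Fin 2 → ℝ := fun n => if n = k then t else s
  have Ek : E k = t := if_pos rfl
  have El : E l = s := if_neg hkl.symm
  have hE : ∀ n, E n ∈ J n := fun n => by
    rcases hcase n with rfl | rfl
    · rwa [Ek]
    · rwa [El]
  have hE0 : ∀ n, t0 n ≤ E n := fun n => by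
    rcases hcase n with rfl | rfl
    · rwa [Ek]
    · rwa [El]
  have hsub : ∀ n, Icc (t0 n) (E n) ⊆ J n := fun n => S.Icc_subset (S.t0_mem n) (hE n)
  obtain ⟨δ₁, hδ₁, H₁⟩ := S.exists_delay hkl (hsub k) (hsub l)
  obtain ⟨δ₂, hδ₂, H₂⟩ := S.exists_delay hkl.symm (hsub l) (hsub k)
  obtain ⟨δ, hδ, Hδ⟩ : ∃ δ > 0, ∀ a b, a ≠ b → ∀ x ∈ Icc (t0 a) (E a), ∀ y ∈ Icc (t0 b) (E b),
      gap (q a) (q b) x y = 0 → δ ≤ y - x := by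
    refine ⟨min δ₁ δ₂, lt_min hδ₁ hδ₂, fun a b hab x hx y hy hxy => ?_⟩
    rcases hcase a with rfl | rfl <;> rcases hcase b with rfl | rfl
    · exact absurd rfl hab
    · exact (min_le_left _ _).trans (H₁ x hx y hy hxy)
    · exact (min_le_right _ _).trans (H₂ x hx y hy hxy)
    · exact absurd rfl hab
  -- retarded times do not leave the compact intervals
  have hret : ∀ a b, a ≠ b → ∀ y ∈ Icc (t0 b) (E b), ∀ x ∈ J a, gap (q a) (q b) x y = 0 →
      x ≤ E a := by
    intro a b hab y hy x hx hxy
    have hyJ := hsub b hy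
    rcases hcase a with rfl | rfl <;> rcases hcase b with rfl | rfl
    · exact absurd rfl hab
    · rw [Ek]; rw [El] at hy
      exact (le_of_gap_eq_zero hxy).trans (hy.2.trans hst_lt.le)
    · rw [El]; rw [Ek] at hy
      refine (S.timelike a).le_left_of_gap_le hx hs (g := q b) (b := y) ?_
      rw [hxy, ← hst]
      exact (S.timelike b).gap_le_right hyJ ht hy.2
    · exact absurd rfl hab
  -- Below both strip ends, agreement is the hypothesis; this starts an induction that gains `δ` at
  -- each step.
  obtain ⟨τ, hτ⟩ : ∃ τ : ℝ, ∀ n, τ ≤ t1 n :=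
    ⟨min (t1 k) (t1 l), fun n => by rcases hcase n with rfl | rfl <;> simp⟩
  -- agreement of the two solutions up to the time `τ + n * δ`
  have key : ∀ n : ℕ, ∀ a, ∀ y ∈ J' a, y ∈ Icc (t0 a) (E a) → y ≤ τ + n * δ →
      q a y = q' a y ∧ p a y = p' a y := by
    intro n
    induction n with
    | zero =>
      intro a y hy' hy hyτ
      have := h a y ⟨hy.1, by simpa using hyτ.trans (by simpa using hτ a)⟩
      exact ⟨this.1.symm, this.2.symm⟩
    | succ n ih =>
      have hq : ∀ a, ∀ y ∈ J' a, y ∈ Icc (t0 a) (E a) → y ≤ τ + (n + 1 : ℕ) * δ →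
          q a y = q' a y := by
        intro a y hy' hy hyτ
        rcases le_or_gt y (t1 a) with hy1 | hy1
        · exact (h a y ⟨hy.1, hy1⟩).1.symm
        obtain ⟨b, hab⟩ : ∃ b, a ≠ b := by
          rcases hcase a with rfl | rfl
          exacts [⟨l, hkl⟩, ⟨k, hkl.symm⟩]
        -- The three terms keep the comparison inside the history of `b`, inside the range of the
        -- induction hypothesis, and, for the history of `a` itself, below `y ≤ E a`.
        refine S.unique_step S' hab (τ := min (E b) (min (τ + n * δ) y)) (hsub a hy) hy' hy1
          (fun x hx hxy => ?_) (fun d x hx h0x hxτ => ?_)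
        · have hxE := hret b a hab.symm y hy x hx hxy
          have hx0 := S.t0_le_of_gap hab hx (hsub a hy) hxy ((S.mem a).2.trans hy1.le)
          have := Hδ b a hab.symm x ⟨hx0, hxE⟩ y hy hxy
          push_cast at hyτ
          exact le_min hxE (le_min (by linarith) (by linarith))
        · refine ih d x hx.2 ⟨h0x, ?_⟩ (hxτ.trans ((min_le_right _ _).trans (min_le_left _ _)))
          obtain rfl | rfl : d = a ∨ d = b := by
            rcases hcase a with rfl | rfl <;> rcases hcase b with rfl | rfl
            exacts [absurd rfl hab, hcase d, (hcase d).symm, absurd rfl hab]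
          · exact hxτ.trans (((min_le_right _ _).trans (min_le_right _ _)).trans hy.2)
          · exact hxτ.trans (min_le_left _ _)
      intro a y hy' hy hyτ
      refine ⟨hq a y hy' hy hyτ, ?_⟩
      rcases le_or_gt y (t1 a) with hy1 | hy1
      · exact (h a y ⟨hy.1, hy1⟩).2.symm
      · exact S.p_eq_of_q_eq S' (hsub a hy) hy' ((S.lt a).trans hy1) fun x hx =>
          hq a x (S'.Icc_subset (S'.t0_mem a) hy' hx) ⟨hx.1, hx.2.trans hy.2⟩ (hx.2.trans hyτ)
  obtain ⟨n, hn⟩ := exists_nat_ge ((t - τ) / δ)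
  refine key n k t ht' ⟨h0, Ek.ge⟩ ?_
  rw [div_le_iff₀ hδ] at hn
  linarith

lemma unique (S : IsContinuation m e t0 t1 c J q p) (S' : IsContinuation m e t0 t1 c J' q' p')
    (h : AgreeOn (fun k => Icc (t0 k) (t1 k)) q' p' q p) :
    AgreeOn (fun k => J k ∩ J' k) q' p' q p := by
  intro k t ht
  rcases le_total (t0 k) t with h0 | h0
  · have := S.unique_future S' h ht.1 ht.2 h0
    exact ⟨this.1.symm, this.2.symm⟩
  · have := S.rev.unique_future S'.rev (k := k) (t := -t) (revSet_Icc t0 t1 ▸ h.rev)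
      (by simpa [mem_revSet] using ht.1) (by simpa [mem_revSet] using ht.2)
      (neg_le_neg (h0.trans (S.lt k).le))
    simp only [revPos, revMom, neg_neg, neg_inj] at this
    exact ⟨this.1.symm, this.2.symm⟩

end IsContinuation

/-! ### Initial data as a solution on the strips -/

/-- With junction times `t0 i` for `i` and `t1 j` for `j`, the conditions on the two strips take the
same form. On the strips alone the momentum equation only concerns the junction times, where it is
the order-zero case of the junction condition. -/
lemma IsInitialData.exists_isContinuation {m e : Fin 2 → ℝ} (hm : ∀ k, 0 < m k)
    (he : ∀ k, e k ≠ 0) {i j : Fin 2} (hij : i ≠ j) {t0 t1 : Fin 2 → ℝ}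
    {q p : Fin 2 → ℝ → Space} (h : IsInitialData m e i j t0 t1 q p) :
    ∃ c, IsContinuation m e t0 t1 c (fun k => Icc (t0 k) (t1 k)) q p := by
  obtain ⟨c, ci, cj⟩ : ∃ c : Fin 2 → ℝ, c i = t0 i ∧ c j = t1 j :=
    ⟨fun k => if k = i then t0 i else t1 j, if_pos rfl, if_neg hij.symm⟩
  have hcase := eq_or_eq_of_ne hij
  have g1 := (isAdvancedTime_iff.1 h.start_i).2
  have g2 := (isAdvancedTime_iff.1 h.end_j).2
  have g3 := (isAdvancedTime_iff.1 h.end_i).2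
  have mem : ∀ k, c k ∈ Icc (t0 k) (t1 k) := fun k => by
    rcases hcase k with rfl | rfl
    · rw [ci]; exact left_mem_Icc.2 (h.lt k).le
    · rw [cj]; exact right_mem_Icc.2 (h.lt k).le
  have gl : ∀ k l, k ≠ l → gap (q l) (q k) (t0 l) (c k) = 0 := fun k l hkl => by
    rcases hcase k with rfl | rfl <;> rcases hcase l with rfl | rfl
    exacts [absurd rfl hkl, ci ▸ g1, cj ▸ g2, absurd rfl hkl]
  have gr : ∀ k l, k ≠ l → gap (q k) (q l) (c k) (t1 l) = 0 := fun k l hkl => by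
    rcases hcase k with rfl | rfl <;> rcases hcase l with rfl | rfl
    exacts [absurd rfl hkl, ci ▸ g2, cj ▸ g3, absurd rfl hkl]
  have jn : ∀ k l, k ≠ l → SolvesToAllOrdersAt m e t0 t1 q p k l (c k) (t0 l) (t1 l) :=
    fun k l hkl => by
      rcases hcase k with rfl | rfl <;> rcases hcase l with rfl | rfl
      exacts [absurd rfl hkl, ci ▸ h.junction_i, cj ▸ h.junction_j, absurd rfl hkl]
  have ne : ∀ k l, k ≠ l → ∀ t ∈ Icc (t0 k) (t1 k), t ∈ Icc (t0 l) (t1 l) → q k t ≠ q l t :=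
    fun k l hkl t hk hl => by
      rcases hcase k with rfl | rfl <;> rcases hcase l with rfl | rfl
      exacts [absurd rfl hkl, h.ne t ⟨hk, hl⟩, (h.ne t ⟨hl, hk⟩).symm, absurd rfl hkl]
  have tl : ∀ k, Timelike (q k) (Icc (t0 k) (t1 k)) := fun k =>
    timelike_of_velocity (hm k) ordConnected_Icc (h.smooth_p k).continuousOn (h.velocity_eq k)
  have l0 : ∀ k, t0 k ∈ Icc (t0 k) (t1 k) := fun k => left_mem_Icc.2 (h.lt k).le
  have l1 : ∀ k, t1 k ∈ Icc (t0 k) (t1 k) := fun k => right_mem_Icc.2 (h.lt k).le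
  refine ⟨c, ⟨⟨fun k => ordConnected_Icc, fun k => Subset.rfl, h.smooth_q, h.smooth_p,
    h.velocity_eq, ?_, fun k l _ t ht h' => absurd h' ht.2.not_gt,
    fun k l _ t ht h' => absurd h' ht.1.not_gt⟩, hm, he, h.lt, mem, gl, gr, jn⟩⟩
  intro k l hkl t ht b a hB hA
  obtain ⟨hb, hb0⟩ := isAdvancedTime_iff.1 hB
  obtain ⟨ha, ha0⟩ := isRetardedTime_iff.1 hA
  clear hA hB
  have nea : ∀ x ∈ Icc (t0 l) (t1 l), ‖q k t - q l x‖ = |t - x| → q k t ≠ q l x := by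
    intro x hx hn heq
    rw [heq, sub_self, norm_zero] at hn
    obtain rfl : t = x := sub_eq_zero.1 (abs_eq_zero.1 hn.symm)
    exact ne k l hkl t ht hx heq
  refine ⟨nea b hb ?_, nea a ha ?_, ?_⟩
  · rw [norm_sub_rev, norm_of_gap_eq_zero hb0, abs_sub_comm,
      abs_of_nonneg (sub_nonneg.2 (le_of_gap_eq_zero hb0))]
  · rw [norm_of_gap_eq_zero ha0, abs_of_nonneg (sub_nonneg.2 (le_of_gap_eq_zero ha0))]
  -- By monotonicity of the gap, an advanced time `b ≤ t1 l` forces `t ≤ c k`, and a retarded time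
  -- `a ≥ t0 l` forces `c k ≤ t`.
  obtain rfl : t = c k := by
    refine le_antisymm ?_ ?_
    · refine (tl k).le_left_of_gap_le ht (mem k) (g := q l) (b := t1 l) ?_
      rw [gr k l hkl, ← hb0]
      exact (tl l).gap_le_right hb (l1 l) hb.2
    · refine (tl k).le_right_of_gap_le (f := q l) (a := t0 l) (mem k) ht ?_
      rw [gl k l hkl, ← ha0]
      exact (tl l).gap_le_left (l0 l) ha ha.1
  obtain rfl : a = t0 l := (tl l).eq_left ha (l0 l) (ha0.trans (gl k l hkl).symm)
  obtain rfl : b = t1 l := (tl l).eq_right hb (l1 l) (hb0.trans (gr k l hkl).symm)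
  obtain ⟨Q, P, Q', τA, τR, hQ, hP, hQ', eQ, eP, eQ', hA, hR, hAt, hRt, hAe, hRe, hn⟩ := jn k l hkl
  have h0 := (hn 0).2
  simp only [iteratedDeriv_zero, hAt, hRt] at h0
  rw [eQ (mem k), eQ' (l0 l), eQ' (l1 l)] at h0
  rw [← h0]
  exact ((hP.differentiable (by simp) (c k)).hasDerivAt.hasDerivWithinAt).congr
    (fun x hx => (eP hx).symm) (eP (mem k)).symm

/-! ### The maximal solution -/

namespace IsContinuation

variable {m e t0 t1 c : Fin 2 → ℝ} {J J' : Fin 2 → Set ℝ} {q p q' p' q0 p0 : Fin 2 → ℝ → Space}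
  {k l : Fin 2}

lemma restrict (S : IsContinuation m e t0 t1 c J q p) (hJ : ∀ k, J' k ⊆ J k)
    (ho : ∀ k, (J' k).OrdConnected) (hs : ∀ k, Icc (t0 k) (t1 k) ⊆ J' k)
    (hf : ∀ k l, k ≠ l → ∀ t ∈ J' k, t1 k < t → ∃ s ∈ J' l, gap (q l) (q k) s t = 0)
    (hp : ∀ k l, k ≠ l → ∀ t ∈ J' k, t < t0 k → ∃ s ∈ J' l, gap (q k) (q l) t s = 0) :
    IsContinuation m e t0 t1 c J' q p := by
  refine S.congr ⟨ho, hs, fun k => (S.smooth_q k).mono (hJ k), fun k => (S.smooth_p k).mono (hJ k),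
    fun k t ht => (S.velocity_eq k t (hJ k ht)).mono (hJ k), ?_, ?_, ?_⟩ fun k t _ => ⟨rfl, rfl⟩
  · intro k l hkl t ht b a hb ha
    obtain ⟨h1, h2, h3⟩ := S.momentum_eq k l hkl t (hJ k ht) b a ⟨hJ l hb.1, hb.2⟩
      ⟨hJ l ha.1, ha.2⟩
    exact ⟨h1, h2, h3.mono (hJ k)⟩
  · intro k l hkl t ht h
    obtain ⟨s, hs, h0⟩ := hf k l hkl t ht h
    exact ⟨s, isRetardedTime_iff.2 ⟨hs, h0⟩⟩
  · intro k l hkl t ht h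
    obtain ⟨s, hs, h0⟩ := hp k l hkl t ht h
    exact ⟨s, isAdvancedTime_iff.2 ⟨hs, h0⟩⟩

/-- Solutions with the same strips agree wherever both are defined, so they glue to one solution on
the union of their time sets; no choice of a chain is needed. The delicate points are smoothness at
end points of the union and the momentum equation, whose three times might belong to different
solutions. -/
lemma exists_maximal (S0 : IsContinuation m e t0 t1 c J q0 p0) :
    ∃ J q p, IsContinuation m e t0 t1 c J q p ∧
      AgreeOn (fun k => Icc (t0 k) (t1 k)) q p q0 p0 ∧
      ∀ J' q' p', IsContinuation m e t0 t1 c J' q' p' →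
        AgreeOn (fun k => Icc (t0 k) (t1 k)) q' p' q0 p0 → ∀ k, J' k ⊆ J k := by
  classical
  let C : (Fin 2 → Set ℝ) × (Fin 2 → ℝ → Space) × (Fin 2 → ℝ → Space) → Prop := fun A =>
    IsContinuation m e t0 t1 c A.1 A.2.1 A.2.2 ∧
      AgreeOn (fun k => Icc (t0 k) (t1 k)) A.2.1 A.2.2 q0 p0
  have hC0 : C (J, q0, p0) := ⟨S0, fun k t _ => ⟨rfl, rfl⟩⟩
  let M : Fin 2 → Set ℝ := fun k => {t | ∃ A, C A ∧ t ∈ A.1 k}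
  let q : Fin 2 → ℝ → Space := fun k t => if h : t ∈ M k then h.choose.2.1 k t else 0
  let p : Fin 2 → ℝ → Space := fun k t => if h : t ∈ M k then h.choose.2.2 k t else 0
  have hsubM : ∀ A, C A → ∀ k, A.1 k ⊆ M k := fun A hA k t ht => ⟨A, hA, ht⟩
  have agree : ∀ A, C A → ∀ k, ∀ t ∈ A.1 k, q k t = A.2.1 k t ∧ p k t = A.2.2 k t := by
    intro A hA k t ht
    have h : t ∈ M k := hsubM A hA k ht
    obtain ⟨hB, hBt⟩ := h.choose_spec
    have := hA.1.unique hB.1 (fun k x hx => ⟨(hB.2 k x hx).1.trans (hA.2 k x hx).1.symm,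
      (hB.2 k x hx).2.trans (hA.2 k x hx).2.symm⟩) k t ⟨ht, hBt⟩
    simp only [q, p, dif_pos h]
    exact this
  have hord : ∀ A, C A → ∀ k x y, x ∈ A.1 k → y ∈ A.1 k → Icc x y ⊆ A.1 k :=
    fun A hA k x y hx hy => (hA.1.ordConnected k).out hx hy
  -- Smoothness is inherited if one solution covers a whole neighbourhood of `t` relative to the
  -- union. For `t` after `t0 k`, either some solution reaches beyond `t`, or `t` is the last time
  -- of the union and every solution containing it will do; otherwise the same holds on the other
  -- side.
  have near : ∀ k, ∀ t ∈ M k, ∃ A, C A ∧ t ∈ A.1 k ∧ A.1 k ∈ 𝓝[M k] t := by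
    intro k t ht
    rcases lt_or_ge (t0 k) t with h0 | h0
    · by_cases hmax : ∃ t' ∈ M k, t < t'
      · obtain ⟨t', ⟨A, hA, ht'⟩, htt'⟩ := hmax
        have hsub := hord A hA k _ _ (hA.1.t0_mem k) ht'
        exact ⟨A, hA, hsub ⟨h0.le, htt'.le⟩,
          mem_nhdsWithin_of_mem_nhds (mem_of_superset (Icc_mem_nhds h0 htt') hsub)⟩
      · push Not at hmax
        obtain ⟨A, hA, htA⟩ := ht
        refine ⟨A, hA, htA, ?_⟩
        filter_upwards [self_mem_nhdsWithin, mem_nhdsWithin_of_mem_nhds (Ioi_mem_nhds h0)]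
          with x hx hx0
        exact hord A hA k _ _ (hA.1.t0_mem k) htA ⟨le_of_lt hx0, hmax x hx⟩
    · have h1 : t < t1 k := h0.trans_lt (S0.lt k)
      by_cases hmin : ∃ t' ∈ M k, t' < t
      · obtain ⟨t', ⟨A, hA, ht'⟩, htt'⟩ := hmin
        have hsub := hord A hA k _ _ ht' (hA.1.t1_mem k)
        exact ⟨A, hA, hsub ⟨htt'.le, h1.le⟩,
          mem_nhdsWithin_of_mem_nhds (mem_of_superset (Icc_mem_nhds htt' h1) hsub)⟩
      · push Not at hmin
        obtain ⟨A, hA, htA⟩ := ht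
        refine ⟨A, hA, htA, ?_⟩
        filter_upwards [self_mem_nhdsWithin, mem_nhdsWithin_of_mem_nhds (Iio_mem_nhds h1)]
          with x hx hx1
        exact hord A hA k _ _ htA (hA.1.t1_mem k) ⟨hmin x hx, le_of_lt hx1⟩
  have gap_eq : ∀ A, C A → ∀ k l, ∀ a ∈ A.1 k, ∀ b ∈ A.1 l,
      gap (A.2.1 k) (A.2.1 l) a b = gap (q k) (q l) a b := by
    intro A hA k l a ha b hb
    rw [gap, gap, (agree A hA k a ha).1, (agree A hA l b hb).1]
  have oc : ∀ k, (M k).OrdConnected := by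
    refine fun k => ⟨fun x hx y hy z hz => ?_⟩
    obtain ⟨A, hA, hxA⟩ := hx
    obtain ⟨B, hB, hyB⟩ := hy
    rcases le_total z (t1 k) with h | h
    · exact ⟨A, hA, hord A hA k _ _ hxA (hA.1.t1_mem k) ⟨hz.1, h⟩⟩
    · exact ⟨B, hB, hord B hB k _ _ (hB.1.t1_mem k) hyB ⟨h, hz.2⟩⟩
  have sq : ∀ k, ContDiffOn ℝ ∞ (q k) (M k) := by
    intro k t ht
    obtain ⟨A, hA, htA, hn⟩ := near k t ht
    exact (((hA.1.smooth_q k).congr fun x hx => (agree A hA k x hx).1) t htA).mono_of_mem_nhdsWithin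
      hn
  have sp : ∀ k, ContDiffOn ℝ ∞ (p k) (M k) := by
    intro k t ht
    obtain ⟨A, hA, htA, hn⟩ := near k t ht
    exact (((hA.1.smooth_p k).congr fun x hx => (agree A hA k x hx).2) t htA).mono_of_mem_nhdsWithin
      hn
  have vel : ∀ k, ∀ t ∈ M k, HasDerivWithinAt (q k) (velocity (m k) (p k t)) (M k) t := by
    intro k t ht
    obtain ⟨A, hA, htA, hn⟩ := near k t ht
    rw [(agree A hA k t htA).2]
    exact ((hA.1.velocity_eq k t htA).congr (fun x hx => (agree A hA k x hx).1)
      (agree A hA k t htA).1).mono_of_mem_nhdsWithin hn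
  have tl : ∀ k, Timelike (q k) (M k) := fun k =>
    timelike_of_velocity (S0.mass_pos k) (oc k) (sp k).continuousOn (vel k)
  have strip : ∀ k, Icc (t0 k) (t1 k) ⊆ M k := fun k =>
    (S0.strip_subset k).trans (hsubM _ hC0 k)
  have gl : ∀ k l, k ≠ l → gap (q l) (q k) (t0 l) (c k) = 0 := fun k l hkl => by
    rw [← gap_eq _ hC0 l k _ (S0.t0_mem l) _ (S0.c_mem k)]; exact S0.gap_left k l hkl
  have gr : ∀ k l, k ≠ l → gap (q k) (q l) (c k) (t1 l) = 0 := fun k l hkl => by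
    rw [← gap_eq _ hC0 k l _ (S0.c_mem k) _ (S0.t1_mem l)]; exact S0.gap_right k l hkl
  -- A solution containing a late `b` contains its retarded time `t`, and then also `a`, which
  -- cannot precede the strip in this case. For an early `a` the argument is mirrored through the
  -- advanced time. Otherwise `a` and `b` both lie in the strip, which every solution contains.
  have common : ∀ k l, k ≠ l → ∀ t ∈ M k, ∀ a ∈ M l, ∀ b ∈ M l, gap (q l) (q k) a t = 0 →
      gap (q k) (q l) t b = 0 → ∃ A, C A ∧ t ∈ A.1 k ∧ a ∈ A.1 l ∧ b ∈ A.1 l := by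
    intro k l hkl t ht a ha b hb hat htb
    have hab : a ≤ b := (le_of_gap_eq_zero hat).trans (le_of_gap_eq_zero htb)
    have hck : c k ∈ M k := strip k (S0.mem k)
    have h0l : t0 l ∈ M l := strip l (left_mem_Icc.2 (S0.lt l).le)
    have h1l : t1 l ∈ M l := strip l (right_mem_Icc.2 (S0.lt l).le)
    rcases lt_or_ge (t1 l) b with hb1 | hb1
    · obtain ⟨A, hA, hbA⟩ := hb
      obtain ⟨u, hu⟩ := hA.1.reached_future l k hkl.symm b hbA hb1
      obtain ⟨hu, hub⟩ := isRetardedTime_iff.1 hu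
      rw [gap_eq A hA k l u hu b hbA] at hub
      obtain rfl : u = t := (tl k).eq_left (hsubM A hA k hu) ht (hub.trans htb.symm)
      refine ⟨A, hA, hu, hord A hA l _ _ (hA.1.t0_mem l) hbA ⟨le_of_not_gt fun ha0 => ?_, hab⟩, hbA⟩
      have e1 : u < c k := (tl k).lt_right_of_gap_lt (f := q l) (a := t0 l) ht hck (by
        rw [gl k l hkl, ← hat]; exact (tl l).gap_lt_left ha h0l ha0)
      have e2 : c k < u := (tl k).lt_left_of_gap_lt (g := q l) (b := t1 l) hck ht (by
        rw [gr k l hkl, ← htb]; exact (tl l).gap_lt_right h1l (hsubM A hA l hbA) hb1)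
      exact e1.not_gt e2
    rcases lt_or_ge a (t0 l) with ha0 | ha0
    · obtain ⟨A, hA, haA⟩ := ha
      obtain ⟨u, hu⟩ := hA.1.reached_past l k hkl.symm a haA ha0
      obtain ⟨hu, hub⟩ := isAdvancedTime_iff.1 hu
      rw [gap_eq A hA l k a haA u hu] at hub
      obtain rfl : u = t := (tl k).eq_right (hsubM A hA k hu) ht (hub.trans hat.symm)
      exact ⟨A, hA, hu, haA, hord A hA l _ _ haA (hA.1.t1_mem l) ⟨hab, hb1⟩⟩
    · obtain ⟨A, hA, htA⟩ := ht
      exact ⟨A, hA, htA, hA.1.strip_subset l ⟨ha0, hab.trans hb1⟩,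
        hA.1.strip_subset l ⟨ha0.trans hab, hb1⟩⟩
  have sol : IsSolution m e t0 t1 M q p := by
    refine ⟨oc, strip, sq, sp, vel, ?_, ?_, ?_⟩
    · intro k l hkl t ht b a hb ha
      obtain ⟨hb, htb⟩ := isAdvancedTime_iff.1 hb
      obtain ⟨ha, hat⟩ := isRetardedTime_iff.1 ha
      obtain ⟨A, hA, htA, haA, hbA⟩ := common k l hkl t ht a ha b hb hat htb
      rw [← gap_eq A hA l k a haA t htA] at hat
      rw [← gap_eq A hA k l t htA b hbA] at htb
      rw [(agree A hA k t htA).1, (agree A hA l a haA).1, (agree A hA l b hbA).1]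
      refine ⟨hA.1.ne_of_gap hkl htA hbA htb, (hA.1.ne_of_gap hkl.symm haA htA hat).symm, ?_⟩
      have d := ((sp k).differentiableOn (by simp) t ht).hasDerivWithinAt
      have d1 := (d.mono (hsubM A hA k)).congr (fun x hx => (agree A hA k x hx).2.symm)
        (agree A hA k t htA).2.symm
      rwa [(hA.1.uniqueDiffOn k t htA).eq_deriv _ d1
        (hA.1.hasDerivWithinAt_p hkl htA haA hbA hat htb)] at d
    · intro k l hkl t ht h
      obtain ⟨A, hA, htA⟩ := ht
      obtain ⟨s, hs⟩ := hA.1.reached_future k l hkl t htA h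
      obtain ⟨hs, hst⟩ := isRetardedTime_iff.1 hs
      rw [gap_eq A hA l k s hs t htA] at hst
      exact ⟨s, isRetardedTime_iff.2 ⟨hsubM A hA l hs, hst⟩⟩
    · intro k l hkl t ht h
      obtain ⟨A, hA, htA⟩ := ht
      obtain ⟨s, hs⟩ := hA.1.reached_past k l hkl t htA h
      obtain ⟨hs, hst⟩ := isAdvancedTime_iff.1 hs
      rw [gap_eq A hA k l t htA s hs] at hst
      exact ⟨s, isAdvancedTime_iff.2 ⟨hsubM A hA l hs, hst⟩⟩
  have hag : AgreeOn (fun k => Icc (t0 k) (t1 k)) q p q0 p0 := fun k t ht =>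
    agree _ hC0 k t (S0.strip_subset k ht)
  exact ⟨M, q, p, S0.congr sol hag, hag, fun J' q' p' S' h' => hsubM (J', q', p') ⟨S', h'⟩⟩

end IsContinuation

/-! ### Functions that are smooth near a point -/

section SmoothNear

variable {E F G : Type*} [NormedAddCommGroup E] [NormedSpace ℝ E] [NormedAddCommGroup F]
  [NormedSpace ℝ F] [NormedAddCommGroup G] [NormedSpace ℝ G]

/-- `f` is smooth in a neighbourhood of `a` (the same neighbourhood for all orders). -/
def SmoothNear (f : E → F) (a : E) : Prop := ∀ᶠ x in 𝓝 a, ContDiffAt ℝ ∞ f x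

lemma SmoothNear.contDiffAt {f : E → F} {a : E} (h : SmoothNear f a) : ContDiffAt ℝ ∞ f a :=
  Eventually.self_of_nhds h

lemma SmoothNear.continuousAt {f : E → F} {a : E} (h : SmoothNear f a) : ContinuousAt f a :=
  h.contDiffAt.continuousAt

lemma SmoothNear.differentiableAt {f : E → F} {a : E} (h : SmoothNear f a) :
    DifferentiableAt ℝ f a :=
  h.contDiffAt.differentiableAt (by simp)

lemma SmoothNear.congr {f g : E → F} {a : E} (h : SmoothNear f a) (hg : g =ᶠ[𝓝 a] f) :
    SmoothNear g a := by
  filter_upwards [h, hg.eventuallyEq_nhds] with x hx hx' using hx.congr_of_eventuallyEq hx'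

lemma ContDiff.smoothNear {f : E → F} (h : ContDiff ℝ ∞ f) (a : E) : SmoothNear f a :=
  Eventually.of_forall fun _ => h.contDiffAt

lemma ContDiffOn.smoothNear {f : E → F} {s : Set E} {a : E} (h : ContDiffOn ℝ ∞ f s)
    (hs : s ∈ 𝓝 a) : SmoothNear f a := by
  filter_upwards [eventually_mem_nhds_iff.2 hs] with x hx using h.contDiffAt hx

lemma SmoothNear.comp {g : F → G} {f : E → F} {a : E} (hg : SmoothNear g (f a))
    (hf : SmoothNear f a) : SmoothNear (fun x => g (f x)) a := by
  filter_upwards [hf, hf.continuousAt.eventually hg] with x h1 h2 using h2.comp x h1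

lemma SmoothNear.add {f g : E → F} {a : E} (hf : SmoothNear f a) (hg : SmoothNear g a) :
    SmoothNear (fun x => f x + g x) a := by
  filter_upwards [hf, hg] with x h1 h2 using h1.add h2

lemma SmoothNear.sub {f g : E → F} {a : E} (hf : SmoothNear f a) (hg : SmoothNear g a) :
    SmoothNear (fun x => f x - g x) a := by
  filter_upwards [hf, hg] with x h1 h2 using h1.sub h2

lemma SmoothNear.const_smul {f : E → F} {a : E} (c : ℝ) (hf : SmoothNear f a) :
    SmoothNear (fun x => c • f x) a := by
  filter_upwards [hf] with x h1 using h1.const_smul c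

lemma smoothNear_id (a : E) : SmoothNear (fun x : E => x) a := ContDiff.smoothNear contDiff_id a

lemma SmoothNear.smoothNear_deriv {f : ℝ → F} {a : ℝ} (h : SmoothNear f a) : SmoothNear (deriv f) a := by
  filter_upwards [h] with x hx
  exact (hx.fderiv_right (m := ∞) (by simp)).clm_apply contDiffAt_const

lemma smoothNear_norm {x : Space} (hx : x ≠ 0) : SmoothNear (fun x : Space => ‖x‖) x := by
  filter_upwards [isOpen_ne.mem_nhds hx] with y hy using contDiffAt_norm ℝ hy

lemma smoothNear_coulomb {x : Space} (hx : x ≠ 0) : SmoothNear coulomb x := by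
  filter_upwards [isOpen_ne.mem_nhds hx] with y hy using contDiffAt_coulomb hy

lemma smoothNear_coulombInv {x : Space} (hx : x ≠ 0) : SmoothNear coulombInv x := by
  filter_upwards [isOpen_ne.mem_nhds hx] with y hy using contDiffAt_coulombInv hy

lemma SmoothNear.exists_lipschitz {f : ℝ → F} {a w : ℝ} (h : SmoothNear f a)
    (hw : ‖deriv f a‖ < w) :
    ∃ ε > 0, ∀ x ∈ Ioo (a - ε) (a + ε), ∀ y ∈ Ioo (a - ε) (a + ε), ‖f y - f x‖ ≤ w * |y - x| := by
  have h2 : ∀ᶠ x in 𝓝 a, DifferentiableAt ℝ f x ∧ ‖deriv f x‖ ≤ w := by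
    filter_upwards [h, h.smoothNear_deriv.continuousAt.norm.eventually (Iic_mem_nhds hw)] with x h1 h2
    exact ⟨h1.differentiableAt (by simp), h2⟩
  obtain ⟨ε, hε, H⟩ := Metric.eventually_nhds_iff_ball.1 h2
  rw [Real.ball_eq_Ioo] at H
  refine ⟨ε, hε, fun x hx y hy => ?_⟩
  exact (convex_Ioo _ _).norm_image_sub_le_of_norm_deriv_le (fun x hx => (H x hx).1)
    (fun x hx => (H x hx).2) hx hy

/-! ### Implicit functions -/

/-- The implicit function theorem gives smoothness at the base point. At a nearby point of the
graph, local uniqueness identifies `τ` with the implicit function based there, so `τ` is smooth on a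
whole neighbourhood. -/
lemma exists_implicit {H : ℝ × ℝ → ℝ} {u : ℝ × ℝ} (hH : SmoothNear H u)
    (h0 : fderiv ℝ H u (0, 1) ≠ 0) :
    ∃ τ : ℝ → ℝ, SmoothNear τ u.1 ∧ τ u.1 = u.2 ∧ (∀ᶠ x in 𝓝 u.1, H (x, τ x) = H u) ∧
      ∀ᶠ z in 𝓝 u, H z = H u → τ z.1 = z.2 := by
  have inv : ∀ z, fderiv ℝ H z (0, 1) ≠ 0 →
      (fderiv ℝ H z ∘SL ContinuousLinearMap.inr ℝ ℝ ℝ).IsInvertible := by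
    intro z hz
    refine ⟨ContinuousLinearEquiv.unitsEquivAut ℝ (Units.mk0 _ hz), ?_⟩
    ext; simp
  have hn : (∞ : WithTop ℕ∞) ≠ 0 := by simp
  set τ := hH.contDiffAt.implicitFunction hn (inv u h0) with hτ
  have hsm : ContDiffAt ℝ ∞ τ u.1 := hH.contDiffAt.contDiffAt_implicitFunction hn (inv u h0)
  have hself : τ u.1 = u.2 := hH.contDiffAt.implicitFunction_apply_self hn (inv u h0)
  have heq : ∀ᶠ x in 𝓝 u.1, H (x, τ x) = H u :=
    hH.contDiffAt.eventually_apply_implicitFunction hn (inv u h0)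
  refine ⟨τ, ?_, hself, heq, ?_⟩
  · have hcont : ∀ᶠ x in 𝓝 u.1, ContinuousAt τ x := by
      filter_upwards [(hsm.of_le (m := 1) (by simp)).eventually (by simp)] with x hx
        using hx.continuousAt
    have hpair : Tendsto (fun x => (x, τ x)) (𝓝 u.1) (𝓝 u) := by
      have : Tendsto (fun x => (x, τ x)) (𝓝 u.1) (𝓝 (u.1, τ u.1)) :=
        tendsto_id.prodMk_nhds hsm.continuousAt
      rwa [hself] at this
    have hder : ∀ᶠ z in 𝓝 u, fderiv ℝ H z (0, 1) ≠ 0 := by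
      have : ContinuousAt (fun z => fderiv ℝ H z (0, 1)) u :=
        ((hH.contDiffAt.fderiv_right (m := 0) (by simp)).clm_apply contDiffAt_const).continuousAt
      exact this.eventually_ne h0
    filter_upwards [hcont, hpair.eventually hH, hpair.eventually hder,
      eventually_eventually_nhds.2 heq] with x h1 h2 h3 h4
    have key := h2.eventually_apply_eq_iff_implicitFunction hn (inv _ h3)
    have hx : Tendsto (fun y => (y, τ y)) (𝓝 x) (𝓝 (x, τ x)) := tendsto_id.prodMk_nhds h1
    refine (h2.contDiffAt_implicitFunction hn (inv _ h3)).congr_of_eventuallyEq ?_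
    filter_upwards [hx.eventually key, h4] with y hy hy4
    exact (hy.1 (by rw [hy4, h4.self_of_nhds])).symm
  · filter_upwards [hH.contDiffAt.eventually_apply_eq_iff_implicitFunction hn (inv u h0)]
      with z hz using hz.1

lemma smoothNear_delay {f g : ℝ → Space} {x0 y0 ε : ℝ} (hf : SmoothNear f x0)
    (hg : SmoothNear g y0) (hne : g y0 - f x0 ≠ 0) :
    SmoothNear (fun z : ℝ × ℝ => z.2 - z.1 - ε * ‖g z.2 - f z.1‖) (x0, y0) := by
  have h1 : SmoothNear (fun z : ℝ × ℝ => f z.1) (x0, y0) :=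
    SmoothNear.comp (f := Prod.fst) hf (ContDiff.smoothNear contDiff_fst _)
  have h2 : SmoothNear (fun z : ℝ × ℝ => g z.2) (x0, y0) :=
    SmoothNear.comp (f := Prod.snd) hg (ContDiff.smoothNear contDiff_snd _)
  have h3 : SmoothNear (fun z : ℝ × ℝ => ‖g z.2 - f z.1‖) (x0, y0) :=
    SmoothNear.comp (f := fun z : ℝ × ℝ => g z.2 - f z.1) (smoothNear_norm hne) (h2.sub h1)
  have h4 : SmoothNear (fun z : ℝ × ℝ => z.2 - z.1) (x0, y0) :=
    ContDiff.smoothNear (contDiff_snd.sub contDiff_fst) _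
  exact h4.sub (h3.const_smul ε)

/-- The distance to a curve slower than light has derivative of modulus below one, so the derivative
of the defining equation in the delayed time cannot vanish. The sign `ε` treats advanced and
retarded times together. -/
lemma exists_delay_function {f g : ℝ → Space} {x0 y0 ε : ℝ} (hε : |ε| = 1)
    (hf : SmoothNear f x0) (hg : SmoothNear g y0) (hne : g y0 ≠ f x0) (hv : ‖deriv g y0‖ < 1)
    (h0 : y0 - x0 - ε * ‖g y0 - f x0‖ = 0) :
    ∃ τ : ℝ → ℝ, SmoothNear τ x0 ∧ τ x0 = y0 ∧
      (∀ᶠ x in 𝓝 x0, τ x - x - ε * ‖g (τ x) - f x‖ = 0) ∧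
      ∀ᶠ z in 𝓝 (x0, y0), z.2 - z.1 - ε * ‖g z.2 - f z.1‖ = 0 → τ z.1 = z.2 := by
  have hne' : g y0 - f x0 ≠ 0 := sub_ne_zero.2 hne
  have hH := smoothNear_delay (ε := ε) hf hg hne'
  obtain ⟨τ, h1, h2, h3, h4⟩ := exists_implicit hH (by
    intro hz
    obtain ⟨w, hw1, hw2⟩ := exists_between hv
    have hw0 : 0 ≤ w := (norm_nonneg _).trans hw1.le
    have hφ : DifferentiableAt ℝ (fun y => ‖g y - f x0‖) y0 :=
      (hg.differentiableAt.sub_const (f x0)).norm ℝ hne'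
    have hφle : |deriv (fun y => ‖g y - f x0‖) y0| ≤ w := by
      rw [← Real.norm_eq_abs]
      refine norm_deriv_le_of_lip' hw0 ?_
      obtain ⟨δ, hδ, hL⟩ := hg.exists_lipschitz hw1
      filter_upwards [Ioo_mem_nhds (sub_lt_self y0 hδ) (lt_add_of_pos_right y0 hδ)] with y hy
      have := hL y0 ⟨sub_lt_self y0 hδ, lt_add_of_pos_right y0 hδ⟩ y hy
      refine le_trans ?_ this
      rw [Real.norm_eq_abs]
      refine (abs_norm_sub_norm_le _ _).trans ?_
      rw [sub_sub_sub_cancel_right]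
    have hc : HasDerivAt (fun y : ℝ => ((x0, y) : ℝ × ℝ)) (0, 1) y0 :=
      (hasDerivAt_const y0 x0).prodMk (hasDerivAt_id y0)
    have hd := hH.differentiableAt.hasFDerivAt.comp_hasDerivAt y0 hc
    have hd' : HasDerivAt (fun y => y - x0 - ε * ‖g y - f x0‖)
        (1 - ε * deriv (fun y => ‖g y - f x0‖) y0) y0 :=
      ((hasDerivAt_id y0).sub_const x0).sub (hφ.hasDerivAt.const_mul ε)
    have := hd.unique hd'
    rw [hz] at this
    have h5 : ε * deriv (fun y => ‖g y - f x0‖) y0 = 1 := by linarith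
    have h6 : |ε * deriv (fun y => ‖g y - f x0‖) y0| = 1 := by rw [h5, abs_one]
    rw [abs_mul, hε, one_mul] at h6
    linarith)
  refine ⟨τ, h1, h2, ?_, ?_⟩
  · filter_upwards [h3] with x hx
    simpa [h0] using hx
  · filter_upwards [h4] with z hz h5
    exact hz (by simpa [h0] using h5)

lemma exists_advanced_function {f g : ℝ → Space} {x0 y0 : ℝ}
    (hf : SmoothNear f x0) (hg : SmoothNear g y0) (hne : g y0 ≠ f x0) (hv : ‖deriv g y0‖ < 1)
    (h0 : gap f g x0 y0 = 0) :
    ∃ τ : ℝ → ℝ, SmoothNear τ x0 ∧ τ x0 = y0 ∧ (∀ᶠ x in 𝓝 x0, gap f g x (τ x) = 0) ∧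
      ∀ᶠ z in 𝓝 (x0, y0), gap f g z.1 z.2 = 0 → τ z.1 = z.2 := by
  obtain ⟨τ, h1, h2, h3, h4⟩ := exists_delay_function (ε := 1) (by simp) hf hg hne hv
    (by unfold gap at h0; linarith)
  refine ⟨τ, h1, h2, h3.mono fun x hx => ?_, h4.mono fun z hz h => hz ?_⟩
  · unfold gap; linarith
  · unfold gap at h; linarith

lemma exists_retarded_function {f g : ℝ → Space} {x0 y0 : ℝ}
    (hf : SmoothNear f x0) (hg : SmoothNear g y0) (hne : g y0 ≠ f x0) (hv : ‖deriv g y0‖ < 1)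
    (h0 : gap g f y0 x0 = 0) :
    ∃ τ : ℝ → ℝ, SmoothNear τ x0 ∧ τ x0 = y0 ∧ (∀ᶠ x in 𝓝 x0, gap g f (τ x) x = 0) ∧
      ∀ᶠ z in 𝓝 (x0, y0), gap g f z.2 z.1 = 0 → τ z.1 = z.2 := by
  obtain ⟨τ, h1, h2, h3, h4⟩ := exists_delay_function (ε := -1) (by simp) hf hg hne hv
    (by unfold gap at h0; rw [norm_sub_rev] at h0; linarith)
  refine ⟨τ, h1, h2, h3.mono fun x hx => ?_, h4.mono fun z hz h => hz ?_⟩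
  · unfold gap; rw [norm_sub_rev]; linarith
  · unfold gap at h; rw [norm_sub_rev] at h; linarith

/-! ### Gluing -/

lemma hasDerivAt_glue_zero {h : ℝ → F} {a x : ℝ} (hx : DifferentiableAt ℝ h x) (h0 : h a = 0)
    (h1 : deriv h a = 0) :
    HasDerivAt (fun y => if y ≤ a then 0 else h y) (if x ≤ a then 0 else deriv h x) x := by
  rcases lt_trichotomy x a with hlt | rfl | hlt
  · rw [if_pos hlt.le]
    refine (hasDerivAt_const x (0 : F)).congr_of_eventuallyEq ?_
    filter_upwards [Iio_mem_nhds hlt] with y hy using if_pos (le_of_lt hy)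
  · rw [if_pos le_rfl]
    have := hx.hasDerivAt
    rw [h1, hasDerivAt_iff_isLittleO] at this
    rw [hasDerivAt_iff_isLittleO]
    refine (Asymptotics.IsBigO.of_bound 1 (Eventually.of_forall fun y => ?_)).trans_isLittleO this
    by_cases hy : y ≤ x <;> simp [hy, h0]
  · rw [if_neg hlt.not_ge]
    refine hx.hasDerivAt.congr_of_eventuallyEq ?_
    filter_upwards [Ioi_mem_nhds hlt] with y hy using if_neg (not_le.2 hy)

/-- Differentiating the glued function gives the function glued from the derivative, whose
derivatives at `a` vanish again; this drives the induction on the order. -/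
lemma contDiffOn_glue_zero {a : ℝ} {U : Set ℝ} (hU : IsOpen U) (n : ℕ) :
    ∀ {h : ℝ → F}, ContDiffOn ℝ ∞ h U → (∀ n, iteratedDeriv n h a = 0) →
      ContDiffOn ℝ n (fun y => if y ≤ a then 0 else h y) U := by
  induction n with
  | zero =>
    intro h hh h0
    refine contDiffOn_zero.2 fun x hx => ?_
    exact (hasDerivAt_glue_zero (hh.contDiffAt (hU.mem_nhds hx) |>.differentiableAt (by simp))
      (by simpa using h0 0) (by simpa [iteratedDeriv_one] using h0 1)).continuousAt
      |>.continuousWithinAt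
  | succ n ih =>
    intro h hh h0
    have hd : ∀ x ∈ U, HasDerivAt (fun y => if y ≤ a then 0 else h y)
        (if x ≤ a then 0 else deriv h x) x := fun x hx =>
      hasDerivAt_glue_zero (hh.contDiffAt (hU.mem_nhds hx) |>.differentiableAt (by simp))
        (by simpa using h0 0) (by simpa [iteratedDeriv_one] using h0 1)
    push_cast
    refine (contDiffOn_succ_iff_deriv_of_isOpen hU).2
      ⟨fun x hx => (hd x hx).differentiableAt.differentiableWithinAt, by simp, ?_⟩
    refine ContDiffOn.congr (ih (h := deriv h) ?_ fun n => ?_) fun x hx => (hd x hx).deriv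
    · exact fun x hx => (((hh.contDiffAt (hU.mem_nhds hx)).fderiv_right (m := ∞)
        (by simp)).clm_apply contDiffAt_const).contDiffWithinAt
    · rw [← iteratedDeriv_succ']; exact h0 (n + 1)

lemma smoothNear_glue {f g : ℝ → F} {a : ℝ} (hf : SmoothNear f a) (hg : SmoothNear g a)
    (h : ∀ n, iteratedDeriv n f a = iteratedDeriv n g a) :
    SmoothNear (fun x => if x ≤ a then f x else g x) a := by
  obtain ⟨U, hU, hUo, haU⟩ := eventually_nhds_iff.1 (hf.and hg)
  have key : ContDiffOn ℝ ∞ (fun y => if y ≤ a then 0 else (g - f) y) U := by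
    refine contDiffOn_infty.2 fun n => contDiffOn_glue_zero hUo n
      (fun x hx => ((hU x hx).2.sub (hU x hx).1).contDiffWithinAt) fun n => ?_
    rw [iteratedDeriv_sub (hg.contDiffAt.of_le (by exact_mod_cast le_top))
      (hf.contDiffAt.of_le (by exact_mod_cast le_top)), h n, sub_self]
  refine (hf.add (ContDiffOn.smoothNear key (hUo.mem_nhds haU))).congr
    (Eventually.of_forall fun x => ?_)
  by_cases hx : x ≤ a <;> simp [hx]

/-- Each derivative is continuous at `a`, hence is the limit of its values on the left, where the
two functions coincide. -/
lemma iteratedDeriv_eq_of_eventuallyEq_left {f g : ℝ → F} {a : ℝ} (hf : SmoothNear f a)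
    (hg : SmoothNear g a) (h : f =ᶠ[𝓝[<] a] g) (n : ℕ) :
    iteratedDeriv n f a = iteratedDeriv n g a := by
  have smooth : ∀ n, ∀ f : ℝ → F, SmoothNear f a → SmoothNear (iteratedDeriv n f) a := by
    intro n
    induction n with
    | zero => intro f hf; simpa [iteratedDeriv_zero] using hf
    | succ n ih => intro f hf; rw [iteratedDeriv_succ']; exact ih _ hf.smoothNear_deriv
  have heq : iteratedDeriv n f =ᶠ[𝓝[<] a] iteratedDeriv n g := by
    have h' : ∀ᶠ x in 𝓝[<] a, f =ᶠ[𝓝 x] g := by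
      filter_upwards [eventually_eventually_nhdsWithin.2 h, self_mem_nhdsWithin] with x hx hxa
      rwa [nhdsWithin_eq_nhds.2 (Iio_mem_nhds hxa)] at hx
    filter_upwards [h'] with x hx using hx.iteratedDeriv_eq n
  refine tendsto_nhds_unique (f := iteratedDeriv n f) (l := 𝓝[<] a) ?_ ?_
  · exact (smooth n f hf).continuousAt.mono_left nhdsWithin_le_nhds
  · exact ((smooth n g hg).continuousAt.mono_left nhdsWithin_le_nhds).congr' heq.symm

end SmoothNear

/-! ### Continuation of a curve by means of the field it generates at retarded times -/

/-- The triangle inequality gives `(1 - w) * (u' - u) ≤ (a' - a) + v * |a' - a|`. Since `v < 1`, the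
right side is negative if `a' < a`, and otherwise at most `2 * (a' - a)`. This is the quantitative
monotonicity of advanced times that survives passage to the limit. -/
lemma advanced_time_expansion {Q f : ℝ → Space} {v w u u' a a' : ℝ} (hv : v < 1)
    (hw : w < 1) (hu : u < u') (hQ : ‖Q u' - Q u‖ ≤ w * (u' - u))
    (hf : ‖f a' - f a‖ ≤ v * |a' - a|) (h : gap Q f u a = 0) (h' : gap Q f u' a' = 0) :
    (1 - w) / 2 * (u' - u) ≤ a' - a := by
  have e := norm_of_gap_eq_zero h
  have e' := norm_of_gap_eq_zero h'
  have tri : ‖f a - Q u‖ ≤ ‖f a' - f a‖ + ‖f a' - Q u'‖ + ‖Q u' - Q u‖ := by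
    have : f a - Q u = -(f a' - f a) + (f a' - Q u') + (Q u' - Q u) := by abel
    rw [this]
    refine (norm_add_le _ _).trans (add_le_add ((norm_add_le _ _).trans ?_) le_rfl)
    rw [norm_neg]
  rcases le_or_gt a a' with haa | haa
  · rw [abs_of_nonneg (by linarith)] at hf
    nlinarith
  · rw [abs_of_neg (by linarith)] at hf
    nlinarith

/-- Let `f` be a curve before the time `T`, and let `G` be smooth near `s` and equal, before `s`, to
the Coulomb field at `Q u` of a charge at the advanced point `f (a u)`. As the Coulomb field
is invertible, `G` determines a smooth continuation `L` of `f` past `T`; the retarded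
times of its points on `Q` are given by `σ`. -/
lemma exists_smooth_continuation {Q G f : ℝ → Space} {s T v : ℝ} {a : ℝ → ℝ} {I : Set ℝ}
    (hQ : SmoothNear Q s) (hG : SmoothNear G s) (hG0 : G s ≠ 0) (hQv : ‖deriv Q s‖ < 1)
    (hv : v < 1) (hf : ∀ x ∈ I, ∀ y ∈ I, ‖f y - f x‖ ≤ v * |y - x|)
    (hI : I ∈ 𝓝[<] T)
    (ha : ∀ᶠ u in 𝓝[<] s, a u ∈ I ∧ gap Q f u (a u) = 0 ∧ coulomb (Q u - f (a u)) = G u)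
    (haT : Tendsto a (𝓝[<] s) (𝓝 T)) :
    ∃ (L : ℝ → Space) (σ : ℝ → ℝ), SmoothNear L T ∧ ContinuousAt σ T ∧ σ T = s ∧
      ‖deriv L T‖ < 1 ∧ (∀ᶠ t in 𝓝[<] T, L t = f t) ∧ (∀ᶠ t in 𝓝[>] T, s < σ t) ∧
      ∀ᶠ t in 𝓝 T, gap Q L (σ t) t = 0 ∧ coulomb (Q (σ t) - L t) = G (σ t) ∧
        Q (σ t) ≠ L t := by
  -- `W` is the displacement from the advanced point to `Q u`, recovered from the field. Light needs
  -- time `‖W u‖` for it, so `θ` is the advanced time; both make sense on either side of `s`.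
  let W : ℝ → Space := fun u => coulombInv (G u)
  let θ : ℝ → ℝ := fun u => u + ‖W u‖
  have hW : SmoothNear W s := SmoothNear.comp (smoothNear_coulombInv hG0) hG
  have hθ : SmoothNear θ s :=
    (smoothNear_id s).add (SmoothNear.comp (smoothNear_norm (coulombInv_ne_zero hG0)) hW)
  have hGn : ∀ᶠ u in 𝓝 s, G u ≠ 0 := hG.continuousAt.eventually_ne hG0
  -- left of `s`
  have hleft : ∀ᶠ u in 𝓝[<] s, W u = Q u - f (a u) ∧ θ u = a u := by
    filter_upwards [ha, nhdsWithin_le_nhds hGn] with u hu hGu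
    have hne : Q u - f (a u) ≠ 0 := fun h0 => hGu (by rw [← hu.2.2, h0, coulomb_zero])
    have hWu : W u = Q u - f (a u) := by
      simp only [W]; rw [← hu.2.2, coulombInv_coulomb hne]
    refine ⟨hWu, ?_⟩
    simp only [θ]
    rw [hWu, norm_sub_rev, norm_of_gap_eq_zero hu.2.1]; ring
  have hθs : θ s = T := by
    refine tendsto_nhds_unique (f := θ) (l := 𝓝[<] s)
      (hθ.continuousAt.mono_left nhdsWithin_le_nhds) (haT.congr' ?_)
    filter_upwards [hleft] with u hu using hu.2.symm
  -- the derivative of `θ` at `s` is positive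
  obtain ⟨w, hw1, hw2⟩ := exists_between hQv
  obtain ⟨ε, hε, hQL⟩ := hQ.exists_lipschitz hw1
  -- To the left of `s`, `θ` is the advanced time on the actual curve, so the expansion estimate
  -- applies; letting `u'` tend to `s` bounds the left difference quotients, and thereby the
  -- derivative of `θ` at `s`, away from zero.
  have hexp : ∀ᶠ u in 𝓝[<] s, (1 - w) / 2 * (s - u) ≤ T - θ u := by
    have hall : ∀ᶠ u in 𝓝[<] s, u ∈ Ioo (s - ε) s ∧
        (a u ∈ I ∧ gap Q f u (a u) = 0 ∧ coulomb (Q u - f (a u)) = G u) ∧ θ u = a u := by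
      filter_upwards [ha, hleft, Ioo_mem_nhdsLT (sub_lt_self s hε)] with u h1 h2 h3
        using ⟨h3, h1, h2.2⟩
    filter_upwards [hall] with u hu
    have lim1 : Tendsto (fun u' => (1 - w) / 2 * (u' - u)) (𝓝[<] s) (𝓝 ((1 - w) / 2 * (s - u))) :=
      (Continuous.tendsto (by fun_prop) s).mono_left nhdsWithin_le_nhds
    have lim2 : Tendsto (fun u' => θ u' - θ u) (𝓝[<] s) (𝓝 (T - θ u)) := by
      rw [← hθs]
      exact (hθ.continuousAt.sub continuousAt_const).mono_left nhdsWithin_le_nhds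
    refine le_of_tendsto_of_tendsto lim1 lim2 ?_
    filter_upwards [hall, Ioo_mem_nhdsLT hu.1.2] with u' hu' huu
    have hmem : ∀ x ∈ Ioo (s - ε) s, x ∈ Ioo (s - ε) (s + ε) := fun x hx =>
      ⟨hx.1, hx.2.trans (by linarith)⟩
    have hq := hQL u (hmem u hu.1) u' (hmem u' hu'.1)
    rw [abs_of_pos (sub_pos.2 huu.1)] at hq
    rw [hu.2.2, hu'.2.2]
    exact advanced_time_expansion hv hw2 huu.1 hq
      (hf _ hu.2.1.1 _ hu'.2.1.1) hu.2.1.2.1 hu'.2.1.2.1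
  have hκ : 0 < (1 - w) / 2 := by linarith
  have hderiv : (1 - w) / 2 ≤ deriv θ s := by
    have := (hasDerivWithinAt_iff_tendsto_slope' (s := Iio s) (by simp)).1
      hθ.differentiableAt.hasDerivAt.hasDerivWithinAt
    refine ge_of_tendsto this ?_
    filter_upwards [hexp, self_mem_nhdsWithin] with u hu hus
    have hus : u < s := hus
    rw [slope_comm, slope_def_field, le_div_iff₀ (sub_pos.2 hus), hθs]
    exact hu
  have hpos : 0 < deriv θ s := hκ.trans_le hderiv
  have hright : ∀ᶠ u in 𝓝 s, s < u → T < θ u := by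
    have := (hasDerivWithinAt_iff_tendsto_slope' (s := Ioi s) (by simp)).1
      hθ.differentiableAt.hasDerivAt.hasDerivWithinAt
    have := this.eventually (Ioi_mem_nhds hpos)
    rw [eventually_nhdsWithin_iff] at this
    filter_upwards [this] with u hu hus
    have := hu hus
    rw [slope_def_field, hθs] at this
    have := (div_pos_iff_of_pos_right (sub_pos.2 hus)).1 this
    linarith
  have hleft' : ∀ᶠ u in 𝓝 s, u < s → θ u < T := by
    rw [eventually_nhdsWithin_iff] at hexp
    filter_upwards [hexp] with u hu hus
    have := hu hus
    have : 0 < (1 - w) / 2 * (s - u) := mul_pos hκ (sub_pos.2 hus)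
    linarith
  -- the inverse function of `θ`
  have hH : SmoothNear (fun z : ℝ × ℝ => θ z.2 - z.1) (T, s) :=
    (SmoothNear.comp (f := Prod.snd) hθ (ContDiff.smoothNear contDiff_snd _)).sub
      (ContDiff.smoothNear contDiff_fst _)
  obtain ⟨σ, hσ, hσT, hσθ, -⟩ := exists_implicit hH (by
    have hc : HasDerivAt (fun y : ℝ => ((T, y) : ℝ × ℝ)) (0, 1) s :=
      (hasDerivAt_const s T).prodMk (hasDerivAt_id s)
    have hd := hH.differentiableAt.hasFDerivAt.comp_hasDerivAt s hc
    have hd' : HasDerivAt (fun y => θ y - T) (deriv θ s) s :=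
      hθ.differentiableAt.hasDerivAt.sub_const T
    rw [hd.unique hd']
    exact hpos.ne')
  simp only [hθs, sub_self] at hσT hσθ
  have hσtend : Tendsto σ (𝓝 T) (𝓝 s) := by
    have : Tendsto σ (𝓝 T) (𝓝 (σ T)) := hσ.continuousAt
    rwa [hσT] at this
  have hσT' : ∀ g : ℝ → Space, SmoothNear g s → SmoothNear (fun t => g (σ t)) T :=
    fun g hg => SmoothNear.comp (hσT.symm ▸ hg) hσ
  let L : ℝ → Space := fun t => Q (σ t) - W (σ t)
  have hL : SmoothNear L T := (hσT' Q hQ).sub (hσT' W hW)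
  have hLf : ∀ᶠ t in 𝓝[<] T, L t = f t := by
    have h1 : ∀ᶠ t in 𝓝 T, σ t < s → W (σ t) = Q (σ t) - f (a (σ t)) ∧ θ (σ t) = a (σ t) :=
      hσtend.eventually (eventually_nhdsWithin_iff.1 hleft)
    filter_upwards [nhdsWithin_le_nhds h1, nhdsWithin_le_nhds hσθ,
      nhdsWithin_le_nhds (hσtend.eventually hright), self_mem_nhdsWithin] with t h1 h2 h3 ht
    have ht : t < T := ht
    have hlt : σ t < s := by
      rcases lt_trichotomy (σ t) s with h | h | h
      · exact h
      · rw [h, hθs] at h2; linarith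
      · have := h3 h; linarith
    obtain ⟨h4, h5⟩ := h1 hlt
    have : a (σ t) = t := by linarith
    simp only [L]
    rw [h4, this]; abel
  refine ⟨L, σ, hL, hσ.continuousAt, hσT, ?_, hLf, ?_, ?_⟩
  -- Before `T` the curve `L` is `f`, so its left difference quotients are bounded by `v`. A uniform
  -- bound is needed here: speeds that are merely below one could tend to one.
  · refine lt_of_le_of_lt ?_ hv
    have hlim := (hasDerivWithinAt_iff_tendsto_slope' (s := Iio T) (by simp)).1
      hL.differentiableAt.hasDerivAt.hasDerivWithinAt
    refine le_of_tendsto hlim.norm ?_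
    filter_upwards [hLf, hI, self_mem_nhdsWithin] with x hx hxI hxT
    have hxT : x < T := hxT
    have hle : ‖L T - L x‖ ≤ v * (T - x) := by
      have l1 : Tendsto (fun y => ‖L y - L x‖) (𝓝[<] T) (𝓝 ‖L T - L x‖) :=
        (hL.continuousAt.sub continuousAt_const).norm.mono_left nhdsWithin_le_nhds
      have l2 : Tendsto (fun y => v * (y - x)) (𝓝[<] T) (𝓝 (v * (T - x))) :=
        (Continuous.tendsto (by fun_prop) T).mono_left nhdsWithin_le_nhds
      refine le_of_tendsto_of_tendsto l1 l2 ?_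
      filter_upwards [hLf, hI, Ioo_mem_nhdsLT hxT] with y hy hyI hxy
      have := hf x hxI y hyI
      rw [abs_of_pos (sub_pos.2 hxy.1)] at this
      rwa [hy, hx]
    rw [slope_comm, slope_def_module, norm_smul, norm_inv, Real.norm_of_nonneg (by linarith),
      inv_mul_le_iff₀ (sub_pos.2 hxT), mul_comm]
    exact hle
  · filter_upwards [nhdsWithin_le_nhds hσθ, nhdsWithin_le_nhds (hσtend.eventually hleft'),
      self_mem_nhdsWithin] with t h2 h3 ht
    have ht : T < t := ht
    rcases lt_trichotomy s (σ t) with h | h | h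
    · exact h
    · rw [← h, hθs] at h2; linarith
    · have := h3 h; linarith
  · filter_upwards [hσθ, hσtend.eventually hGn] with t h2 h3
    have hW0 : Q (σ t) - L t = W (σ t) := by simp only [L]; abel
    refine ⟨?_, ?_, ?_⟩
    · rw [gap, norm_sub_rev, hW0]
      simp only [θ] at h2
      linarith
    · rw [hW0]; exact coulomb_coulombInv h3
    · rw [← sub_ne_zero, hW0]; exact coulombInv_ne_zero h3

/-! ### Extension of a solution by a smooth continuation of one trajectory -/

namespace IsContinuation

variable {m e t0 t1 c : Fin 2 → ℝ} {J : Fin 2 → Set ℝ} {q p : Fin 2 → ℝ → Space} {k l : Fin 2}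

lemma mem_of_lt_isLUB (S : IsContinuation m e t0 t1 c J q p) {T t : ℝ} (hT : IsLUB (J l) T)
    (h0 : t0 l ≤ t) (h : t < T) : t ∈ J l := by
  obtain ⟨x, hx, htx⟩ := (lt_isLUB_iff hT).1 h
  exact S.Icc_subset (S.t0_mem l) hx ⟨h0, htx.le⟩

lemma t1_le_of_isLUB (S : IsContinuation m e t0 t1 c J q p) {T : ℝ} (hT : IsLUB (J l) T) :
    t1 l ≤ T := hT.1 (S.t1_mem l)

/-- Adding a piece of `L` to trajectory `l` adds equations for `k` only: those at the times `σ t`,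
whose advanced times have become available, and they hold because `G` is the field of `L` there. No
equation for `l` is added, since the new points of `l` have no advanced time on the unchanged
trajectory of `k`. -/
lemma exists_extension (S : IsContinuation m e t0 t1 c J q p) (hkl : k ≠ l) {Q G L : ℝ → Space}
    {σ : ℝ → ℝ} {s T : ℝ} (hT : IsLUB (J l) T) (hT1 : T ∈ J l ∨ t1 l < T) (hsT : s < T)
    (hQ : ∀ᶠ u in 𝓝[≥] s, u ∈ J k ∧ Q u = q k u ∧ ∀ r ∈ J l, gap (q l) (q k) r u = 0 →
      HasDerivWithinAt (p k) ((e k * e l) • (G u + coulomb (q k u - q l r))) (J k) u)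
    (hL : SmoothNear L T) (hσ : ContinuousAt σ T) (hσT : σ T = s) (hL1 : ‖deriv L T‖ < 1)
    (hLf : ∀ᶠ t in 𝓝[<] T, L t = q l t) (hσs : ∀ᶠ t in 𝓝[>] T, s < σ t)
    (hLσ : ∀ᶠ t in 𝓝 T, gap Q L (σ t) t = 0 ∧ coulomb (Q (σ t) - L t) = G (σ t) ∧
      Q (σ t) ≠ L t) :
    ∃ J' q' p', IsContinuation m e t0 t1 c J' q' p' ∧
      AgreeOn (fun k => Icc (t0 k) (t1 k)) q' p' q p ∧ ∃ t ∈ J' l, T < t := by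
  classical
  have h0T : t0 l < T := (S.lt l).trans_le (S.t1_le_of_isLUB hT)
  -- choice of a neighbourhood of `T`
  have hσ' : Tendsto σ (𝓝[≥] T) (𝓝[≥] s) := by
    refine tendsto_nhdsWithin_iff.2 ⟨hσT ▸ hσ.tendsto.mono_left nhdsWithin_le_nhds, ?_⟩
    rw [eventually_nhdsWithin_iff] at hσs ⊢
    filter_upwards [hσs] with t ht htT
    rcases (show T ≤ t from htT).eq_or_lt with rfl | h
    · exact hσT.ge
    · exact (ht h).le
  obtain ⟨ε, hε, B⟩ : ∃ ε > 0, ∀ t ∈ Ioo (T - ε) (T + ε), (ContDiffAt ℝ ∞ L t ∧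
      ‖deriv L t‖ < 1 ∧ (gap Q L (σ t) t = 0 ∧ coulomb (Q (σ t) - L t) = G (σ t) ∧
      Q (σ t) ≠ L t) ∧ σ t < T ∧ t0 l < t) ∧ (t < T → L t = q l t) ∧
      (T ≤ t → σ t ∈ J k ∧ Q (σ t) = q k (σ t) ∧ ∀ r ∈ J l, gap (q l) (q k) r (σ t) = 0 →
      HasDerivWithinAt (p k) ((e k * e l) • (G (σ t) + coulomb (q k (σ t) - q l r))) (J k)
        (σ t)) := by
    have h1 := hL.smoothNear_deriv.continuousAt.norm.eventually (Iio_mem_nhds hL1)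
    have h2 : ∀ᶠ t in 𝓝 T, σ t < T := by
      have : Tendsto σ (𝓝 T) (𝓝 s) := hσT ▸ hσ.tendsto
      exact this.eventually (Iio_mem_nhds hsT)
    have h3 := eventually_nhdsWithin_iff.1 hLf
    have h4 := eventually_nhdsWithin_iff.1 (hσ'.eventually hQ)
    obtain ⟨ε, hε, H⟩ := Metric.eventually_nhds_iff_ball.1
      ((hL.and (h1.and (hLσ.and (h2.and (Ioi_mem_nhds h0T))))).and (h3.and h4))
    rw [Real.ball_eq_Ioo] at H
    exact ⟨ε, hε, H⟩
  have hTU : T ∈ Ioo (T - ε) (T + ε) := ⟨by linarith, by linarith⟩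
  have memJ : ∀ t ∈ Ioo (T - ε) (T + ε), t < T → t ∈ J l := fun t ht htT =>
    S.mem_of_lt_isLUB hT (B t ht).1.2.2.2.2.le htT
  have LT : T ∈ J l → L T = q l T := by
    intro hTJ
    have c1 : Tendsto L (𝓝[<] T) (𝓝 (L T)) := hL.continuousAt.mono_left nhdsWithin_le_nhds
    have c2 : Tendsto (q l) (𝓝[<] T) (𝓝 (q l T)) := by
      refine (S.continuousOn l T hTJ).mono_left ?_
      refine nhdsWithin_le_of_mem ?_
      filter_upwards [Ioo_mem_nhdsLT h0T] with t ht using S.mem_of_lt_isLUB hT ht.1.le ht.2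
    exact tendsto_nhds_unique c1 (c2.congr' (hLf.mono fun _ h => h.symm))
  have LJ : ∀ t ∈ J l, t ∈ Ioo (T - ε) (T + ε) → L t = q l t := by
    intro t ht htU
    rcases (hT.1 ht).eq_or_lt with rfl | h
    · exact LT ht
    · exact (B t htU).2.1 h
  have PJ : ∀ t ∈ J l, t ∈ Ioo (T - ε) (T + ε) → momentum (m l) (deriv L t) = p l t := by
    intro t ht htU
    have hLd : HasDerivWithinAt L (deriv L t) (J l) t :=
      ((B t htU).1.1.differentiableAt (by simp)).hasDerivAt.hasDerivWithinAt
    have hqd : HasDerivWithinAt L (velocity (m l) (p l t)) (J l) t := by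
      refine (S.velocity_eq l t ht).congr_of_eventuallyEq ?_ (LJ t ht htU)
      filter_upwards [self_mem_nhdsWithin, mem_nhdsWithin_of_mem_nhds (isOpen_Ioo.mem_nhds htU)]
        with x hx hxU using LJ x hx hxU
    rw [(S.uniqueDiffOn l t ht).eq_deriv _ hLd hqd, momentum_velocity (S.mass_pos l)]
  -- the extended solution
  let J' : Fin 2 → Set ℝ := fun n => {t | t ∈ J n ∨ n = l ∧ t ∈ Icc T (T + ε / 2)}
  let q' : Fin 2 → ℝ → Space := fun n t => if n = l ∧ T ≤ t then L t else q n t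
  let p' : Fin 2 → ℝ → Space := fun n t =>
    if n = l ∧ T ≤ t then momentum (m l) (deriv L t) else p n t
  have Jk : J' k = J k := by ext t; simp [J', hkl]
  have qk : q' k = q k := by funext t; simp [q', hkl]
  have pk : p' k = p k := by funext t; simp [p', hkl]
  have sub : ∀ n, J n ⊆ J' n := fun n t ht => Or.inl ht
  have hcase := eq_or_eq_of_ne hkl
  have ql : ∀ t, T ≤ t → q' l t = L t := fun t ht => by simp [q', ht]
  have pl : ∀ t, T ≤ t → p' l t = momentum (m l) (deriv L t) := fun t ht => by simp [p', ht]
  have ql_lt : ∀ t, t < T → q' l t = q l t := fun t ht => by simp [q', ht]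
  have pl_lt : ∀ t, t < T → p' l t = p l t := fun t ht => by simp [p', ht]
  have qU : ∀ t ∈ Ioo (T - ε) (T + ε), q' l t = L t := by
    intro t ht
    rcases lt_or_ge t T with h | h
    · rw [ql_lt t h, LJ t (memJ t ht h) ht]
    · exact ql t h
  have pU : ∀ t ∈ Ioo (T - ε) (T + ε), p' l t = momentum (m l) (deriv L t) := by
    intro t ht
    rcases lt_or_ge t T with h | h
    · rw [pl_lt t h, PJ t (memJ t ht h) ht]
    · exact pl t h
  have agree : ∀ n, ∀ t ∈ J n, q' n t = q n t ∧ p' n t = p n t := by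
    intro n t ht
    rcases hcase n with rfl | rfl
    · rw [qk, pk]; exact ⟨rfl, rfl⟩
    · rcases (hT.1 ht).eq_or_lt with rfl | h
      · exact ⟨(qU _ hTU).trans (LJ _ ht hTU), (pU _ hTU).trans (PJ _ ht hTU)⟩
      · exact ⟨ql_lt t h, pl_lt t h⟩
  have split : ∀ t ∈ J' l, (t < T ∧ t ∈ J l ∧ J l ∈ 𝓝[J' l] t) ∨ t ∈ Ioo (T - ε) (T + ε) := by
    intro t ht
    rcases lt_or_ge t T with h | h
    · have hlt : ∀ x ∈ J' l, x < T → x ∈ J l := by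
        intro x hx hxT
        rcases hx with hx | ⟨-, hx⟩
        · exact hx
        · exact absurd hx.1 (not_le.2 hxT)
      refine Or.inl ⟨h, hlt t ht h, ?_⟩
      filter_upwards [self_mem_nhdsWithin, mem_nhdsWithin_of_mem_nhds (Iio_mem_nhds h)] with x hx hxT
        using hlt x hx hxT
    · refine Or.inr ⟨by linarith, ?_⟩
      rcases ht with ht | ⟨-, ht⟩
      · linarith [hT.1 ht]
      · linarith [ht.2]
  have hqev : ∀ t ∈ Ioo (T - ε) (T + ε), q' l =ᶠ[𝓝 t] L := fun t ht => by
    filter_upwards [isOpen_Ioo.mem_nhds ht] with x hx using qU x hx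
  have hpev : ∀ t ∈ Ioo (T - ε) (T + ε), p' l =ᶠ[𝓝 t] fun t => momentum (m l) (deriv L t) :=
    fun t ht => by filter_upwards [isOpen_Ioo.mem_nhds ht] with x hx using pU x hx
  have oc : ∀ n, (J' n).OrdConnected := by
    intro n
    rcases hcase n with rfl | rfl
    · rw [Jk]; exact S.ordConnected n
    · refine ⟨fun x hx y hy z hz => ?_⟩
      rcases lt_or_ge z T with h | h
      · rcases hx with hx | ⟨-, hx⟩
        · rcases hy with hy | ⟨-, hy⟩
          · exact Or.inl (S.Icc_subset hx hy hz)
          · rcases le_total z (t0 n) with hz0 | hz0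
            · exact Or.inl (S.Icc_subset hx (S.t0_mem n) ⟨hz.1, hz0⟩)
            · exact Or.inl (S.mem_of_lt_isLUB hT hz0 h)
        · exact absurd (hx.1.trans hz.1) (not_le.2 h)
      · refine Or.inr ⟨rfl, h, hz.2.trans ?_⟩
        rcases hy with hy | ⟨-, hy⟩
        · linarith [hT.1 hy]
        · exact hy.2
  have strip : ∀ n, Icc (t0 n) (t1 n) ⊆ J' n := fun n => (S.strip_subset n).trans (sub n)
  have sq : ∀ n, ContDiffOn ℝ ∞ (q' n) (J' n) := by
    intro n
    rcases hcase n with rfl | rfl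
    · rw [Jk, qk]; exact S.smooth_q n
    · intro t ht
      rcases split t ht with ⟨h, htJ, hn⟩ | h
      · exact (((S.smooth_q n).congr fun x hx => (agree n x hx).1) t htJ).mono_of_mem_nhdsWithin hn
      · exact ((B t h).1.1.congr_of_eventuallyEq (hqev t h)).contDiffWithinAt
  have sp : ∀ n, ContDiffOn ℝ ∞ (p' n) (J' n) := by
    intro n
    rcases hcase n with rfl | rfl
    · rw [Jk, pk]; exact S.smooth_p n
    · intro t ht
      rcases split t ht with ⟨h, htJ, hn⟩ | h
      · exact (((S.smooth_p n).congr fun x hx => (agree n x hx).2) t htJ).mono_of_mem_nhdsWithin hn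
      · refine ContDiffAt.contDiffWithinAt (ContDiffAt.congr_of_eventuallyEq ?_ (hpev t h))
        exact (contDiffAt_momentum (B t h).1.2.1).comp t
          (((B t h).1.1.fderiv_right (m := ∞) (by simp)).clm_apply contDiffAt_const)
  have vel : ∀ n, ∀ t ∈ J' n, HasDerivWithinAt (q' n) (velocity (m n) (p' n t)) (J' n) t := by
    intro n
    rcases hcase n with rfl | rfl
    · rw [Jk, qk, pk]; exact S.velocity_eq n
    · intro t ht
      rcases split t ht with ⟨h, htJ, hn⟩ | h
      · rw [(agree n t htJ).2]
        exact ((S.velocity_eq n t htJ).congr (fun x hx => (agree n x hx).1)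
          (agree n t htJ).1).mono_of_mem_nhdsWithin hn
      · rw [pU t h, velocity_momentum (S.mass_pos n) (B t h).1.2.1]
        exact (((B t h).1.1.differentiableAt (by simp)).hasDerivAt.congr_of_eventuallyEq
          (hqev t h)).hasDerivWithinAt
  have tl : ∀ n, Timelike (q' n) (J' n) := fun n =>
    timelike_of_velocity (S.mass_pos n) (oc n) (sp n).continuousOn (vel n)
  have gap_eq : ∀ a ∈ J l, ∀ b, gap (q' l) (q' k) a b = gap (q l) (q k) a b := fun a ha b => by
    rw [gap, gap, qk, (agree l a ha).1]
  have gap_eq' : ∀ a, ∀ b ∈ J l, gap (q' k) (q' l) a b = gap (q k) (q l) a b := fun a b hb => by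
    rw [gap, gap, qk, (agree l b hb).1]
  have gapU : ∀ t ∈ Ioo (T - ε) (T + ε), T ≤ t → gap (q' k) (q' l) (σ t) t = 0 := by
    intro t ht h
    rw [← (B t ht).1.2.2.1.1, gap, gap, qU t ht, qk, ((B t ht).2.2 h).2.1]
  have newU : ∀ t ∈ J' l, T ≤ t → t ∈ Ioo (T - ε) (T + ε) := fun t ht h => by
    rcases split t ht with ⟨h', -⟩ | h'
    · exact absurd h' (not_lt.2 h)
    · exact h'
  have oldJ : ∀ t ∈ J' l, t < T → t ∈ J l := fun t ht h => by
    rcases ht with ht | ⟨-, ht⟩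
    · exact ht
    · exact absurd ht.1 (not_le.2 h)
  have sol : IsSolution m e t0 t1 J' q' p' := by
    refine ⟨oc, strip, sq, sp, vel, ?_, ?_, ?_⟩
    · intro n n' hn t ht b a hB hA
      obtain ⟨hb, htb⟩ := isAdvancedTime_iff.1 hB
      obtain ⟨ha, hat⟩ := isRetardedTime_iff.1 hA
      rcases hcase n with rfl | rfl <;> rcases hcase n' with rfl | rfl
      · exact absurd rfl hn
      · -- particle `k`
        rw [Jk] at ht
        have hat' := le_of_gap_eq_zero hat
        have htb' := le_of_gap_eq_zero htb
        rw [Jk, qk, pk]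
        rcases lt_or_ge b T with hbT | hbT
        · have hbJ := oldJ b hb hbT
          have haJ := oldJ a ha (by linarith)
          rw [gap_eq' _ _ hbJ] at htb
          rw [gap_eq _ haJ] at hat
          rw [(agree _ b hbJ).1, (agree _ a haJ).1]
          exact ⟨S.ne_of_gap hn ht hbJ htb, (S.ne_of_gap hn.symm haJ ht hat).symm,
            S.hasDerivWithinAt_p hn ht haJ hbJ hat htb⟩
        -- The advanced time is new, so `t` must be its retarded time `σ b`. The field `G` was
        -- chosen to make the momentum equation hold there.
        · have hbU := newU b hb hbT
          obtain ⟨hσJ, hσQ, hσd⟩ := (B b hbU).2.2 hbT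
          obtain rfl : σ b = t := (tl n).eq_left (Jk.symm ▸ hσJ) (Jk.symm ▸ ht)
            ((gapU b hbU hbT).trans htb.symm)
          have haT : a < T := lt_of_le_of_lt hat' (B b hbU).1.2.2.2.1
          have haJ := oldJ a ha haT
          rw [gap_eq _ haJ] at hat
          have h3 := (B b hbU).1.2.2.1
          rw [hσQ] at h3
          rw [(agree _ a haJ).1, qU b hbU]
          refine ⟨h3.2.2, (S.ne_of_gap hn.symm haJ ht hat).symm, ?_⟩
          rw [force, h3.2.1]
          exact hσd a haJ hat
      · -- particle `l`
        rw [Jk] at ha hb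
        have htJ : t ∈ J n := by
          -- An advanced time of a new point would lie beyond the strip of the other particle, hence
          -- would already have a retarded time in the old interval. By uniqueness of retarded times
          -- the point would not be new.
          by_contra hnot
          have hTt : T ≤ t := le_of_not_gt fun h => hnot (oldJ t ht h)
          have h1t : t1 n < t := by
            rcases hT1 with h | h
            · refine (S.t1_le_of_isLUB hT).trans_lt (hTt.lt_of_ne ?_)
              rintro rfl; exact hnot h
            · exact h.trans_le hTt
          have hbk : t1 n' < b := by
            refine (tl n').lt_right_of_gap_lt (f := q' n) (a := t) (strip _ ?_) (sub _ hb) ?_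
            · exact right_mem_Icc.2 (S.lt n').le
            · have h0 : gap (q' n) (q' n') (c n) (t1 n') = 0 := by
                rw [gap_eq _ (S.c_mem n)]; exact S.gap_right n n' hn
              rw [htb, ← h0]
              exact (tl n).gap_lt_left (sub _ (S.c_mem n)) ht ((S.mem n).2.trans_lt h1t)
          obtain ⟨x, hx⟩ := S.reached_future n' n hn.symm b hb hbk
          obtain ⟨hx, hxb⟩ := isRetardedTime_iff.1 hx
          rw [← gap_eq _ hx] at hxb
          exact hnot ((tl n).eq_left (sub _ hx) ht (hxb.trans htb.symm) ▸ hx)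
        rw [gap_eq _ htJ] at htb
        rw [gap_eq' _ _ htJ] at hat
        rw [qk, (agree _ t htJ).1]
        refine ⟨S.ne_of_gap hn htJ hb htb, (S.ne_of_gap hn.symm ha htJ hat).symm, ?_⟩
        have d := ((sp n).differentiableOn (by simp) t ht).hasDerivWithinAt
        have d1 := (d.mono (sub n)).congr (fun x hx => (agree n x hx).2.symm)
          (agree n t htJ).2.symm
        rwa [(S.uniqueDiffOn n t htJ).eq_deriv _ d1
          (S.hasDerivWithinAt_p hn htJ ha hb hat htb)] at d
      · exact absurd rfl hn
    · intro n n' hn t ht h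
      simp only [isRetardedTime_iff]
      rcases hcase n with rfl | rfl <;> rcases hcase n' with rfl | rfl
      · exact absurd rfl hn
      · rw [Jk] at ht
        obtain ⟨x, hx⟩ := S.reached_future n n' hn t ht h
        obtain ⟨hx, hxt⟩ := isRetardedTime_iff.1 hx
        exact ⟨x, sub _ hx, by rw [gap_eq _ hx, hxt]⟩
      · rcases lt_or_ge t T with htT | htT
        · have htJ := oldJ t ht htT
          obtain ⟨x, hx⟩ := S.reached_future n n' hn t htJ h
          obtain ⟨hx, hxt⟩ := isRetardedTime_iff.1 hx
          exact ⟨x, sub _ hx, by rw [gap_eq' _ _ htJ, hxt]⟩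
        · have htU := newU t ht htT
          exact ⟨σ t, sub _ ((B t htU).2.2 htT).1, gapU t htU htT⟩
      · exact absurd rfl hn
    · intro n n' hn t ht h
      simp only [isAdvancedTime_iff]
      rcases hcase n with rfl | rfl <;> rcases hcase n' with rfl | rfl
      · exact absurd rfl hn
      · rw [Jk] at ht
        obtain ⟨x, hx⟩ := S.reached_past n n' hn t ht h
        obtain ⟨hx, hxt⟩ := isAdvancedTime_iff.1 hx
        exact ⟨x, sub _ hx, by rw [gap_eq' _ _ hx, hxt]⟩
      · have htJ := oldJ t ht (h.trans h0T)
        obtain ⟨x, hx⟩ := S.reached_past n n' hn t htJ h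
        obtain ⟨hx, hxt⟩ := isAdvancedTime_iff.1 hx
        exact ⟨x, sub _ hx, by rw [gap_eq _ htJ, hxt]⟩
      · exact absurd rfl hn
  have hag : AgreeOn (fun k => Icc (t0 k) (t1 k)) q' p' q p := fun n t ht =>
    agree n t (S.strip_subset n ht)
  exact ⟨J', q', p', S.congr sol hag, hag, T + ε / 2, Or.inr ⟨rfl, by linarith, le_rfl⟩,
    by linarith⟩

/-! ### Continuation past an end point, away from and at the end of a strip -/

lemma hasDerivAt (S : IsContinuation m e t0 t1 c J q p) {t : ℝ} (h : J k ∈ 𝓝 t) :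
    HasDerivAt (q k) (velocity (m k) (p k t)) t :=
  (S.velocity_eq k t (mem_of_mem_nhds h)).hasDerivAt h

lemma lipschitz_of_velocity_le (S : IsContinuation m e t0 t1 c J q p) {v : ℝ} {I : Set ℝ}
    (hI : I.OrdConnected) (hIJ : I ⊆ J k) (hv : ∀ t ∈ I, ‖velocity (m k) (p k t)‖ ≤ v) :
    ∀ x ∈ I, ∀ y ∈ I, ‖q k y - q k x‖ ≤ v * |y - x| := fun _ hx _ hy =>
  hI.convex.norm_image_sub_le_of_norm_hasDerivWithin_le
    (fun t ht => (S.velocity_eq k t (hIJ ht)).mono hIJ) hv hx hy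

lemma exists_speed_bound (S : IsContinuation m e t0 t1 c J q p) {x y : ℝ} (h : Icc x y ⊆ J k) :
    ∃ v < 1, ∀ t ∈ Icc x y, ‖velocity (m k) (p k t)‖ ≤ v := by
  have hc : ContinuousOn (fun t => 1 - ‖velocity (m k) (p k t)‖) (Icc x y) :=
    continuousOn_const.sub ((contDiff_velocity (S.mass_pos k)).continuous.comp_continuousOn
      ((S.smooth_p k).continuousOn.mono h)).norm
  obtain ⟨δ, hδ, H⟩ := isCompact_Icc.exists_forall_le' hc (a := 0)
    (fun t _ => sub_pos.2 (norm_velocity_lt_one (S.mass_pos k) _))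
  exact ⟨1 - δ, by linarith, fun t ht => by linarith [H t ht]⟩

lemma Ico_subset_of_isLUB (S : IsContinuation m e t0 t1 c J q p) {T : ℝ} (hT : IsLUB (J l) T) :
    Ico (t0 l) T ⊆ J l := fun _ ht => S.mem_of_lt_isLUB hT ht.1 ht.2

/-- The times of particle `k` that are retarded times of times of particle `l` in `[t1 l, T)`. -/
def retardedTimes (t1 : Fin 2 → ℝ) (J : Fin 2 → Set ℝ) (q : Fin 2 → ℝ → Space) (k l : Fin 2)
    (T : ℝ) : Set ℝ :=
  {x | x ∈ J k ∧ ∃ t ∈ J l, t1 l ≤ t ∧ t < T ∧ gap (q k) (q l) x t = 0}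

lemma exists_mem_retardedTimes (S : IsContinuation m e t0 t1 c J q p) (hkl : k ≠ l) {T y : ℝ}
    (hT : IsLUB (J l) T) (h1 : t1 l ≤ y) (hy : y < T) :
    ∃ x ∈ retardedTimes t1 J q k l T, gap (q k) (q l) x y = 0 := by
  have hyJ := S.mem_of_lt_isLUB hT ((S.lt l).le.trans h1) hy
  obtain ⟨x, hx, hxy, -⟩ := S.exists_retarded hkl.symm hyJ ((S.mem l).2.trans h1)
  exact ⟨x, ⟨hx, y, hyJ, h1, hy, hxy⟩, hxy⟩

lemma c_lt_of_isLUB (S : IsContinuation m e t0 t1 c J q p) (hkl : k ≠ l) {s T : ℝ}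
    (hT : IsLUB (J l) T) (hT1 : t1 l < T) (hs : IsLUB (retardedTimes t1 J q k l T) s) :
    c k < s := by
  obtain ⟨y, hy1, hyT⟩ := exists_between hT1
  obtain ⟨x, hx, hxy⟩ := S.exists_mem_retardedTimes hkl hT hy1.le hyT
  have hyJ := S.mem_of_lt_isLUB hT ((S.lt l).le.trans hy1.le) hyT
  exact (S.c_lt_of_gap hkl.symm hx.1 hyJ hxy hy1).trans_le (hs.1 hx)

lemma lt_of_mem_retardedTimes (S : IsContinuation m e t0 t1 c J q p) (hkl : k ≠ l) {s T x y : ℝ}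
    (hT : IsLUB (J l) T) (hs : IsLUB (retardedTimes t1 J q k l T) s)
    (h1 : t1 l ≤ y) (hy : y < T) (hx : x ∈ J k) (hxy : gap (q k) (q l) x y = 0) : x < s := by
  obtain ⟨y', hyy', hy'⟩ := exists_between hy
  obtain ⟨x', hx', hxy'⟩ := S.exists_mem_retardedTimes hkl hT (h1.trans hyy'.le) hy'
  have h0 := (S.lt l).le.trans h1
  have hyJ := S.mem_of_lt_isLUB hT h0 hy
  have hyJ' := S.mem_of_lt_isLUB hT (h0.trans hyy'.le) hy'
  refine ((S.timelike k).lt_left_of_gap_lt hx hx'.1 (g := q l) (b := y') ?_).trans_le (hs.1 hx')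
  rw [hxy', ← hxy]
  exact (S.timelike l).gap_lt_right hyJ hyJ' hyy'

/-- Near the limit `s` of the retarded times, the trajectory of `k` is already known and smooth,
also beyond `s`. Its momentum derivative minus the retarded field is therefore a smooth field `G`
across `s`, which equals the advanced field before `s` and generates the continuation of `l` after
it. -/
lemma exists_extension_of_interior (S : IsContinuation m e t0 t1 c J q p) (hkl : k ≠ l) {s T v : ℝ}
    (hT : IsLUB (J l) T) (hT1 : t1 l < T) (hv : v < 1)
    (hvel : ∀ t ∈ Ico (t0 l) T, ‖velocity (m l) (p l t)‖ ≤ v)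
    (hs : IsLUB (retardedTimes t1 J q k l T) s) (hsT : s < T) (hsk : ∃ x ∈ J k, s < x) :
    ∃ J' q' p', IsContinuation m e t0 t1 c J' q' p' ∧
      AgreeOn (fun k => Icc (t0 k) (t1 k)) q' p' q p ∧ ∃ t ∈ J' l, T < t := by
  classical
  obtain ⟨x', hx', hsx'⟩ := hsk
  have hcs := S.c_lt_of_isLUB hkl hT hT1 hs
  have hJs : J k ∈ 𝓝 s :=
    mem_of_superset (Icc_mem_nhds hcs hsx') (S.Icc_subset (S.c_mem k) hx')
  have hsJ := mem_of_mem_nhds hJs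
  obtain ⟨r, hr, hrs, -⟩ := S.exists_retarded hkl hsJ hcs.le
  have h0r := S.t0_lt_of_gap hkl hr hsJ hrs hcs
  have hrlt := S.lt_of_gap hkl.symm hr hsJ hrs
  have hIJ := S.Ico_subset_of_isLUB hT
  have hJr : J l ∈ 𝓝 r := mem_of_superset (Ico_mem_nhds h0r (hrlt.trans hsT)) hIJ
  have hqs : SmoothNear (q k) s := ContDiffOn.smoothNear (S.smooth_q k) hJs
  have hps : SmoothNear (p k) s := ContDiffOn.smoothNear (S.smooth_p k) hJs
  have hqr : SmoothNear (q l) r := ContDiffOn.smoothNear (S.smooth_q l) hJr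
  have hne := S.ne_of_gap hkl.symm hr hsJ hrs
  obtain ⟨τ, hτ, hτs, hτe, -⟩ := exists_retarded_function hqs hqr hne
    (by rw [(S.hasDerivAt hJr).deriv]; exact norm_velocity_lt_one (S.mass_pos l) _) hrs
  have hce : e k * e l ≠ 0 := mul_ne_zero (S.charge_ne k) (S.charge_ne l)
  let G : ℝ → Space := fun u => (e k * e l)⁻¹ • deriv (p k) u - coulomb (q k u - q l (τ u))
  have hG : SmoothNear G s := by
    refine (hps.smoothNear_deriv.const_smul _).sub (SmoothNear.comp ?_ (hqs.sub ?_))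
    · rw [hτs]; exact smoothNear_coulomb (sub_ne_zero.2 hne.symm)
    · exact SmoothNear.comp (hτs.symm ▸ hqr) hτ
  have hev : ∀ᶠ u in 𝓝 s, J k ∈ 𝓝 u ∧ τ u ∈ J l ∧ gap (q l) (q k) (τ u) u = 0 := by
    have : Tendsto τ (𝓝 s) (𝓝 r) := hτs ▸ hτ.continuousAt.tendsto
    filter_upwards [eventually_mem_nhds_iff.2 hJs, this.eventually hJr, hτe] with u h1 h2 h3
      using ⟨h1, h2, h3⟩
  have hQ : ∀ᶠ u in 𝓝 s, u ∈ J k ∧ q k u = q k u ∧ ∀ r ∈ J l, gap (q l) (q k) r u = 0 →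
      HasDerivWithinAt (p k) ((e k * e l) • (G u + coulomb (q k u - q l r))) (J k) u := by
    filter_upwards [hev] with u ⟨h1, h2, h3⟩
    refine ⟨mem_of_mem_nhds h1, rfl, fun r' hr' hru => ?_⟩
    obtain rfl : r' = τ u := (S.timelike l).eq_left hr' h2 (hru.trans h3.symm)
    simp only [G]
    rw [sub_add_cancel, smul_inv_smul₀ hce]
    exact (((S.smooth_p k).contDiffAt h1).differentiableAt (by simp)).hasDerivAt.hasDerivWithinAt
  -- the advanced times of particle `k`
  let a : ℝ → ℝ := fun u =>
    if h : ∃ b ∈ J l, b < T ∧ gap (q k) (q l) u b = 0 then h.choose else T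
  have haspec : ∀ᶠ u in 𝓝[<] s, a u ∈ J l ∧ a u < T ∧ gap (q k) (q l) u (a u) = 0 := by
    filter_upwards [nhdsWithin_le_nhds hev, self_mem_nhdsWithin] with u ⟨h1, h2, h3⟩ hus
    have hus : u < s := hus
    have huJ := mem_of_mem_nhds h1
    have h : ∃ b ∈ J l, b < T ∧ gap (q k) (q l) u b = 0 := by
      obtain ⟨x, ⟨hx, t, ht, -, htT, hxt⟩, hux⟩ := (lt_isLUB_iff hs).1 hus
      have hτt : τ u ≤ t :=
        (le_of_gap_eq_zero h3).trans (hux.le.trans (le_of_gap_eq_zero hxt))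
      obtain ⟨b, hb, hub⟩ := exists_gap_right (f := q k) (g := q l) (a := u) hτt
        ((S.continuousOn l).mono (S.Icc_subset h2 ht)) (gap_nonpos_of_le (le_of_gap_eq_zero h3))
        (by rw [← hxt]; exact ((S.timelike k).gap_lt_left huJ hx hux).le)
      exact ⟨b, S.Icc_subset h2 ht hb, hb.2.trans_lt htT, hub⟩
    simp only [a, dif_pos h]
    exact h.choose_spec
  have halt : ∀ y < T, t1 l ≤ y → ∀ᶠ u in 𝓝[<] s, y < a u := by
    intro y hy h1
    obtain ⟨x, hx, hxy⟩ := S.exists_mem_retardedTimes hkl hT h1 hy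
    have hxs := S.lt_of_mem_retardedTimes hkl hT hs h1 hy hx.1 hxy
    filter_upwards [haspec, Ioo_mem_nhdsLT hxs] with u hu hxu
    refine (S.timelike l).lt_right_of_gap_lt (f := q k) (a := u)
      (S.mem_of_lt_isLUB hT ((S.lt l).le.trans h1) hy) hu.1 ?_
    rw [hu.2.2, ← hxy]
    exact (S.timelike k).gap_lt_left hx.1 (S.Icc_subset hx.1 hsJ ⟨hxu.1.le, hxu.2.le⟩) hxu.1
  have haT : Tendsto a (𝓝[<] s) (𝓝 T) := by
    refine tendsto_order.2 ⟨fun y hy => ?_, fun y hy => ?_⟩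
    · filter_upwards [halt (max y (t1 l)) (max_lt hy hT1) (le_max_right _ _)] with u hu
        using (le_max_left _ _).trans_lt hu
    · filter_upwards [haspec] with u hu using hu.2.1.trans hy
  have hfield : ∀ᶠ u in 𝓝[<] s, coulomb (q k u - q l (a u)) = G u := by
    filter_upwards [haspec, nhdsWithin_le_nhds hev] with u hu ⟨h1, h2, h3⟩
    have huJ := mem_of_mem_nhds h1
    have := (S.hasDerivWithinAt_p hkl huJ h2 hu.1 h3 hu.2.2).hasDerivAt h1
    simp only [G]
    rw [this.deriv, force, inv_smul_smul₀ hce, add_sub_cancel_right]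
  -- The advanced field has the inverse square of the delay as its norm, and the delays near `s` are
  -- at most `T - c k`.
  have hG0 : G s ≠ 0 := by
    have hpos : 0 < ((T - c k) ^ 2)⁻¹ := by
      have : 0 < T - c k := by linarith
      positivity
    have : ((T - c k) ^ 2)⁻¹ ≤ ‖G s‖ := by
      refine ge_of_tendsto (hG.continuousAt.norm.mono_left nhdsWithin_le_nhds : Tendsto
        (fun u => ‖G u‖) (𝓝[<] s) (𝓝 ‖G s‖)) ?_
      filter_upwards [haspec, hfield, nhdsWithin_le_nhds hev, Ioo_mem_nhdsLT hcs]
        with u hu hf h1 hcu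
      have huJ := mem_of_mem_nhds h1.1
      have hlt := S.lt_of_gap hkl huJ hu.1 hu.2.2
      rw [← hf, norm_coulomb, norm_sub_rev, norm_of_gap_eq_zero hu.2.2]
      have h4 : 0 < a u - u := by linarith
      have h5 : a u - u ≤ T - c k := by linarith [hu.2.1, hcu.1]
      gcongr
    intro h0
    rw [h0, norm_zero] at this
    linarith
  have hlip := S.lipschitz_of_velocity_le ordConnected_Ico hIJ hvel
  obtain ⟨L, σ, hL, hσ, hσT, hL1, hLf, hσs, hLσ⟩ := exists_smooth_continuation (f := q l) (T := T)
    (a := a) (I := Ico (t0 l) T) hqs hG hG0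
    (by rw [(S.hasDerivAt hJs).deriv]; exact norm_velocity_lt_one (S.mass_pos k) _) hv hlip
    (mem_of_superset (Ioo_mem_nhdsLT ((S.lt l).trans hT1)) Ioo_subset_Ico_self)
    (by
      filter_upwards [haspec, hfield, halt (t1 l) hT1 le_rfl] with u h1 h2 h3
      exact ⟨⟨(S.lt l).le.trans h3.le, h1.2.1⟩, h1.2.2, h2⟩) haT
  exact S.exists_extension hkl hT (Or.inr hT1) hsT (nhdsWithin_le_nhds hQ) hL hσ hσT hL1 hLf hσs hLσ

lemma deriv_eq_velocity (S : IsContinuation m e t0 t1 c J q p) {Q : ℝ → Space}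
    (hQ : ContDiff ℝ ∞ Q) (h : EqOn Q (q k) (Icc (t0 k) (t1 k))) {t : ℝ}
    (ht : t ∈ Icc (t0 k) (t1 k)) : deriv Q t = velocity (m k) (p k t) := by
  have h1 : HasDerivWithinAt Q (deriv Q t) (Icc (t0 k) (t1 k)) t :=
    (hQ.differentiable (by simp) t).hasDerivAt.hasDerivWithinAt
  have h2 := ((S.velocity_eq k t (S.strip_subset k ht)).mono (S.strip_subset k)).congr h (h ht)
  exact (uniqueDiffOn_Icc (S.lt k) t ht).eq_deriv _ h1 h2

/-- To the left of `c k` the momentum equation is not available, since the retarded times leave the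
strip. There `G` is the Coulomb field `A` of the strip of `l`; to the right it is the field `B`
computed from the motion of `k`. The junction condition to all orders is what makes the glued field
smooth. -/
lemma exists_extension_of_junction (S : IsContinuation m e t0 t1 c J q p) (hkl : k ≠ l)
    (hT : IsLUB (J l) (t1 l)) (hsk : ∃ x ∈ J k, c k < x) :
    ∃ J' q' p', IsContinuation m e t0 t1 c J' q' p' ∧
      AgreeOn (fun k => Icc (t0 k) (t1 k)) q' p' q p ∧ ∃ t ∈ J' l, t1 l < t := by
  classical
  obtain ⟨x', hx', hsx'⟩ := hsk
  obtain ⟨Q, P, R, τA, τR, hQ, hP, hR, eQ, eP, eR, cA, cR, hAs, hRs, hAe, hRe, hn⟩ :=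
    S.junction k l hkl
  have hce : e k * e l ≠ 0 := mul_ne_zero (S.charge_ne k) (S.charge_ne l)
  have hsT : c k < t1 l := S.lt_of_gap hkl (S.c_mem k) (S.t1_mem l) (S.gap_right k l hkl)
  have l0 : t0 l ∈ Icc (t0 l) (t1 l) := left_mem_Icc.2 (S.lt l).le
  have l1 : t1 l ∈ Icc (t0 l) (t1 l) := right_mem_Icc.2 (S.lt l).le
  have hR0 : ‖deriv R (t0 l)‖ < 1 := by
    rw [S.deriv_eq_velocity hR eR l0]; exact norm_velocity_lt_one (S.mass_pos l) _
  have hR1 : ‖deriv R (t1 l)‖ < 1 := by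
    rw [S.deriv_eq_velocity hR eR l1]; exact norm_velocity_lt_one (S.mass_pos l) _
  have hQ1 : ‖deriv Q (c k)‖ < 1 := by
    rw [S.deriv_eq_velocity hQ eQ (S.mem k)]; exact norm_velocity_lt_one (S.mass_pos k) _
  have sR : ∀ t, SmoothNear R t := fun t => ContDiff.smoothNear hR t
  have sQ0 : SmoothNear Q (c k) := ContDiff.smoothNear hQ _
  have sP0 : SmoothNear P (c k) := ContDiff.smoothNear hP _
  -- smooth extensions of the strip of `k` that agree with the trajectory to the right of `c k`
  obtain ⟨q', p', sq', sp', hright, hleft⟩ : ∃ q' p' : ℝ → Space, SmoothNear q' (c k) ∧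
      SmoothNear p' (c k) ∧ (∀ᶠ u in 𝓝[≥] (c k), u ∈ J k ∧ q' u = q k u ∧ p' u = p k u) ∧
      ∀ᶠ u in 𝓝[<] (c k), q' u = Q u ∧ p' u = P u := by
    -- A junction before the end of the strip allows the extensions from the junction condition. A
    -- junction at the end requires the trajectory itself, which continues past it by assumption.
    rcases (S.mem k).2.lt_or_eq with h | h
    · refine ⟨Q, P, sQ0, sP0, ?_, Eventually.of_forall fun _ => ⟨rfl, rfl⟩⟩
      filter_upwards [Ico_mem_nhdsGE h] with u hu
      have hu' : u ∈ Icc (t0 k) (t1 k) := ⟨(S.mem k).1.trans hu.1, hu.2.le⟩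
      exact ⟨S.strip_subset k hu', eQ hu', eP hu'⟩
    · have hJ : J k ∈ 𝓝 (c k) := by
        refine mem_of_superset (Icc_mem_nhds (h ▸ S.lt k) hsx') (S.Icc_subset (S.t0_mem k) hx')
      refine ⟨q k, p k, ContDiffOn.smoothNear (S.smooth_q k) hJ,
        ContDiffOn.smoothNear (S.smooth_p k) hJ, ?_, ?_⟩
      · filter_upwards [nhdsWithin_le_nhds hJ] with u hu using ⟨hu, rfl, rfl⟩
      · filter_upwards [Ioo_mem_nhdsLT (h ▸ S.lt k : t0 k < c k)] with u hu
        have hu' : u ∈ Icc (t0 k) (t1 k) := ⟨hu.1.le, hu.2.le.trans h.le⟩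
        exact ⟨(eQ hu').symm, (eP hu').symm⟩
  have hq's : q' (c k) = q k (c k) := (hright.self_of_nhdsWithin self_mem_Ici).2.1
  have hQs : Q (c k) = q k (c k) := eQ (S.mem k)
  have hJge : J k ∈ 𝓝[≥] (c k) := hright.mono fun _ h => h.1
  have hq'1 : ‖deriv q' (c k)‖ < 1 := by
    have h1 : HasDerivWithinAt q' (deriv q' (c k)) (Ici (c k)) (c k) :=
      sq'.differentiableAt.hasDerivAt.hasDerivWithinAt
    have h2 := ((S.velocity_eq k _ (S.c_mem k)).mono_of_mem_nhdsWithin hJge).congr_of_eventuallyEq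
      (hright.mono fun _ h => h.2.1) hq's
    rw [(uniqueDiffOn_Ici (c k) _ self_mem_Ici).eq_deriv _ h1 h2]
    exact norm_velocity_lt_one (S.mass_pos k) _
  -- the delay functions
  have gR : gap Q R (c k) (t1 l) = 0 := by
    rw [← S.gap_right k l hkl, gap, gap, hQs, eR l1]
  have gL : gap R Q (t0 l) (c k) = 0 := by
    rw [← S.gap_left k l hkl, gap, gap, hQs, eR l0]
  have gL' : gap R q' (t0 l) (c k) = 0 := by
    rw [← S.gap_left k l hkl, gap, gap, hq's, eR l0]
  have neA : R (t1 l) ≠ Q (c k) := by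
    rw [hQs, eR l1]
    exact (S.ne_of_gap hkl (S.c_mem k) (S.t1_mem l) (S.gap_right k l hkl)).symm
  have neR : R (t0 l) ≠ Q (c k) := by
    rw [hQs, eR l0]
    exact S.ne_of_gap hkl.symm (S.t0_mem l) (S.c_mem k) (S.gap_left k l hkl)
  have gA : ∀ᶠ u in 𝓝 (c k), gap Q R u (τA u) = 0 := by
    filter_upwards [hAe] with u hu
    rw [gap, norm_sub_rev]; linarith
  have gRet : ∀ᶠ u in 𝓝 (c k), gap R Q (τR u) u = 0 := by
    filter_upwards [hRe] with u hu
    rw [gap]; linarith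
  have tA : Tendsto τA (𝓝 (c k)) (𝓝 (t1 l)) := hAs ▸ cA.continuousAt.tendsto
  have tR : Tendsto τR (𝓝 (c k)) (𝓝 (t0 l)) := hRs ▸ cR.continuousAt.tendsto
  -- The junction condition gives smoothness of the delay functions at one point only;
  -- identification with the implicit delay function gives it on a neighbourhood.
  have sA : SmoothNear τA (c k) := by
    obtain ⟨τ, h1, -, -, h4⟩ := exists_advanced_function sQ0 (sR _) neA hR1 gR
    refine h1.congr ?_
    filter_upwards [(tendsto_id.prodMk_nhds tA).eventually h4, gA] with u hu h0
      using (hu h0).symm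
  have sRet : SmoothNear τR (c k) := by
    obtain ⟨τ, h1, -, -, h4⟩ := exists_retarded_function sQ0 (sR _) neR hR0 gL
    refine h1.congr ?_
    filter_upwards [(tendsto_id.prodMk_nhds tR).eventually h4, gRet] with u hu h0
      using (hu h0).symm
  obtain ⟨τ, sτ, hτs, hτe, hτu⟩ := exists_retarded_function sq' (sR _)
    (by rw [hq's, ← hQs]; exact neR) hR0 gL'
  have tτ : Tendsto τ (𝓝 (c k)) (𝓝 (t0 l)) := hτs ▸ sτ.continuousAt.tendsto
  have hττR : ∀ᶠ u in 𝓝[<] (c k), τ u = τR u := by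
    filter_upwards [nhdsWithin_le_nhds ((tendsto_id.prodMk_nhds tR).eventually hτu),
      nhdsWithin_le_nhds gRet, hleft] with u h1 h2 h3
    refine h1 ?_
    simp only [id]
    rw [← h2, gap, gap, h3.1]
  -- the advanced field on both sides of the junction
  let A : ℝ → Space := fun u => coulomb (Q u - R (τA u))
  let B : ℝ → Space := fun u => (e k * e l)⁻¹ • deriv p' u - coulomb (q' u - R (τ u))
  let D : ℝ → Space := fun u => coulomb (Q u - R (τR u))
  let C : ℝ → Space := fun u => (e k * e l)⁻¹ • deriv P u - D u
  have smA : SmoothNear A (c k) := by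
    refine SmoothNear.comp ?_ (sQ0.sub (SmoothNear.comp (sR _) sA))
    rw [hAs]; exact smoothNear_coulomb (sub_ne_zero.2 neA.symm)
  have smD : SmoothNear D (c k) := by
    refine SmoothNear.comp ?_ (sQ0.sub (SmoothNear.comp (sR _) sRet))
    rw [hRs]; exact smoothNear_coulomb (sub_ne_zero.2 neR.symm)
  have smB : SmoothNear B (c k) := by
    refine (sp'.smoothNear_deriv.const_smul _).sub
      (SmoothNear.comp ?_ (sq'.sub (SmoothNear.comp (sR _) sτ)))
    rw [hτs, hq's, ← hQs]; exact smoothNear_coulomb (sub_ne_zero.2 neR.symm)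
  have smC : SmoothNear C (c k) := (sP0.smoothNear_deriv.const_smul _).sub smD
  have hBC : B =ᶠ[𝓝[<] (c k)] C := by
    have : ∀ᶠ u in 𝓝[<] (c k), deriv p' u = deriv P u := by
      filter_upwards [eventually_eventually_nhdsWithin.2 hleft, self_mem_nhdsWithin] with u hu hus
      rw [nhdsWithin_eq_nhds.2 (Iio_mem_nhds hus)] at hu
      exact EventuallyEq.deriv_eq (hu.mono fun _ h => h.2)
    filter_upwards [this, hleft, hττR] with u h1 h2 h3
    simp only [B, C, D]
    rw [h1, h2.1, h3]
  -- To the left, `B` coincides with the field `C` of the extended strips, so their derivatives at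
  -- `c k` agree. Those of `C` equal those of `A` by the junction equations, solved for the advanced
  -- field.
  have hjet : ∀ n, iteratedDeriv n A (c k) = iteratedDeriv n B (c k) := by
    intro n
    rw [iteratedDeriv_eq_of_eventuallyEq_left smB smC hBC n]
    have up : ∀ {f : ℝ → Space}, SmoothNear f (c k) → ContDiffAt ℝ n f (c k) := fun h =>
      h.contDiffAt.of_le (by exact_mod_cast le_top)
    have hF : (fun s => force (e k * e l) (Q s) (R (τA s)) (R (τR s))) =
        (e k * e l) • (A + D) := by
      funext s; simp [force, A, D]
    have hCe : C = (e k * e l)⁻¹ • deriv P - D := by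
      funext s; simp [C]
    have h2 := (hn n).2
    have hAD : ContDiffAt ℝ n (A + D) (c k) := (up smA).add (up smD)
    rw [hF, iteratedDeriv_const_smul hAD, iteratedDeriv_add (up smA) (up smD)] at h2
    have hcP : ContDiffAt ℝ n ((e k * e l)⁻¹ • deriv P) (c k) := by
      change ContDiffAt ℝ n (fun y => (e k * e l)⁻¹ • deriv P y) (c k)
      exact (up sP0.smoothNear_deriv).const_smul _
    rw [hCe, iteratedDeriv_sub hcP (up smD),
      iteratedDeriv_const_smul (up sP0.smoothNear_deriv), h2, inv_smul_smul₀ hce,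
      add_sub_cancel_right]
  let G : ℝ → Space := fun u => if u ≤ c k then A u else B u
  have smG : SmoothNear G (c k) := smoothNear_glue smA smB hjet
  have hG0 : G (c k) ≠ 0 := by
    simp only [G, le_refl, if_true, A, hAs]
    exact coulomb_ne_zero (sub_ne_zero.2 neA.symm)
  have hGge : ∀ u, c k ≤ u → G u = B u := by
    intro u hu
    rcases hu.eq_or_lt with rfl | h
    · simp only [G, le_refl, if_true]
      simpa using hjet 0
    · exact if_neg (not_le.2 h)
  -- the advanced times before the junction lie in the strip
  have hAin : ∀ᶠ u in 𝓝[<] (c k), τA u ∈ Ico (t0 l) (t1 l) := by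
    obtain ⟨w, hw1, hw2⟩ := exists_between hQ1
    obtain ⟨w', hw1', hw2'⟩ := exists_between hR1
    obtain ⟨ε, hε, hlQ⟩ := sQ0.exists_lipschitz hw1
    obtain ⟨ε', hε', hlR⟩ := (sR (t1 l)).exists_lipschitz hw1'
    filter_upwards [Ioo_mem_nhdsLT (sub_lt_self (c k) hε), nhdsWithin_le_nhds gA,
      nhdsWithin_le_nhds (tA.eventually (Ioo_mem_nhds (sub_lt_self _ hε')
        (lt_add_of_pos_right _ hε'))),
      nhdsWithin_le_nhds (tA.eventually (Ioi_mem_nhds (S.lt l)))] with u h1 h2 h3 h4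
    refine ⟨le_of_lt h4, ?_⟩
    have h5 := hlQ u ⟨h1.1, by linarith [h1.2]⟩ (c k) ⟨by linarith, by linarith⟩
    rw [abs_of_pos (sub_pos.2 h1.2)] at h5
    have := advanced_time_expansion hw2' hw2 h1.2 h5
      (hlR _ h3 (t1 l) ⟨by linarith, by linarith⟩) h2 gR
    have h6 : 0 < (1 - w) / 2 * (c k - u) := mul_pos (by linarith) (sub_pos.2 h1.2)
    linarith
  -- the retarded times after the junction lie in the strip
  have hRin : ∀ᶠ u in 𝓝[≥] (c k), τ u ∈ Icc (t0 l) (t1 l) ∧ gap R q' (τ u) u = 0 := by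
    obtain ⟨w, hw1, hw2⟩ := exists_between hR0
    obtain ⟨w', hw1', hw2'⟩ := exists_between hq'1
    obtain ⟨ε, hε, hlR⟩ := (sR (t0 l)).exists_lipschitz hw1
    obtain ⟨ε', hε', hlq⟩ := sq'.exists_lipschitz hw1'
    filter_upwards [Ico_mem_nhdsGE (lt_add_of_pos_right (c k) hε'), nhdsWithin_le_nhds hτe,
      nhdsWithin_le_nhds (tτ.eventually (Ioo_mem_nhds (sub_lt_self _ hε)
        (lt_add_of_pos_right _ hε))),
      nhdsWithin_le_nhds (tτ.eventually (Iio_mem_nhds (S.lt l)))] with u h1 h2 h3 h4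
    refine ⟨⟨le_of_not_gt fun hlt => ?_, le_of_lt h4⟩, h2⟩
    have h5 := hlR _ h3 (t0 l) ⟨by linarith, by linarith⟩
    rw [abs_of_pos (sub_pos.2 hlt)] at h5
    have := advanced_time_expansion hw2' hw2 hlt h5
      (hlq u ⟨by linarith [h1.1], h1.2⟩ (c k) ⟨by linarith, by linarith⟩) h2 gL'
    have h6 : 0 < (1 - w) / 2 * (t0 l - τ u) := mul_pos (by linarith) (sub_pos.2 hlt)
    linarith [h1.1]
  have hderiv : ∀ᶠ u in 𝓝[≥] (c k), HasDerivWithinAt (p k) (deriv p' u) (J k) u := by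
    obtain ⟨η, hη, H⟩ := mem_nhdsGE_iff_exists_Ico_subset.1
      (hright.and (nhdsWithin_le_nhds sp'))
    filter_upwards [Ico_mem_nhdsGE hη] with u hu
    obtain ⟨⟨huJ, -, hpu⟩, hsm⟩ := H hu
    have hsub : Ico u η ⊆ J k := fun x hx => (H ⟨hu.1.trans hx.1, hx.2⟩).1.1
    have d := ((S.smooth_p k).differentiableOn (by simp) u huJ).hasDerivWithinAt
    have d1 := (d.mono hsub).congr (fun x hx => (H ⟨hu.1.trans hx.1, hx.2⟩).1.2.2) hpu
    have d2 : HasDerivWithinAt p' (deriv p' u) (Ico u η) u :=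
      (hsm.differentiableAt (by simp)).hasDerivAt.hasDerivWithinAt
    rwa [(uniqueDiffOn_Ico u η u (left_mem_Ico.2 hu.2)).eq_deriv _ d1 d2] at d
  have hfin : ∀ᶠ u in 𝓝[≥] (c k), u ∈ J k ∧ q' u = q k u ∧ ∀ r ∈ J l, gap (q l) (q k) r u = 0 →
      HasDerivWithinAt (p k) ((e k * e l) • (G u + coulomb (q k u - q l r))) (J k) u := by
    filter_upwards [hright, hRin, hderiv, self_mem_nhdsWithin] with u h1 h2 h3 hu
    refine ⟨h1.1, h1.2.1, fun r hr hru => ?_⟩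
    have hτJ := S.strip_subset l h2.1
    have h4 : gap (q l) (q k) (τ u) u = 0 := by rw [← h2.2, gap, gap, eR h2.1, h1.2.1]
    obtain rfl : r = τ u := (S.timelike l).eq_left hr hτJ (hru.trans h4.symm)
    rw [hGge u hu]
    simp only [B]
    rw [h1.2.1, eR h2.1, sub_add_cancel, smul_inv_smul₀ hce]
    exact h3
  obtain ⟨v, hv, hvel⟩ := S.exists_speed_bound (S.strip_subset l)
  have hlip := S.lipschitz_of_velocity_le ordConnected_Icc (S.strip_subset l) hvel
  obtain ⟨L, σ, hL, hσ, hσT, hL1, hLf, hσs, hLσ⟩ := exists_smooth_continuation (f := q l)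
    (T := t1 l) (a := τA) (I := Icc (t0 l) (t1 l)) sq' smG hG0 hq'1 hv hlip
    (mem_of_superset (Ioo_mem_nhdsLT (S.lt l)) Ioo_subset_Icc_self)
    (by
      filter_upwards [hAin, nhdsWithin_le_nhds gA, hleft, self_mem_nhdsWithin] with u h1 h2 h3 hu
      have h1' := Ico_subset_Icc_self h1
      have hu : u ≤ c k := (show u < c k from hu).le
      refine ⟨h1', ?_, ?_⟩
      · rw [← h2, gap, gap, h3.1, eR h1']
      · simp only [G, if_pos hu, A]
        rw [h3.1, eR h1'])
    (tA.mono_left nhdsWithin_le_nhds)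
  exact S.exists_extension hkl hT (Or.inl (S.t1_mem l)) hsT hfin hL hσ hσT hL1 hLf hσs hLσ

end IsContinuation

/-! ### A maximal solution ends only where the bounds fail -/

/-- The solution contains all solutions with the same strips. -/
def IsMaximal (m e t0 t1 c : Fin 2 → ℝ) (J : Fin 2 → Set ℝ) (q p : Fin 2 → ℝ → Space) : Prop :=
  ∀ J' q' p', IsContinuation m e t0 t1 c J' q' p' →
    AgreeOn (fun k => Icc (t0 k) (t1 k)) q' p' q p → ∀ k, J' k ⊆ J k

/-- `B k ⊆ J k` are the time intervals of a part of a solution on `J` that obeys the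
bounds `(v, d)`. -/
structure IsBoundedPart (m t0 t1 : Fin 2 → ℝ) (J : Fin 2 → Set ℝ) (q p : Fin 2 → ℝ → Space)
    (v d : ℝ) (B : Fin 2 → Set ℝ) : Prop where
  subset : ∀ k, B k ⊆ J k
  ordConnected : ∀ k, (B k).OrdConnected
  strip_subset : ∀ k, Icc (t0 k) (t1 k) ⊆ B k
  reached_future : ∀ k l, k ≠ l → ∀ t ∈ B k, t1 k < t → ∃ s ∈ B l, gap (q l) (q k) s t = 0
  reached_past : ∀ k l, k ≠ l → ∀ t ∈ B k, t < t0 k → ∃ s ∈ B l, gap (q k) (q l) t s = 0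
  speed_le : ∀ k, ∀ t ∈ B k, ‖velocity (m k) (p k t)‖ ≤ v
  le_delay : ∀ k l, k ≠ l → ∀ a ∈ B k, ∀ b ∈ B l, gap (q k) (q l) a b = 0 → d ≤ b - a

lemma IsBoundedPart.rev {m t0 t1 : Fin 2 → ℝ} {J B : Fin 2 → Set ℝ} {q p : Fin 2 → ℝ → Space}
    {v d : ℝ} (h : IsBoundedPart m t0 t1 J q p v d B) :
    IsBoundedPart m (-t1) (-t0) (revSet J) (revPos q) (revMom p) v d (revSet B) where
  subset k _ ht := h.subset k ht
  ordConnected k := ⟨fun _ hx _ hy _ hz =>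
    (h.ordConnected k).out hy hx ⟨neg_le_neg hz.2, neg_le_neg hz.1⟩⟩
  strip_subset k t ht := h.strip_subset k ⟨le_neg.1 ht.2, neg_le.1 ht.1⟩
  reached_future k l hkl t ht h1 := by
    obtain ⟨s, hs, h0⟩ := h.reached_past k l hkl (-t) ht (neg_lt.1 h1)
    exact ⟨-s, by simpa [mem_revSet] using hs, by rw [gap_revPos, neg_neg, h0]⟩
  reached_past k l hkl t ht h1 := by
    obtain ⟨s, hs, h0⟩ := h.reached_future k l hkl (-t) ht (lt_neg.1 h1)
    exact ⟨-s, by simpa [mem_revSet] using hs, by rw [gap_revPos, neg_neg, h0]⟩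
  speed_le k t ht := by
    rw [revMom, velocity_neg, norm_neg]; exact h.speed_le k _ ht
  le_delay k l hkl a ha b hb hab := by
    rw [gap_revPos] at hab
    have := h.le_delay l k hkl.symm (-b) hb (-a) ha hab
    linarith

namespace IsContinuation

variable {m e t0 t1 c : Fin 2 → ℝ} {J J' B : Fin 2 → Set ℝ} {q p q' p' : Fin 2 → ℝ → Space}
  {k l : Fin 2} {v d : ℝ}

lemma _root_.TwoBodyDelay.IsMaximal.rev (h : IsMaximal m e t0 t1 c J q p) :
    IsMaximal m e (-t1) (-t0) (-c) (revSet J) (revPos q) (revMom p) := by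
  intro J' q' p' S' hag k t ht
  have S := S'.rev
  simp only [neg_neg] at S
  refine h _ _ _ S ?_ k (by simpa [mem_revSet] using ht)
  have := hag.rev
  rw [revSet_Icc] at this
  simpa using this

/-- If `k` is known beyond the limit of the retarded times, `l` can be extended. Otherwise `k` ends
there, earlier than `l` by at least `d`; then `l` is known beyond what an extension of `k` requires,
and `k` can be extended. Either way maximality is violated. -/
lemma not_isLUB_of_bounds (S : IsContinuation m e t0 t1 c J q p)
    (hmax : IsMaximal m e t0 t1 c J q p) (hkl : k ≠ l) {T : ℝ} (hT : IsLUB (J l) T)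
    (hv : v < 1) (hd : 0 < d) (hvl : ∀ t ∈ Ico (t0 l) T, ‖velocity (m l) (p l t)‖ ≤ v)
    (hvk : ∀ x ∈ J k, t0 k ≤ x → (∃ y ∈ retardedTimes t1 J q k l T, x < y) →
      ‖velocity (m k) (p k x)‖ ≤ v)
    (hdl : ∀ x ∈ J k, ∀ t ∈ J l, t1 l ≤ t → t < T → gap (q k) (q l) x t = 0 → d ≤ t - x)
    (hdk : ∀ r ∈ J l, ∀ x ∈ J k, t1 k ≤ x → (∃ y ∈ retardedTimes t1 J q k l T, x < y) →
      gap (q l) (q k) r x = 0 → d ≤ x - r) : False := by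
  have contra : ∀ {n : Fin 2} {T : ℝ}, IsLUB (J n) T →
      ¬ ∃ J' q' p', IsContinuation m e t0 t1 c J' q' p' ∧
      AgreeOn (fun k => Icc (t0 k) (t1 k)) q' p' q p ∧ ∃ t ∈ J' n, T < t := by
    rintro n T hT ⟨J', q', p', S', hag, t, ht, hTt⟩
    exact absurd (hT.1 (hmax J' q' p' S' hag n ht)) (not_le.2 hTt)
  rcases (S.t1_le_of_isLUB hT).eq_or_lt with rfl | hT1
  · by_cases hk : ∃ x ∈ J k, c k < x
    · exact contra hT (S.exists_extension_of_junction hkl hT hk)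
    · push Not at hk
      -- Here `k` ends at its own junction, and `l` has times after `c l`, for instance `t1 l`; so
      -- the trajectory of `k` is the one to extend.
      have hck : c k = t1 k := le_antisymm (S.mem k).2 (hk _ (S.t1_mem k))
      have hTk : IsLUB (J k) (t1 k) :=
        ⟨fun x hx => hck ▸ hk x hx, fun b hb => hb (S.t1_mem k)⟩
      refine contra hTk (S.exists_extension_of_junction hkl.symm hTk ⟨t1 l, S.t1_mem l, ?_⟩)
      refine (S.timelike l).lt_right_of_gap_lt (f := q k) (a := t0 k) (S.c_mem l) (S.t1_mem l) ?_
      rw [S.gap_left l k hkl.symm, ← S.gap_right k l hkl]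
      exact (S.timelike k).gap_lt_left (S.t0_mem k) (S.c_mem k) (hck ▸ S.lt k)
  · have hle : ∀ x ∈ retardedTimes t1 J q k l T, x ≤ T - d := by
      rintro x ⟨hx, t, ht, h1t, htT, hxt⟩
      linarith [hdl x hx t ht h1t htT hxt]
    obtain ⟨x0, hx0, -⟩ := S.exists_mem_retardedTimes hkl hT le_rfl hT1
    have hs := isLUB_csSup ⟨x0, hx0⟩ ⟨T - d, hle⟩
    set s := sSup (retardedTimes t1 J q k l T)
    have hsT : s ≤ T - d := hs.2 hle
    by_cases hk : ∃ x ∈ J k, s < x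
    · exact contra hT (S.exists_extension_of_interior hkl hT hT1 hv hvl hs (by linarith) hk)
    push Not at hk
    have hTk : IsLUB (J k) s := ⟨hk, fun b hb => hs.2 fun x hx => hb hx.1⟩
    rcases (S.t1_le_of_isLUB hTk).eq_or_lt with h1 | h1
    · rw [← h1] at hTk
      obtain ⟨x, hx, h1x⟩ := (lt_isLUB_iff hT).1 hT1
      exact contra hTk (S.exists_extension_of_junction hkl.symm hTk
        ⟨x, hx, (S.mem l).2.trans_lt h1x⟩)
    · have hle' : ∀ r ∈ retardedTimes t1 J q l k s, r ≤ s - d := by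
        rintro r ⟨hr, x, hx, h1x, hxs, hrx⟩
        linarith [hdk r hr x hx h1x ((lt_isLUB_iff hs).1 hxs) hrx]
      obtain ⟨r0, hr0, -⟩ := S.exists_mem_retardedTimes hkl.symm hTk le_rfl h1
      have hr := isLUB_csSup ⟨r0, hr0⟩ ⟨s - d, hle'⟩
      have hrs : sSup (retardedTimes t1 J q l k s) ≤ s - d := hr.2 hle'
      refine contra hTk (S.exists_extension_of_interior hkl.symm hTk h1 hv (fun x hx => ?_) hr
        (by linarith) ((lt_isLUB_iff hT).1 (by linarith)))
      exact hvk x (S.mem_of_lt_isLUB hTk hx.1 hx.2) hx.1 ((lt_isLUB_iff hs).1 hx.2)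

/-- If a last time were attained, the relevant histories would be compact, so bounds with some
constants would hold up to the end. -/
lemma exists_gt_of_isMaximal (S : IsContinuation m e t0 t1 c J q p)
    (hmax : IsMaximal m e t0 t1 c J q p) {T : ℝ} (hT : T ∈ J l) : ∃ t ∈ J l, T < t := by
  by_contra hno
  push Not at hno
  obtain ⟨k, hlk⟩ := exists_other l
  have hkl := hlk.symm
  have hLUB : IsLUB (J l) T := ⟨hno, fun b hb => hb hT⟩
  have h1T := S.t1_le_of_isLUB hLUB
  obtain ⟨s, hs, hsT, -⟩ := S.exists_retarded hlk hT ((S.mem l).2.trans h1T)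
  have hJl := S.Icc_subset (S.t0_mem l) hT
  have hJk := S.Icc_subset (S.t0_mem k) hs
  obtain ⟨v, hv, hvl⟩ := S.exists_speed_bound hJl
  obtain ⟨v', hv', hvk⟩ := S.exists_speed_bound hJk
  obtain ⟨d, hd, hdl⟩ := S.exists_delay hkl hJk hJl
  obtain ⟨d', hd', hdk⟩ := S.exists_delay hlk hJl hJk
  have hret : ∀ x ∈ J k, ∀ t ∈ J l, gap (q k) (q l) x t = 0 → x ≤ s := by
    intro x hx t ht hxt
    refine (S.timelike k).le_left_of_gap_le hx hs (g := q l) (b := t) ?_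
    rw [hxt, ← hsT]
    exact (S.timelike l).gap_le_right ht hT (hno t ht)
  refine S.not_isLUB_of_bounds hmax hkl hLUB (max_lt hv hv') (lt_min hd hd')
    (fun t ht => (hvl t ⟨ht.1, ht.2.le⟩).trans (le_max_left _ _)) ?_ ?_ ?_
  · rintro x hx h0 ⟨y, ⟨hy, t, ht, -, -, hyt⟩, hxy⟩
    exact (hvk x ⟨h0, hxy.le.trans (hret y hy t ht hyt)⟩).trans (le_max_right _ _)
  · intro x hx t ht h1 htT hxt
    exact (min_le_left _ _).trans (hdl x ⟨S.t0_le_of_gap hlk hx ht hxt ((S.mem l).2.trans h1),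
      hret x hx t ht hxt⟩ t ⟨(S.lt l).le.trans h1, htT.le⟩ hxt)
  · rintro r hr x hx h1 ⟨y, ⟨hy, t, ht, -, -, hyt⟩, hxy⟩ hrx
    exact (min_le_right _ _).trans (hdk r ⟨S.t0_le_of_gap hkl hr hx hrx ((S.mem k).2.trans h1),
      hno r hr⟩ x ⟨(S.lt k).le.trans h1, hxy.le.trans (hret y hy t ht hyt)⟩ hrx)

/-! ### Closures and unions of bounded parts -/

lemma mem_of_mem_closure (hB : IsBoundedPart m t0 t1 J q p v d B) {T t : ℝ}
    (hT : T ∈ closure (B l)) (h0 : t0 l ≤ t) (h1 : t0 l ≤ t1 l) (h : t < T) : t ∈ B l := by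
  obtain ⟨b, htb, hb⟩ := mem_closure_iff.1 hT (Ioi t) isOpen_Ioi h
  exact (hB.ordConnected l).out (hB.strip_subset l (left_mem_Icc.2 h1)) hb ⟨h0, le_of_lt htb⟩

lemma retarded_mem (S : IsContinuation m e t0 t1 c J q p)
    (hB : IsBoundedPart m t0 t1 J q p v d B) (hkl : k ≠ l) {x t : ℝ} (hx : x ∈ J k) (ht : t ∈ B l)
    (h1 : t1 l ≤ t) (hxt : gap (q k) (q l) x t = 0) : x ∈ B k := by
  rcases h1.eq_or_lt with rfl | h1
  · rw [(S.timelike k).eq_left hx (S.c_mem k) (hxt.trans (S.gap_right k l hkl).symm)]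
    exact hB.strip_subset k (S.mem k)
  · obtain ⟨s, hs, hst⟩ := hB.reached_future l k hkl.symm t ht h1
    rwa [(S.timelike k).eq_left hx (hB.subset k hs) (hxt.trans hst.symm)]

/-- A limit point outside `J l` would be the least upper bound of `J l`, with the bounds holding all
the way up to it; a maximal solution does not end like that. -/
lemma closure_future_subset (S : IsContinuation m e t0 t1 c J q p)
    (hmax : IsMaximal m e t0 t1 c J q p) (hB : IsBoundedPart m t0 t1 J q p v d B) (hv : v < 1)
    (hd : 0 < d) {T : ℝ} (hT : T ∈ closure (B l)) (h1 : t1 l < T) : T ∈ J l := by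
  by_contra hno
  obtain ⟨k, hlk⟩ := exists_other l
  have hkl := hlk.symm
  have hLUB : IsLUB (J l) T := by
    refine ⟨fun y hy => le_of_not_gt fun h => hno (S.Icc_subset (S.t1_mem l) hy ⟨h1.le, h.le⟩),
      fun b hb => ?_⟩
    exact closure_minimal (fun x hx => hb (hB.subset l hx)) isClosed_Iic hT
  have hBl : ∀ t, t0 l ≤ t → t < T → t ∈ B l := fun t h0 h =>
    mem_of_mem_closure hB hT h0 (S.lt l).le h
  have hBk : ∀ x, t0 k ≤ x → (∃ y ∈ retardedTimes t1 J q k l T, x < y) → x ∈ B k := by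
    rintro x h0 ⟨y, ⟨hy, t, ht, h1t, htT, hyt⟩, hxy⟩
    exact (hB.ordConnected k).out (hB.strip_subset k (left_mem_Icc.2 (S.lt k).le))
      (S.retarded_mem hB hkl hy (hBl t ((S.lt l).le.trans h1t) htT) h1t hyt) ⟨h0, hxy.le⟩
  refine S.not_isLUB_of_bounds hmax hkl hLUB hv hd
    (fun t ht => hB.speed_le l t (hBl t ht.1 ht.2))
    (fun x _ h0 hy => hB.speed_le k x (hBk x h0 hy)) (fun x hx t ht h1t htT hxt => ?_)
    fun r hr x hx h1x hy hrx => ?_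
  · have htB := hBl t ((S.lt l).le.trans h1t) htT
    exact hB.le_delay k l hkl x (S.retarded_mem hB hkl hx htB h1t hxt) t htB hxt
  · have hxB := hBk x ((S.lt k).le.trans h1x) hy
    exact hB.le_delay l k hlk r (S.retarded_mem hB hlk hr hxB h1x hrx) x hxB hrx

/-- Slightly earlier times of the bounded part have retarded times slightly before `s`, by
continuity and monotonicity of the gap. Retarded times and delay bounds thereby pass to the closure.
-/
lemma exists_approx (S : IsContinuation m e t0 t1 c J q p)
    (hB : IsBoundedPart m t0 t1 J q p v d B) (hkl : k ≠ l) {s t x : ℝ} (ht : t ∈ closure (B k))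
    (htJ : t ∈ J k) (h1 : t1 k < t) (hs : s ∈ J l) (hst : gap (q l) (q k) s t = 0) (hx : x < s) :
    ∃ t' ∈ B k, t' < t ∧ ∃ s' ∈ B l, x < s' ∧ s' < s ∧ gap (q l) (q k) s' t' = 0 := by
  have h0s : t0 l < s := (S.mem l).1.trans_lt (S.c_lt_of_gap hkl hs htJ hst h1)
  obtain ⟨y, hy, hys⟩ := exists_between (max_lt hx h0s)
  obtain ⟨hxy, h0y⟩ := max_lt_iff.1 hy
  have hyJ := S.Icc_subset (S.t0_mem l) hs ⟨h0y.le, hys.le⟩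
  have hpos : 0 < gap (q l) (q k) y t := by
    rw [← hst]; exact (S.timelike l).gap_lt_left hyJ hs hys
  have hcont : Tendsto (fun u => gap (q l) (q k) y u) (𝓝[<] t) (𝓝 (gap (q l) (q k) y t)) := by
    refine (continuousOn_gap_right (S.continuousOn k) y t htJ).mono_left ?_
    refine nhdsWithin_le_of_mem ?_
    filter_upwards [Ioo_mem_nhdsLT h1] with u hu
      using S.Icc_subset (S.t1_mem k) htJ ⟨hu.1.le, hu.2.le⟩
  obtain ⟨t', ht'pos, h1t', ht't⟩ :=
    ((hcont.eventually (Ioi_mem_nhds hpos)).and (Ioo_mem_nhdsLT h1)).exists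
  have ht'B := mem_of_mem_closure hB ht ((S.lt k).le.trans h1t'.le) (S.lt k).le ht't
  obtain ⟨s', hs', hst'⟩ := hB.reached_future k l hkl t' ht'B h1t'
  refine ⟨t', ht'B, ht't, s', hs', hxy.trans ?_, ?_, hst'⟩
  · refine (S.timelike l).lt_left_of_gap_lt hyJ (hB.subset l hs') (g := q k) (b := t') ?_
    rw [hst']; exact ht'pos
  · refine (S.timelike l).lt_left_of_gap_lt (hB.subset l hs') hs (g := q k) (b := t) ?_
    rw [hst, ← hst']
    exact (S.timelike k).gap_lt_right (hB.subset k ht'B) htJ ht't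

lemma closure_reached_future (S : IsContinuation m e t0 t1 c J q p)
    (hmax : IsMaximal m e t0 t1 c J q p) (hB : IsBoundedPart m t0 t1 J q p v d B) (hv : v < 1)
    (hd : 0 < d) (hkl : k ≠ l) {t : ℝ} (ht : t ∈ closure (B k)) (h1 : t1 k < t) :
    ∃ s ∈ closure (B l), gap (q l) (q k) s t = 0 := by
  have htJ := S.closure_future_subset hmax hB hv hd ht h1
  obtain ⟨s, hs, hst, -⟩ := S.exists_retarded hkl htJ ((S.mem k).2.trans h1.le)
  refine ⟨s, Metric.mem_closure_iff.2 fun ε hε => ?_, hst⟩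
  obtain ⟨-, -, -, s', hs', h3, h4, -⟩ :=
    S.exists_approx hB hkl ht htJ h1 hs hst (sub_lt_self s hε)
  refine ⟨s', hs', ?_⟩
  rw [Real.dist_eq, abs_of_pos (sub_pos.2 h4)]
  linarith

lemma closure_le_delay (S : IsContinuation m e t0 t1 c J q p)
    (hmax : IsMaximal m e t0 t1 c J q p) (hB : IsBoundedPart m t0 t1 J q p v d B) (hv : v < 1)
    (hd : 0 < d) (hkl : k ≠ l) {s t : ℝ} (ht : t ∈ closure (B k)) (h1 : t1 k < t) (hs : s ∈ J l)
    (hst : gap (q l) (q k) s t = 0) : d ≤ t - s := by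
  by_contra hlt
  have htJ := S.closure_future_subset hmax hB hv hd ht h1
  obtain ⟨t', ht', htt', s', hs', h3, h4, hst'⟩ :=
    S.exists_approx hB hkl ht htJ h1 hs hst (x := t - d) (by linarith)
  linarith [hB.le_delay l k hkl.symm s' hs' t' ht' hst']

lemma closure_revSet (B : Fin 2 → Set ℝ) (k : Fin 2) :
    closure (revSet B k) = revSet (fun k => closure (B k)) k :=
  ((Homeomorph.neg ℝ).preimage_closure (B k)).symm

lemma strips_of_gap (S : IsContinuation m e t0 t1 c J q p) (hkl : k ≠ l) {a b : ℝ} (ha : a ∈ J k)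
    (hb : b ∈ J l) (hab : gap (q k) (q l) a b = 0) (ha0 : t0 k ≤ a) (hb1 : b ≤ t1 l) :
    a ∈ Icc (t0 k) (t1 k) ∧ b ∈ Icc (t0 l) (t1 l) := by
  refine ⟨⟨ha0, le_trans ?_ (S.mem k).2⟩, ⟨(S.mem l).1.trans ?_, hb1⟩⟩
  · refine (S.timelike k).le_left_of_gap_le ha (S.c_mem k) (g := q l) (b := t1 l) ?_
    rw [S.gap_right k l hkl, ← hab]
    exact (S.timelike l).gap_le_right hb (S.t1_mem l) hb1
  · refine (S.timelike l).le_right_of_gap_le (f := q k) (a := t0 k) (S.c_mem l) hb ?_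
    rw [S.gap_left l k hkl.symm, ← hab]
    exact (S.timelike k).gap_le_left (S.t0_mem k) ha ha0

/-- The future follows by approximation and the past by reversal; a light-like pair that extends
beyond the strips on neither side lies in the strips, where the bounds are those of `B`. -/
lemma isBoundedPart_closure (S : IsContinuation m e t0 t1 c J q p)
    (hmax : IsMaximal m e t0 t1 c J q p) (hB : IsBoundedPart m t0 t1 J q p v d B) (hv : v < 1)
    (hd : 0 < d) : IsBoundedPart m t0 t1 J q p v d (fun k => closure (B k)) := by
  have hrev : ∀ k t, t ∈ closure (B k) → -t ∈ closure (revSet B k) := fun k t ht => by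
    rw [closure_revSet]; simpa [mem_revSet] using ht
  have hsub : ∀ k, closure (B k) ⊆ J k := by
    intro k t ht
    rcases lt_or_ge (t1 k) t with h1 | h1
    · exact S.closure_future_subset hmax hB hv hd ht h1
    rcases lt_or_ge t (t0 k) with h0 | h0
    · have := S.rev.closure_future_subset hmax.rev hB.rev hv hd (hrev k t ht) (neg_lt_neg h0)
      simpa [mem_revSet] using this
    · exact S.strip_subset k ⟨h0, h1⟩
  refine ⟨hsub, fun k => ?_, fun k => (hB.strip_subset k).trans subset_closure,
    fun k l hkl t ht h1 => S.closure_reached_future hmax hB hv hd hkl ht h1,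
    fun k l hkl t ht h0 => ?_, fun k t ht => ?_, fun k l hkl a ha b hb hab => ?_⟩
  · exact ((hB.ordConnected k).convex.closure).ordConnected
  · obtain ⟨s, hs, hst⟩ := S.rev.closure_reached_future hmax.rev hB.rev hv hd hkl (hrev k t ht)
      (neg_lt_neg h0)
    rw [gap_revPos, neg_neg] at hst
    rw [closure_revSet] at hs
    exact ⟨-s, hs, hst⟩
  · have hc : ContinuousOn (fun t => ‖velocity (m k) (p k t)‖) (closure (B k)) :=
      ((contDiff_velocity (S.mass_pos k)).continuous.comp_continuousOn
        ((S.smooth_p k).continuousOn.mono (hsub k))).norm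
    exact ContinuousWithinAt.closure_le ht ((hc t ht).mono subset_closure)
      continuousWithinAt_const (fun x hx => hB.speed_le k x hx)
  · rcases lt_or_ge (t1 l) b with h1 | h1
    · exact S.closure_le_delay hmax hB hv hd hkl.symm hb h1 (hsub k ha) hab
    rcases lt_or_ge a (t0 k) with h0 | h0
    · have := S.rev.closure_le_delay hmax.rev hB.rev hv hd hkl (hrev k a ha) (neg_lt_neg h0)
        (s := -b) (by simpa [mem_revSet] using hsub l hb) (by rw [gap_revPos]; simpa using hab)
      linarith
    · obtain ⟨h2, h3⟩ := S.strips_of_gap hkl (hsub k ha) (hsub l hb) hab h0 h1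
      exact hB.le_delay k l hkl a (hB.strip_subset k h2) b (hB.strip_subset l h3) hab

/-- The two times of a light-like pair may come from different parts, but outside the strips the
part containing the outer time also contains its delayed time, so a single part supplies the bound.
-/
lemma isBoundedPart_iUnion (S : IsContinuation m e t0 t1 c J q p)
    (hB : IsBoundedPart m t0 t1 J q p v d B) :
    IsBoundedPart m t0 t1 J q p v d
      (fun k => {t | ∃ B, IsBoundedPart m t0 t1 J q p v d B ∧ t ∈ B k}) := by
  refine ⟨?_, ?_, ?_, ?_, ?_, ?_, ?_⟩
  · rintro k t ⟨A, hA, ht⟩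
    exact hA.subset k ht
  · refine fun k => ⟨?_⟩
    rintro x ⟨A, hA, hx⟩ y ⟨A', hA', hy⟩ z hz
    have hr : t1 k ∈ Icc (t0 k) (t1 k) := right_mem_Icc.2 (S.lt k).le
    rcases le_total z (t1 k) with h | h
    · exact ⟨A, hA, (hA.ordConnected k).out hx (hA.strip_subset k hr) ⟨hz.1, h⟩⟩
    · exact ⟨A', hA', (hA'.ordConnected k).out (hA'.strip_subset k hr) hy ⟨h, hz.2⟩⟩
  · exact fun k t ht => ⟨B, hB, hB.strip_subset k ht⟩
  · rintro k l hkl t ⟨A, hA, ht⟩ h1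
    obtain ⟨s, hs, hst⟩ := hA.reached_future k l hkl t ht h1
    exact ⟨s, ⟨A, hA, hs⟩, hst⟩
  · rintro k l hkl t ⟨A, hA, ht⟩ h1
    obtain ⟨s, hs, hst⟩ := hA.reached_past k l hkl t ht h1
    exact ⟨s, ⟨A, hA, hs⟩, hst⟩
  · rintro k t ⟨A, hA, ht⟩
    exact hA.speed_le k t ht
  · rintro k l hkl a ⟨A, hA, ha⟩ b ⟨A', hA', hb⟩ hab
    have haJ := hA.subset k ha
    have hbJ := hA'.subset l hb
    rcases lt_or_ge (t1 l) b with h1 | h1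
    · exact hA'.le_delay k l hkl a (S.retarded_mem hA' hkl haJ hb h1.le hab) b hb hab
    rcases lt_or_ge a (t0 k) with h0 | h0
    · obtain ⟨s, hs, hst⟩ := hA.reached_past k l hkl a ha h0
      obtain rfl : s = b := (S.timelike l).eq_right (hA.subset l hs) hbJ (hst.trans hab.symm)
      exact hA.le_delay k l hkl a ha s hs hab
    · obtain ⟨h2, h3⟩ := S.strips_of_gap hkl haJ hbJ hab h0 h1
      exact hB.le_delay k l hkl a (hB.strip_subset k h2) b (hB.strip_subset l h3) hab

/-- The distance at a delayed time is the delay itself, so the distance bound becomes a bound on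
delays. -/
lemma obeysBounds_iff (S : IsContinuation m e t0 t1 c J q p) :
    ObeysBounds v d J q ↔ (∀ k, ∀ t ∈ J k, ‖velocity (m k) (p k t)‖ ≤ v) ∧
      ∀ k l, k ≠ l → ∀ a ∈ J k, ∀ b ∈ J l, gap (q k) (q l) a b = 0 → d ≤ b - a := by
  have hd : ∀ k, ∀ t ∈ J k, derivWithin (q k) (J k) t = velocity (m k) (p k t) := fun k t ht =>
    (S.velocity_eq k t ht).derivWithin (S.uniqueDiffOn k t ht)
  constructor
  · rintro ⟨h1, h2⟩
    refine ⟨fun k t ht => hd k t ht ▸ h1 k t ht, fun k l hkl a ha b hb hab => ?_⟩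
    have := h2 k l hkl a ha b (Or.inl (isAdvancedTime_iff.2 ⟨hb, hab⟩))
    rwa [norm_sub_rev, norm_of_gap_eq_zero hab] at this
  · rintro ⟨h1, h2⟩
    refine ⟨fun k t ht => (hd k t ht).symm ▸ h1 k t ht, fun k l hkl t ht s hs => ?_⟩
    rcases hs with hs | hs
    · obtain ⟨hs, h0⟩ := isAdvancedTime_iff.1 hs
      rw [norm_sub_rev, norm_of_gap_eq_zero h0]
      exact h2 k l hkl t ht s hs h0
    · obtain ⟨hs, h0⟩ := isRetardedTime_iff.1 hs
      rw [norm_of_gap_eq_zero h0]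
      exact h2 l k hkl.symm s hs t ht h0

lemma isBoundedPart_of_solution (S : IsContinuation m e t0 t1 c J q p)
    (hmax : IsMaximal m e t0 t1 c J q p) (S' : IsContinuation m e t0 t1 c J' q' p')
    (hag : AgreeOn (fun k => Icc (t0 k) (t1 k)) q' p' q p) (hb : ObeysBounds v d J' q') :
    IsBoundedPart m t0 t1 J q p v d J' := by
  have hsub := hmax J' q' p' S' hag
  have heq : ∀ k, ∀ t ∈ J' k, q' k t = q k t ∧ p' k t = p k t := fun k t ht =>
    S.unique S' hag k t ⟨hsub k ht, ht⟩
  have hgap : ∀ k l, ∀ a ∈ J' k, ∀ b ∈ J' l,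
      gap (q' k) (q' l) a b = gap (q k) (q l) a b := fun k l a ha b hb => by
    rw [gap, gap, (heq k a ha).1, (heq l b hb).1]
  obtain ⟨h1, h2⟩ := S'.obeysBounds_iff.1 hb
  refine ⟨hsub, S'.ordConnected, S'.strip_subset, fun k l hkl t ht h => ?_,
    fun k l hkl t ht h => ?_, fun k t ht => (heq k t ht).2 ▸ h1 k t ht,
    fun k l hkl a ha b hb hab => h2 k l hkl a ha b hb (by rw [hgap k l a ha b hb, hab])⟩
  · obtain ⟨s, hs⟩ := S'.reached_future k l hkl t ht h
    obtain ⟨hs, h0⟩ := isRetardedTime_iff.1 hs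
    exact ⟨s, hs, by rw [← hgap l k s hs t ht, h0]⟩
  · obtain ⟨s, hs⟩ := S'.reached_past k l hkl t ht h
    obtain ⟨hs, h0⟩ := isAdvancedTime_iff.1 hs
    exact ⟨s, hs, by rw [← hgap k l t ht s hs, h0]⟩

lemma restrict_isBoundedPart (S : IsContinuation m e t0 t1 c J q p)
    (hB : IsBoundedPart m t0 t1 J q p v d B) :
    IsContinuation m e t0 t1 c B q p ∧ ObeysBounds v d B q := by
  have S' := S.restrict hB.subset hB.ordConnected hB.strip_subset hB.reached_future hB.reached_past
  exact ⟨S', S'.obeysBounds_iff.2 ⟨hB.speed_le, hB.le_delay⟩⟩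

/-! ### Existence of the delayed times -/

/-- If `J l` is bounded above, `t` precedes the retarded time of its last point, so the gap has
become nonnegative there. If not, the speed bound makes the gap grow without limit. The intermediate
value theorem concludes in both cases. -/
lemma exists_advanced (S : IsContinuation m e t0 t1 c J q p) (hkl : k ≠ l)
    (hcl : IsClosed (J l)) (hv : v < 1) (hvel : ∀ t ∈ J l, ‖velocity (m l) (p l t)‖ ≤ v) {t : ℝ}
    (ht : t ∈ J k) (hb : ∀ b, IsGreatest (J l) b → ∀ s ∈ J k, gap (q k) (q l) s b = 0 → t < s) :
    ∃ s ∈ J l, gap (q k) (q l) t s = 0 := by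
  rcases lt_or_ge t (t0 k) with h0 | h0
  · obtain ⟨s, hs⟩ := S.reached_past k l hkl t ht h0
    obtain ⟨hs, hts⟩ := isAdvancedTime_iff.1 hs
    exact ⟨s, hs, hts⟩
  have hlow : gap (q k) (q l) t (t0 l) ≤ 0 := by
    rw [← S.gap_left l k hkl.symm]
    exact ((S.timelike k).gap_le_left (S.t0_mem k) ht h0).trans
      ((S.timelike l).gap_le_right (S.t0_mem l) (S.c_mem l) (S.mem l).1)
  suffices ∃ y ∈ J l, t0 l ≤ y ∧ 0 ≤ gap (q k) (q l) t y by
    obtain ⟨y, hy, h0y, hpos⟩ := this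
    have hsub := S.Icc_subset (S.t0_mem l) hy
    obtain ⟨s, hs, hts⟩ := exists_gap_right h0y ((S.continuousOn l).mono hsub) hlow hpos
    exact ⟨s, hsub hs, hts⟩
  by_cases hbdd : BddAbove (J l)
  · have hg : IsGreatest (J l) (sSup (J l)) :=
      ⟨hcl.csSup_mem ⟨_, S.t0_mem l⟩ hbdd, fun x hx => le_csSup hbdd hx⟩
    obtain ⟨s, hs, hsb, -⟩ :=
      S.exists_retarded hkl.symm hg.1 ((S.mem l).2.trans (hg.2 (S.t1_mem l)))
    refine ⟨_, hg.1, hg.2 (S.t0_mem l), ?_⟩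
    rw [← hsb]
    exact (S.timelike k).gap_le_left ht hs (hb _ hg s hs hsb).le
  -- The gap from `t` to `y` is at least `(1 - v) * y - (t - v * t0 l + ‖q l (t0 l) - q k t‖)`,
  -- which is positive beyond this threshold.
  · obtain ⟨y, hy, hlt⟩ := not_bddAbove_iff.1 hbdd
      (max (t0 l) ((t - v * t0 l + ‖q l (t0 l) - q k t‖) / (1 - v)))
    obtain ⟨h1, h2⟩ := max_lt_iff.1 hlt
    refine ⟨y, hy, h1.le, ?_⟩
    rw [div_lt_iff₀ (by linarith)] at h2
    have h3 := S.lipschitz_of_velocity_le (S.ordConnected l) Subset.rfl hvel _ (S.t0_mem l) _ hy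
    rw [abs_of_pos (sub_pos.2 h1)] at h3
    have h4 : ‖q l y - q k t‖ ≤ ‖q l y - q l (t0 l)‖ + ‖q l (t0 l) - q k t‖ :=
      norm_sub_le_norm_sub_add_norm_sub ..
    rw [gap]
    nlinarith

lemma solvesAt_of_mem_equationDomain (S : IsContinuation m e t0 t1 c J q p) (hkl : k ≠ l)
    (hcl : IsClosed (J l)) (hv : v < 1) (hvel : ∀ t ∈ J l, ‖velocity (m l) (p l t)‖ ≤ v) {t : ℝ}
    (ht : t ∈ equationDomain J q k l) : SolvesAt m e J q p k l t := by
  obtain ⟨htJ, hmin, hmax⟩ := ht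
  obtain ⟨b, hb, htb⟩ := S.exists_advanced hkl hcl hv hvel htJ fun b hg s hs hsb =>
    hmax b hg s (isRetardedTime_iff.2 ⟨hs, hsb⟩)
  obtain ⟨a, ha, hat⟩ := S.rev.exists_advanced (t := -t) hkl
    (hcl.preimage continuous_neg) hv
    (fun t ht => by rw [revMom, velocity_neg, norm_neg]; exact hvel _ ht)
    (by simpa [mem_revSet] using htJ) (fun b hg s hs hsb => by
      rw [gap_revPos] at hsb
      have hl : IsLeast (J l) (-b) :=
        ⟨hg.1, fun x hx => neg_le.1 (hg.2 (by simpa [mem_revSet] using hx))⟩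
      have := hmin (-b) hl (-s) (isAdvancedTime_iff.2 ⟨hs, hsb⟩)
      linarith)
  rw [gap_revPos, neg_neg] at hat
  have ha : -a ∈ J l := ha
  obtain ⟨h1, h2, h3⟩ := S.momentum_eq k l hkl t htJ b (-a) (isAdvancedTime_iff.2 ⟨hb, htb⟩)
    (isRetardedTime_iff.2 ⟨ha, hat⟩)
  exact ⟨S.velocity_eq k t htJ, b, -a, isAdvancedTime_iff.2 ⟨hb, htb⟩,
    isRetardedTime_iff.2 ⟨ha, hat⟩, h1, h2, h3⟩

lemma exists_admissibleConstants
    (S : IsContinuation m e t0 t1 c (fun k => Icc (t0 k) (t1 k)) q p) :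
    ∃ v d : ℝ, AdmissibleConstants t0 t1 q v d := by
  have h01 : ∀ n : Fin 2, n = 0 ∨ n = 1 := by decide
  have hne : (0 : Fin 2) ≠ 1 := by decide
  obtain ⟨v, hv, hv0⟩ := S.exists_speed_bound (k := 0) Subset.rfl
  obtain ⟨v', hv', hv1⟩ := S.exists_speed_bound (k := 1) Subset.rfl
  obtain ⟨d, hd, hd0⟩ := S.exists_delay hne Subset.rfl Subset.rfl
  obtain ⟨d', hd', hd1⟩ := S.exists_delay hne.symm Subset.rfl Subset.rfl
  refine ⟨max 0 (max v v'), min d d', le_max_left _ _, max_lt one_pos (max_lt hv hv'),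
    lt_min hd hd', S.obeysBounds_iff.2 ⟨fun k t ht => ?_, fun k l hkl a ha b hb hab => ?_⟩⟩
  · rcases h01 k with rfl | rfl
    · exact (hv0 t ht).trans ((le_max_left _ _).trans (le_max_right _ _))
    · exact (hv1 t ht).trans ((le_max_right _ _).trans (le_max_right _ _))
  · rcases h01 k with rfl | rfl <;> rcases h01 l with rfl | rfl
    exacts [absurd rfl hkl, (min_le_left _ _).trans (hd0 a ha b hb hab),
      (min_le_right _ _).trans (hd1 a ha b hb hab), absurd rfl hkl]

end IsContinuation

lemma AgreeOn.symm {I : Fin 2 → Set ℝ} {q p q' p' : Fin 2 → ℝ → Space}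
    (h : AgreeOn I q p q' p') : AgreeOn I q' p' q p :=
  fun k t ht => ⟨(h k t ht).1.symm, (h k t ht).2.symm⟩

lemma AgreeOn.trans {I : Fin 2 → Set ℝ} {q p q' p' q'' p'' : Fin 2 → ℝ → Space}
    (h : AgreeOn I q p q' p') (h' : AgreeOn I q' p' q'' p'') : AgreeOn I q p q'' p'' :=
  fun k t ht => ⟨(h k t ht).1.trans (h' k t ht).1, (h k t ht).2.trans (h' k t ht).2⟩

end TwoBodyDelay

open TwoBodyDelay

theorem theorem1 (m e : Fin 2 → ℝ) (hm : ∀ k, 0 < m k) (he : ∀ k, e k ≠ 0)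
    (i j : Fin 2) (hij : i ≠ j) (t0 t1 : Fin 2 → ℝ)
    (q0 p0 : Fin 2 → ℝ → TwoBodyDelay.Space)
    (hinit : TwoBodyDelay.IsInitialData m e i j t0 t1 q0 p0) :
    -- admissible constants exist
    (∃ v d : ℝ, TwoBodyDelay.AdmissibleConstants t0 t1 q0 v d) ∧
    ∀ v d : ℝ, TwoBodyDelay.AdmissibleConstants t0 t1 q0 v d →
      -- smooth trajectories on closed intervals `J k = [Tmin k, Tmax k]`
      ∃ (J : Fin 2 → Set ℝ) (q p : Fin 2 → ℝ → TwoBodyDelay.Space),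
        (∀ k, IsClosed (J k)) ∧
        TwoBodyDelay.IsSolution m e t0 t1 J q p ∧
        -- (i) they extend the initial strips
        TwoBodyDelay.AgreeOn (fun k => Set.Icc (t0 k) (t1 k)) q p q0 p0 ∧
        -- (ii) they solve the equations of motion on the intervals between the delayed end points
        (∀ k l, k ≠ l → ∀ t ∈ TwoBodyDelay.equationDomain J q k l,
          TwoBodyDelay.SolvesAt m e J q p k l t) ∧
        -- (iii) uniqueness
        (∀ (J' : Fin 2 → Set ℝ) (q' p' : Fin 2 → ℝ → TwoBodyDelay.Space),
          TwoBodyDelay.IsSolution m e t0 t1 J' q' p' →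
          (TwoBodyDelay.AgreeOn (fun k => J k ∩ J' k) q' p' q p ↔
            TwoBodyDelay.AgreeOn (fun k => Set.Icc (t0 k) (t1 k)) q' p' q p)) ∧
        -- the bounds hold, and the intervals are the largest ones on which they hold
        TwoBodyDelay.ObeysBounds v d J q ∧
        (∀ (J' : Fin 2 → Set ℝ) (q' p' : Fin 2 → ℝ → TwoBodyDelay.Space),
          TwoBodyDelay.IsSolution m e t0 t1 J' q' p' →
          TwoBodyDelay.AgreeOn (fun k => Set.Icc (t0 k) (t1 k)) q' p' q0 p0 →
          TwoBodyDelay.ObeysBounds v d J' q' → ∀ k, J' k ⊆ J k) ∧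
        -- only the bounds end the intervals: the solution itself continues past finite end points
        ((∃ k, BddAbove (J k)) →
          ∃ (J' : Fin 2 → Set ℝ) (q' p' : Fin 2 → ℝ → TwoBodyDelay.Space),
            TwoBodyDelay.IsSolution m e t0 t1 J' q' p' ∧ (∀ k, J k ⊆ J' k) ∧
            TwoBodyDelay.AgreeOn J q' p' q p ∧ ∃ l, ∃ s ∈ J' l, ∀ t ∈ J l, t < s) ∧
        ((∃ k, BddBelow (J k)) →
          ∃ (J' : Fin 2 → Set ℝ) (q' p' : Fin 2 → ℝ → TwoBodyDelay.Space),
            TwoBodyDelay.IsSolution m e t0 t1 J' q' p' ∧ (∀ k, J k ⊆ J' k) ∧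
            TwoBodyDelay.AgreeOn J q' p' q p ∧ ∃ l, ∃ s ∈ J' l, ∀ t ∈ J l, s < t) := by
  obtain ⟨c, S0⟩ := hinit.exists_isContinuation hm he hij
  refine ⟨S0.exists_admissibleConstants, fun v d ⟨_, hv, hd, hobeys⟩ => ?_⟩
  obtain ⟨M, q, p, S, hag, hlargest⟩ := S0.exists_maximal
  have hag' : AgreeOn (fun k => Icc (t0 k) (t1 k)) q0 p0 q p := hag.symm
  have hmax : IsMaximal m e t0 t1 c M q p := fun J' q' p' S' h =>
    hlargest J' q' p' S' (h.trans hag)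
  have hU := S.isBoundedPart_iUnion (S.isBoundedPart_of_solution hmax S0 hag' hobeys)
  set J : Fin 2 → Set ℝ := fun k => {t | ∃ B, IsBoundedPart m t0 t1 M q p v d B ∧ t ∈ B k}
  have hclosed : ∀ k, IsClosed (J k) := fun k =>
    -- The closure of the union is itself one of the bounded parts, hence contained in the union.
    isClosed_of_closure_subset fun t ht => ⟨_, S.isBoundedPart_closure hmax hU hv hd, ht⟩
  obtain ⟨SJ, hob⟩ := S.restrict_isBoundedPart hU
  refine ⟨J, q, p, hclosed, SJ.toIsSolution, hag, fun k l hkl t ht =>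
    SJ.solvesAt_of_mem_equationDomain hkl (hclosed l) hv (hU.speed_le l) ht,
    fun J' q' p' S' => ⟨fun h k t ht => h k t ⟨SJ.strip_subset k ht, S'.strip_subset k ht⟩,
      fun h => SJ.unique (SJ.congr S' h) h⟩, hob, fun J' q' p' S' h hb k t ht =>
    ⟨J', S.isBoundedPart_of_solution hmax (S0.congr S' h) (h.trans hag') hb, ht⟩, ?_, ?_⟩
  · rintro ⟨k, hk⟩
    have hT := (hclosed k).csSup_mem ⟨_, SJ.t0_mem k⟩ hk
    obtain ⟨s, hs, hTs⟩ := S.exists_gt_of_isMaximal hmax (hU.subset k hT)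
    -- The maximal solution serves as the extension: the last time of `J k` belongs to `M k`, which
    -- has no last time.
    exact ⟨M, q, p, S.toIsSolution, hU.subset, fun _ _ _ => ⟨rfl, rfl⟩, k, s, hs,
      fun t ht => (le_csSup hk ht).trans_lt hTs⟩
  · rintro ⟨k, hk⟩
    have hT := (hclosed k).csInf_mem ⟨_, SJ.t0_mem k⟩ hk
    obtain ⟨s, hs, hTs⟩ := S.rev.exists_gt_of_isMaximal hmax.rev (l := k) (T := -sInf (J k))
      (by simpa [mem_revSet] using hU.subset k hT)
    exact ⟨M, q, p, S.toIsSolution, hU.subset, fun _ _ _ => ⟨rfl, rfl⟩, k, -s, hs,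
      fun t ht => (neg_lt.1 hTs).trans_le (csInf_le hk ht)⟩
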